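/- Let $p$ be a prime and let $\mathbb{G}$ be a compact $p$-adic Lie group of dimension $d\ge 1$, realized as a (closed) subgroup of $\mathrm{GL}_m(\mathbb{Z}_p)$, with normalized Haar measure $dx$ (write $|A|$ for the measure of $A$) and identity $e$. For $n\in\mathbb{N}_0$ let $\mathbb{G}_n:=\mathbb{G}\cap(I_m+p^nM_m(\mathbb{Z}_p))$, so $\mathbb{G}_0=\mathbb{G}$, and put $\|x\|_p:=|\mathbb{G}_n|^{1/d}$ for $x\in\mathbb{G}_n\setminus\mathbb{G}_{n+1}$, $\|e\|_p:=0$. For $1<r<\infty$ and $\alpha\in\mathbb{R}$ let $L^r_\alpha(\mathbb{G}):=L^r(\mathbb{G},\|x\|_p^{\alpha}dx)$. Let $\mathrm{Rep}(\mathbb{G})$ be the continuous finite-dimensional unitary representations of $\mathbb{G}$ and $\widehat{\mathbb{G}}$ its unitary dual; $d_\pi$ is the dimension of $\pi$. For $\pi\in\mathrm{Rep}(\mathbb{G})$ let $n_\pi:=\min\{n:\pi|_{\mathbb{G}_n}=I_{d_\pi}\}$ and $\|\pi\|_p:=|\mathbb{G}_{n_\pi}|^{-1/d}$ if $n_\pi>0$,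 $\|\pi\|_p:=0$ if $n_\pi=0$. A symbol $\sigma$ assigns to each $\pi\in\mathrm{Rep}(\mathbb{G})$ a linear operator $\sigma(\pi)$ on the space of $\pi$, compatibly with unitary equivalence and direct sums (so it is determined by its values on $\widehat{\mathbb{G}}$). For $\beta\ge 0$ and $\eta,\xi\in\widehat{\mathbb{G}}$ let $$\Delta_\eta\sigma(\xi):=\sigma(\eta\otimes\xi)-\sigma(I_{d_\eta}\otimes\xi),\qquad \Delta^\beta_\eta\sigma(\xi):=\|\eta\|_p^{-\beta}\,\Delta_\eta\sigma(\xi),$$ where $I_{d_\eta}$ is the trivial representation of dimension $d_\eta$ (and $\Delta^\beta_\eta\sigma(\xi):=0$ for trivial $\eta$, for which $\Delta_\eta\sigma=0$). On the space $\mathcal{D}(\mathbb{G})$ of functions $f:\mathbb{G}\to\mathbb{C}$ that are right invariant under some $\mathbb{G}_l$, the Fourier multiplier $T_\sigma$ is $$T_\sigma f(x)=\sum_{[\pi]\in\widehat{\mathbb{G}}}d_\pi\,\mathrm{Tr}\big[\pi(x)\sigma(\pi)\widehat f(\pi)\big],\qquad \widehat f(\pi)=\int_{\mathbb{G}}f(x)\pi(x)^*\,dx.$$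 **Theorem.** Let $\sigma$ be a symbol with $\sup_{[\xi]\in\widehat{\mathbb{G}}}\|\sigma(\xi)\|_{op}<\infty$. 1. If for some $\alpha_0>\frac d2$ there is a constant $C>0$ such that $$\big\|\Delta_\eta^{\alpha_0+\frac d2}\sigma(\xi)\big\|_{op}\le C\,\|\xi\|_p^{-(\alpha_0+\frac d2)}\qquad\text{for all }\eta,\xi\in\widehat{\mathbb{G}}\text{ with }\|\eta\|_p<\|\xi\|_p,$$ then $T_\sigma$ extends from $\mathcal{D}(\mathbb{G})$ to a bounded operator on $L^r(\mathbb{G})$ for every $1<r<\infty$. 2. Let $1<t<2$. If for some $\alpha_0>d\left(\frac1t-\frac12\right)$ there is a constant $C>0$ such that $$\big\|\Delta_\eta^{\alpha_0+\frac d2}\sigma(\xi)\big\|_{op}\le C\,\|\xi\|_p^{-\left(\alpha_0+d\left(\frac32-\frac1t\right)\right)}\qquad\text{for all }\eta,\xi\in\widehat{\mathbb{G}}\text{ with }\|\eta\|_p<\|\xi\|_p,$$ then $T_\sigma$ extends from $\mathcal{D}(\mathbb{G})$ to a bounded operator on $L^r_\alpha(\mathbb{G})$ for every $1<r<\infty$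 and every $\alpha$ with $-d<\alpha<(r-1)d$. -/

import Mathlib

open MeasureTheory
open scoped Matrix Kronecker ENNReal Manifold ContDiff

noncomputable section

namespace PadicMultiplier

/-- The `n`-th principal congruence subgroup of a group `G` realized as a matrix group through
`ρ : G →* GL_m(ℤ_p)`, that is, `G ∩ (I_m + p ^ n M_m(ℤ_p))`. For `n = 0` this is `G` itself. -/
def congruenceFiltration {p : ℕ} [Fact p.Prime] {m : ℕ} {G : Type*} [Group G]
    (ρ : G →* Matrix.GeneralLinearGroup (Fin m) ℤ_[p]) (n : ℕ) : Subgroup G :=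
  ((Matrix.GeneralLinearGroup.map (n := Fin m) (PadicInt.toZModPow (p := p) n)).ker).comap ρ

section Norms

variable {G : Type*} [Group G] [MeasurableSpace G]

open Classical in
/-- The ultrametric `|x|` attached to a decreasing sequence of subgroups with trivial intersection:
`|x| = |G_n|` (Haar measure) if `x ∈ G_n \ G_{n+1}`, and `|e| = 0`. -/
def groupAbs (μ : Measure G) (F : ℕ → Subgroup G) (x : G) : ℝ :=
  if x = 1 then 0 else μ.real (F (sSup {n | x ∈ F n}) : Set G)

/-- `‖x‖_p = |x| ^ (1 / d)`. -/
def groupNorm (μ : Measure G) (F : ℕ → Subgroup G) (d : ℕ) (x : G) : ℝ :=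
  groupAbs μ F x ^ (1 / (d : ℝ))

/-- The weighted measure `μ_α(A) = ∫_A ‖x‖_p ^ α dx`. The space `L^r_α` is `L^r(μ_α)`. -/
def weightedMeasure (μ : Measure G) (F : ℕ → Subgroup G) (d : ℕ) (α : ℝ) : Measure G :=
  μ.withDensity fun x => ENNReal.ofReal (groupNorm μ F d x ^ α)

end Norms

/-- A continuous finite-dimensional unitary representation in matrix form, with rows and columns
indexed by the finite type `ι`. -/
structure UnitaryRep (G : Type*) [Group G] [TopologicalSpace G]
    (ι : Type) [Fintype ι] [DecidableEq ι] where
  toHom : G →* Matrix ι ι ℂ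
  unitary : ∀ x, toHom x ∈ Matrix.unitaryGroup ι ℂ
  continuous_toHom : Continuous toHom

section Rep

variable {G : Type*} [Group G] [TopologicalSpace G]
variable {ι κ : Type} [Fintype ι] [DecidableEq ι] [Fintype κ] [DecidableEq κ]

namespace UnitaryRep

/-- The identity representation `I_{d}` on `ℂ^ι`. -/
def one (G : Type*) [Group G] [TopologicalSpace G] (ι : Type) [Fintype ι] [DecidableEq ι] :
    UnitaryRep G ι where
  toHom := 1
  unitary _ := one_mem _
  continuous_toHom := continuous_const

/-- The direct sum `π ⊕ π'` (block diagonal matrices). -/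
def sum (π : UnitaryRep G ι) (π' : UnitaryRep G κ) : UnitaryRep G (ι ⊕ κ) where
  toHom :=
    { toFun := fun x => Matrix.fromBlocks (π.toHom x) 0 0 (π'.toHom x)
      map_one' := by simp
      map_mul' := by intro x y; simp [Matrix.fromBlocks_multiply] }
  unitary x := by
    have h1 := Matrix.mem_unitaryGroup_iff.1 (π.unitary x)
    have h2 := Matrix.mem_unitaryGroup_iff.1 (π'.unitary x)
    rw [Matrix.mem_unitaryGroup_iff]
    rw [Matrix.star_eq_conjTranspose] at *
    simp [Matrix.fromBlocks_conjTranspose, Matrix.fromBlocks_multiply, h1, h2]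
  continuous_toHom :=
    Continuous.matrix_fromBlocks π.continuous_toHom continuous_const continuous_const
      π'.continuous_toHom

/-- The tensor product `π ⊗ π'` (Kronecker product of matrices). -/
def tensor (π : UnitaryRep G ι) (π' : UnitaryRep G κ) : UnitaryRep G (ι × κ) where
  toHom :=
    { toFun := fun x => π.toHom x ⊗ₖ π'.toHom x
      map_one' := by simp
      map_mul' := by intro x y; simp [Matrix.mul_kronecker_mul] }
  unitary x := Matrix.kronecker_mem_unitary (π.unitary x) (π'.unitary x)
  continuous_toHom := by
    refine continuous_matrix fun i j => ?_
    exact (π.continuous_toHom.matrix_elem i.1 j.1).mul (π'.continuous_toHom.matrix_elem i.2 j.2)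

/-- Irreducibility: the space is nonzero and has no proper nonzero invariant subspace. -/
def Irreducible (π : UnitaryRep G ι) : Prop :=
  Nonempty ι ∧ ∀ W : Submodule ℂ (ι → ℂ),
    (∀ x, ∀ v ∈ W, π.toHom x *ᵥ v ∈ W) → W = ⊥ ∨ W = ⊤

/-- `U` is a unitary matrix with `π' = U π U*`. -/
def IsUnitaryEquiv (U : Matrix κ ι ℂ) (π : UnitaryRep G ι) (π' : UnitaryRep G κ) : Prop :=
  U * Uᴴ = 1 ∧ Uᴴ * U = 1 ∧ ∀ x, π'.toHom x = U * π.toHom x * Uᴴ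

/-- `n_π = min {n : π is trivial on G_n}`. -/
def level (F : ℕ → Subgroup G) (π : UnitaryRep G ι) : ℕ :=
  sInf {n | ∀ x ∈ F n, π.toHom x = 1}

/-- The dual ultrametric: `|π| = 0` if `n_π = 0`, and `|π| = |G_{n_π}|⁻¹` otherwise. -/
def abs [MeasurableSpace G] (μ : Measure G) (F : ℕ → Subgroup G) (π : UnitaryRep G ι) : ℝ :=
  if π.level F = 0 then 0 else (μ.real (F (π.level F) : Set G))⁻¹

/-- `‖π‖_p = |π| ^ (1 / d)`. -/
def norm [MeasurableSpace G] (μ : Measure G) (F : ℕ → Subgroup G) (d : ℕ)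
    (π : UnitaryRep G ι) : ℝ :=
  π.abs μ F ^ (1 / (d : ℝ))

/-- The group Fourier transform `f̂(π) = ∫ f(x) π(x)* dx`. -/
def fourier [MeasurableSpace G] (μ : Measure G) (f : G → ℂ) (π : UnitaryRep G ι) :
    Matrix ι ι ℂ :=
  Matrix.of fun i j => ∫ x, f x * (π.toHom x)ᴴ i j ∂μ

end UnitaryRep

/-- An irreducible continuous unitary matrix representation, of dimension `dim`. -/
structure Irrep (G : Type*) [Group G] [TopologicalSpace G] where
  dim : ℕ
  rep : UnitaryRep G (Fin dim)
  irreducible : rep.Irreducible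

/-- Unitary equivalence of irreducible representations. -/
def irrepSetoid (G : Type*) [Group G] [TopologicalSpace G] : Setoid (Irrep G) where
  r ξ η := ∃ U : Matrix (Fin η.dim) (Fin ξ.dim) ℂ, UnitaryRep.IsUnitaryEquiv U ξ.rep η.rep
  iseqv :=
    { refl := fun ξ => ⟨1, by simp [UnitaryRep.IsUnitaryEquiv]⟩
      symm := by
        rintro ξ η ⟨U, h1, h2, h3⟩
        refine ⟨Uᴴ, by simpa using h2, by simpa using h1, fun x => ?_⟩
        rw [h3 x, Matrix.conjTranspose_conjTranspose]
        calc ξ.rep.toHom x = (Uᴴ * U) * ξ.rep.toHom x * (Uᴴ * U) := by simp [h2]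
          _ = Uᴴ * (U * ξ.rep.toHom x * Uᴴ) * U := by simp only [Matrix.mul_assoc]
      trans := by
        rintro ξ η ζ ⟨U, h1, h2, h3⟩ ⟨V, k1, k2, k3⟩
        refine ⟨V * U, ?_, ?_, fun x => ?_⟩
        · rw [Matrix.conjTranspose_mul]
          calc V * U * (Uᴴ * Vᴴ) = V * (U * Uᴴ) * Vᴴ := by simp only [Matrix.mul_assoc]
            _ = 1 := by simp [h1, k1]
        · rw [Matrix.conjTranspose_mul]
          calc Uᴴ * Vᴴ * (V * U) = Uᴴ * (Vᴴ * V) * U := by simp only [Matrix.mul_assoc]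
            _ = 1 := by simp [h2, k2]
        · rw [k3 x, h3 x, Matrix.conjTranspose_mul]
          simp only [Matrix.mul_assoc] }

/-- The unitary dual `Ĝ`. -/
def UnitaryDual (G : Type*) [Group G] [TopologicalSpace G] : Type _ :=
  Quotient (irrepSetoid G)

/-- A chosen matrix realization of a class in the unitary dual. -/
def UnitaryDual.out (c : UnitaryDual G) : Irrep G := Quotient.out c

/-- A symbol: an assignment `π ↦ σ(π) ∈ L(H_π)` on `Rep(G)`, given on matrix realizations,
compatible with unitary equivalence and with direct sums. Such a `σ` is the same thing as a family
of operators on the classes of the unitary dual, extended to `Rep(G)` by direct sums. -/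
structure Symbol (G : Type*) [Group G] [TopologicalSpace G] where
  toFun : ∀ {ι : Type} [Fintype ι] [DecidableEq ι], UnitaryRep G ι → Matrix ι ι ℂ
  equiv : ∀ {ι κ : Type} [Fintype ι] [DecidableEq ι] [Fintype κ] [DecidableEq κ]
    (U : Matrix κ ι ℂ) (π : UnitaryRep G ι) (π' : UnitaryRep G κ),
    UnitaryRep.IsUnitaryEquiv U π π' → toFun π' = U * toFun π * Uᴴ
  sum : ∀ {ι κ : Type} [Fintype ι] [DecidableEq ι] [Fintype κ] [DecidableEq κ]
    (π : UnitaryRep G ι) (π' : UnitaryRep G κ),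
    toFun (π.sum π') = Matrix.fromBlocks (toFun π) 0 0 (toFun π')

/-- The operator norm of a matrix with respect to the Euclidean norm. -/
def opNorm (A : Matrix ι ι ℂ) : ℝ := ‖Matrix.toEuclideanCLM (𝕜 := ℂ) A‖

namespace Symbol

/-- `σ ∈ L^∞(Ĝ)`: the operator norms `‖σ(ξ)‖_op`, `[ξ] ∈ Ĝ`, are bounded. -/
def IsBounded (σ : Symbol G) : Prop :=
  ∃ B : ℝ, ∀ ξ : Irrep G, opNorm (σ.toFun ξ.rep) ≤ B

/-- The difference operator `Δ_η σ(ξ) = σ(η ⊗ ξ) - σ(I_{d_η} ⊗ ξ)`. -/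
def diff (σ : Symbol G) (η : UnitaryRep G ι) (ξ : UnitaryRep G κ) :
    Matrix (ι × κ) (ι × κ) ℂ :=
  σ.toFun (η.tensor ξ) - σ.toFun ((UnitaryRep.one G ι).tensor ξ)

variable [MeasurableSpace G]

/-- The weighted difference operator `Δ_η^β σ(ξ) = ‖η‖_p ^ (-β) Δ_η σ(ξ)`. (It vanishes for the
trivial `η`, for which `Δ_η = 0`.) -/
def wdiff (μ : Measure G) (F : ℕ → Subgroup G) (d : ℕ) (β : ℝ) (σ : Symbol G)
    (η : UnitaryRep G ι) (ξ : UnitaryRep G κ) : Matrix (ι × κ) (ι × κ) ℂ :=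
  ((1 / η.norm μ F d ^ β : ℝ) : ℂ) • σ.diff η ξ

/-- The Fourier multiplier `T_σ f(x) = ∑_{[π] ∈ Ĝ} d_π Tr[π(x) σ(π) f̂(π)]`. For a smooth `f`
only finitely many terms are nonzero; the terms do not depend on the chosen realizations. -/
def multiplier (μ : Measure G) (σ : Symbol G) (f : G → ℂ) (x : G) : ℂ :=
  ∑' c : UnitaryDual G, (c.out.dim : ℂ) *
    (c.out.rep.toHom x * σ.toFun c.out.rep * c.out.rep.fourier μ f).trace

end Symbol

end Rep

/-- The space `D(G)` of smooth functions: `f(x y) = f(x)` for all `y` in some `G_l`. -/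
def IsSmooth {G : Type*} [Group G] (F : ℕ → Subgroup G) (f : G → ℂ) : Prop :=
  ∃ l, ∀ x, ∀ y ∈ F l, f (x * y) = f x

/-- An operator `T`, given on the smooth functions, extends to a bounded linear operator on
`L^r(ν)`, `1 ≤ r < ∞`; this includes that smooth functions and their images lie in `L^r(ν)`. -/
def ExtendsToBounded {G : Type*} [Group G] [MeasurableSpace G] (F : ℕ → Subgroup G)
    (T : (G → ℂ) → G → ℂ) (ν : Measure G) (r : ℝ) (hr : 1 ≤ r) : Prop :=
  haveI : Fact (1 ≤ ENNReal.ofReal r) := ⟨ENNReal.one_le_ofReal.2 hr⟩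
  ∃ S : Lp ℂ (ENNReal.ofReal r) ν →L[ℂ] Lp ℂ (ENNReal.ofReal r) ν,
    ∀ f : G → ℂ, IsSmooth F f →
      ∃ (hf : MemLp f (ENNReal.ofReal r) ν) (hTf : MemLp (T f) (ENNReal.ofReal r) ν),
        S (hf.toLp f) = hTf.toLp (T f)

end PadicMultiplier

end

/-!
Write `|x|` for the ultrametric of the congruence filtration `G = G_0 ⊇ G_1 ⊇ …` and put
`a = α / d`; the dimension `d` only rescales exponents. Both difference conditions say that
`‖Δ_η σ(ξ)‖ ≤ C (|η| / |ξ|) ^ b` for some `b > 1` (`IsFiltration.isDiffBound`), and the conclusion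
is that `T_σ` is bounded on `L^r(|x| ^ a dx)` for `-1 < a < r - 1`.

*Reduction to finite groups.* A smooth function lives on a finite quotient `H = G / G_N`, and there
`T_σ` is convolution with a function `K` whose Fourier transform at the representations of `H` is
`σ` (`fourier_symbolKernel`, `multiplier_comp_quotient`). It therefore suffices to bound these
convolutions with constants that do not depend on `N`.

*The kernel.* The value of `σ` at the right regular representation of `H` is the matrix of the
convolution operator, so the boundedness of `σ` gives the `ℓ²` bound. Let `k_n` be the part of the
kernel that comes from the representations of level `n`. For `z ∉ G_l` with `l < n`, a matrix entry
of the difference of the symbol of `k_n` at the regular representations of `G / G_l` and `G / G_n`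
is, up to normalization, `k_n(z)` (`norm_symbolKernel_sub_le`). Passing from irreducible to
arbitrary representations costs nothing, because operator norms of direct sums are maxima
(`Symbol.opNorm_diff_le`). Thus `|k_n(z)| ≤ C |G_n| ^ (b - 1) |G_l| ^ (-b)`. As `b > 1` and
as distinct members of the filtration differ by a factor of at least `2`, these bounds sum to a
geometric series, and `K` is a Calderón–Zygmund kernel of Hölder exponent `b - 1`
(`IsFiltration.isCZKernel_quotientKernel`).

*Calderón–Zygmund theory.* For such kernels the bilinear form `∑ f(y) K(y⁻¹ x) g(x)` over a coset
is estimated by stopping at the maximal subcosets on which the average of `|f|` or `|g|` has grown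
by a fixed factor: the form is at most a constant times `|Q| ⟨|f|⟩_Q ⟨|g|⟩_Q` plus the sum of the
forms over the stopped cosets (`IsCZKernel.norm_form_sub_le`). Induction along the chain with
a Bellman function, which exploits the strict growth of the averages of `|f| ^ r` and `|g| ^ r'`
over the stopped cosets, yields the `L^r` bound for all `1 < r < ∞`. The power weight is constant on
the shells `{|x| = c}`; the interaction of nearby points is covered by the unweighted bound, and
the interaction of different shells by a Schur test (`exists_weighted_bound`).

*Extension.* The weighted measure of a fiber of `G → G / G_N` is comparable to the weight
on `G / G_N`, if `N` is a jump of the filtration (`IsFiltration.weightedMeasure_fiber`). This uses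
that points have measure zero: `G` is not discrete, since `d ≥ 1`. Smooth functions are dense by the
Stone–Weierstrass theorem, so the operator extends.
-/

noncomputable section

namespace PadicMultiplier

set_option linter.unusedSectionVars false

/-! ### Chains of normal subgroups of a finite group -/

/-- A decreasing chain `⊤ = A₀ ⊇ A₁ ⊇ …` of normal subgroups which is trivial from the index `len`
on. Consecutive members may coincide. -/
structure NormalChain (H : Type*) [Group H] where
  sub : ℕ → Subgroup H
  normal : ∀ n, (sub n).Normal
  anti : Antitone sub
  sub_zero : sub 0 = ⊤
  len : ℕ
  sub_len : sub len = ⊥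

namespace NormalChain

variable {H : Type*} [Group H] [Fintype H] (A : NormalChain H)

/-- The number of elements of `A_n`, as a real number. -/
def card (n : ℕ) : ℝ := Nat.card (A.sub n)

lemma one_le_card (n : ℕ) : 1 ≤ A.card n := by
  unfold card
  exact_mod_cast Nat.card_pos (α := A.sub n)

lemma card_pos (n : ℕ) : 0 < A.card n := lt_of_lt_of_le one_pos (A.one_le_card n)

lemma card_len : A.card A.len = 1 := by
  simp [card, A.sub_len]

lemma card_anti {m n : ℕ} (h : m ≤ n) : A.card n ≤ A.card m := by
  unfold card
  exact_mod_cast Subgroup.card_le_of_le (A.anti h)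

lemma sub_eq_bot {n : ℕ} (h : A.len ≤ n) : A.sub n = ⊥ :=
  le_bot_iff.1 (A.sub_len ▸ A.anti h)

lemma two_mul_card_le {m n : ℕ} (h : m ≤ n) (hne : A.sub m ≠ A.sub n) :
    2 * A.card n ≤ A.card m := by
  have hle := A.anti h
  obtain ⟨k, hk⟩ := Subgroup.card_dvd_of_le hle
  have hpos : 0 < Nat.card (A.sub m) := Nat.card_pos
  have hk2 : 2 ≤ k := by
    rcases k with _ | _ | k
    · rw [mul_zero] at hk; exact absurd hk hpos.ne'
    · exact absurd (Subgroup.eq_of_le_of_card_ge hle (by simpa using hk.le)) hne.symm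
    · omega
  unfold card
  have : 2 * Nat.card (A.sub n) ≤ Nat.card (A.sub m) := by
    rw [hk, mul_comm]; exact Nat.mul_le_mul_left _ hk2
  exact_mod_cast this

open Classical in
/-- The index of the smallest member of the chain that contains `z`. -/
def lev (z : H) : ℕ := Nat.findGreatest (fun n => z ∈ A.sub n) A.len

/-- The ultrametric absolute value `v(z)` in counting normalization: the cardinality of the
smallest member of the chain that contains `z`. In particular `v(1) = 1`. -/
def vol (z : H) : ℝ := A.card (A.lev z)

lemma mem_sub_lev (z : H) : z ∈ A.sub (A.lev z) := by
  classical
  have : z ∈ A.sub 0 := by simp [A.sub_zero]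
  exact Nat.findGreatest_spec (P := fun n => z ∈ A.sub n) (Nat.zero_le _) this

lemma lev_lt {z : H} {n : ℕ} (h : z ∉ A.sub n) : A.lev z < n := by
  by_contra! hn
  exact h (A.anti hn (A.mem_sub_lev z))

lemma le_lev {z : H} {n : ℕ} (hn : n ≤ A.len) (h : z ∈ A.sub n) : n ≤ A.lev z := by
  classical
  exact Nat.le_findGreatest hn h

lemma one_le_vol (z : H) : 1 ≤ A.vol z := A.one_le_card _

lemma vol_pos (z : H) : 0 < A.vol z := A.card_pos _

lemma vol_le_card {z : H} {n : ℕ} (h : z ∈ A.sub n) : A.vol z ≤ A.card n := by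
  rcases le_total n A.len with hn | hn
  · exact A.card_anti (A.le_lev hn h)
  · have h1 : z = 1 := by simpa [A.sub_eq_bot hn] using h
    have : A.len ≤ A.lev z := A.le_lev le_rfl (by simp [h1, A.sub_len])
    calc A.vol z ≤ A.card A.len := A.card_anti this
      _ = 1 := A.card_len
      _ ≤ _ := A.one_le_card n

lemma card_lt_vol {z : H} {n : ℕ} (h : z ∉ A.sub n) : 2 * A.card n ≤ A.vol z :=
  A.two_mul_card_le (A.lev_lt h).le fun he => h (he ▸ A.mem_sub_lev z)

lemma mem_sub_iff {z : H} {n : ℕ} : z ∈ A.sub n ↔ A.vol z ≤ A.card n := by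
  refine ⟨A.vol_le_card, fun h => ?_⟩
  by_contra hn
  have := A.card_lt_vol hn
  have := A.card_pos n
  linarith

lemma vol_eq_card {z : H} {n : ℕ} (h : z ∈ A.sub n) (h' : z ∉ A.sub (n + 1)) :
    A.vol z = A.card n :=
  le_antisymm (A.vol_le_card h) (A.card_anti (Nat.lt_succ_iff.1 (A.lev_lt h')))

lemma vol_eq_of_forall {y z : H} (h : ∀ n, y ∈ A.sub n ↔ z ∈ A.sub n) : A.vol y = A.vol z := by
  have : A.lev y = A.lev z := by
    unfold lev
    congr! 2 with n
    exact h n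
  rw [vol, vol, this]

lemma vol_one : A.vol 1 = 1 :=
  le_antisymm ((A.vol_le_card (one_mem (A.sub A.len))).trans_eq A.card_len) (A.one_le_vol 1)

lemma vol_inv (z : H) : A.vol z⁻¹ = A.vol z :=
  A.vol_eq_of_forall fun _ => inv_mem_iff

lemma mul_mem_cancel {z g : H} {n k : ℕ} (hz : z ∉ A.sub n) (hg : g ∈ A.sub n) :
    z * g ∈ A.sub k ↔ z ∈ A.sub k := by
  rcases le_total k n with h | h
  · exact Subgroup.mul_mem_cancel_right _ (A.anti h hg)
  · refine iff_of_false (fun h' => hz ?_) fun h' => hz (A.anti h h')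
    exact (Subgroup.mul_mem_cancel_right _ hg).1 (A.anti h h')

lemma vol_mul_right {z g : H} {n : ℕ} (hz : z ∉ A.sub n) (hg : g ∈ A.sub n) :
    A.vol (z * g) = A.vol z :=
  A.vol_eq_of_forall fun _ => A.mul_mem_cancel hz hg

lemma vol_mul_left {z g : H} {n : ℕ} (hz : z ∉ A.sub n) (hg : g ∈ A.sub n) :
    A.vol (g * z) = A.vol z := by
  rw [← A.vol_inv, mul_inv_rev, A.vol_mul_right (n := n) (by simpa using hz) (by simpa using hg),
    A.vol_inv]

/-- The strong triangle inequality, with equality for elements of different size. -/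
lemma vol_inv_mul_eq_max {x y : H} (h : A.vol x ≠ A.vol y) :
    A.vol (y⁻¹ * x) = max (A.vol x) (A.vol y) := by
  rcases lt_or_gt_of_ne h with h | h
  · rw [max_eq_right h.le, A.vol_mul_right (n := A.lev x) _ (A.mem_sub_lev x), A.vol_inv]
    rw [inv_mem_iff, A.mem_sub_iff]
    exact not_le.2 h
  · rw [max_eq_left h.le, A.vol_mul_left (n := A.lev y) _ (inv_mem (A.mem_sub_lev y))]
    rw [A.mem_sub_iff]
    exact not_le.2 h

open Classical in
lemma card_eq_card_filter (n : ℕ) : A.card n = (Finset.univ.filter fun z => z ∈ A.sub n).card := by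
  unfold card
  rw [Nat.card_eq_fintype_card, Fintype.card_subtype]

end NormalChain

lemma rpow_neg_le_of_two_mul_le {u w s : ℝ} (hu : 0 < u) (h : 2 * u ≤ w) (hs : 0 < s) :
    2 ^ s * u ^ s ≤ w ^ s := by
  rw [← Real.mul_rpow (by norm_num) hu.le]
  exact Real.rpow_le_rpow (by positivity) h hs.le

lemma one_lt_two_rpow {s : ℝ} (hs : 0 < s) : (1 : ℝ) < 2 ^ s :=
  Real.one_lt_rpow (by norm_num) hs

namespace NormalChain

variable {H : Type*} [Group H] [Fintype H] (A : NormalChain H)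

open Classical in
/-- The tail sum `∑_{z ∉ A_m} v(z)^{-1-ε}` is dominated by its innermost shell. -/
lemma sum_vol_off (m : ℕ) {ε : ℝ} (hε : 0 < ε) :
    ∑ z with z ∉ A.sub m, A.vol z ^ (-1 - ε) ≤ (1 / (2 ^ ε - 1)) * A.card m ^ (-ε) := by
  have h2 := one_lt_two_rpow hε
  have h2' : 0 < (2 : ℝ) ^ ε - 1 := by linarith
  induction m with
  | zero =>
    have : (Finset.univ.filter fun z => z ∉ A.sub 0) = ∅ := by simp [A.sub_zero]
    rw [this, Finset.sum_empty]
    have := A.card_pos 0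
    positivity
  | succ m ih =>
    by_cases hm : A.sub m = A.sub (m + 1)
    · have : A.card m = A.card (m + 1) := by unfold card; rw [hm]
      rwa [hm, this] at ih
    have hsplit : (Finset.univ.filter fun z => z ∉ A.sub (m + 1)) =
        (Finset.univ.filter fun z => z ∉ A.sub m) ∪
        (Finset.univ.filter fun z => z ∈ A.sub m ∧ z ∉ A.sub (m + 1)) := by
      ext z
      have : z ∈ A.sub (m + 1) → z ∈ A.sub m := fun h => A.anti (Nat.le_succ m) h
      simp only [Finset.mem_filter, Finset.mem_univ, true_and, Finset.mem_union]
      tauto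
    have hdisj : Disjoint (Finset.univ.filter fun z => z ∉ A.sub m)
        (Finset.univ.filter fun z => z ∈ A.sub m ∧ z ∉ A.sub (m + 1)) := by
      rw [Finset.disjoint_filter]
      tauto
    rw [hsplit, Finset.sum_union hdisj]
    have hshell : ∑ z with z ∈ A.sub m ∧ z ∉ A.sub (m + 1), A.vol z ^ (-1 - ε)
        ≤ A.card m ^ (-ε) := by
      have : ∀ z ∈ Finset.univ.filter (fun z => z ∈ A.sub m ∧ z ∉ A.sub (m + 1)),
          A.vol z ^ (-1 - ε) = A.card m ^ (-1 - ε) := by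
        intro z hz
        rw [Finset.mem_filter] at hz
        rw [A.vol_eq_card hz.2.1 hz.2.2]
      rw [Finset.sum_congr rfl this, Finset.sum_const, nsmul_eq_mul]
      have hc : ((Finset.univ.filter (fun z => z ∈ A.sub m ∧ z ∉ A.sub (m + 1))).card : ℝ)
          ≤ A.card m := by
        rw [A.card_eq_card_filter]
        exact_mod_cast Finset.card_le_card fun z hz => by
          simp only [Finset.mem_filter, Finset.mem_univ, true_and] at hz ⊢
          exact hz.1
      have hp := A.card_pos m
      calc _ ≤ A.card m * A.card m ^ (-1 - ε) := by gcongr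
        _ = A.card m ^ (1 : ℝ) * A.card m ^ (-1 - ε) := by rw [Real.rpow_one]
        _ = A.card m ^ (-ε) := by rw [← Real.rpow_add hp]; congr 1; ring
    have hp := A.card_pos m
    have hp1 := A.card_pos (m + 1)
    have h3 : 2 ^ ε * A.card m ^ (-ε) ≤ A.card (m + 1) ^ (-ε) := by
      have h4 := rpow_neg_le_of_two_mul_le hp1 (A.two_mul_card_le (Nat.le_succ m) hm) hε
      rw [Real.rpow_neg hp.le, Real.rpow_neg hp1.le]
      rw [← div_eq_mul_inv, div_le_iff₀ (by positivity), ← div_eq_inv_mul,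
        le_div_iff₀ (by positivity)]
      exact h4
    calc _ ≤ (1 / (2 ^ ε - 1)) * A.card m ^ (-ε) + A.card m ^ (-ε) := add_le_add ih hshell
      _ = (1 / (2 ^ ε - 1)) * (2 ^ ε * A.card m ^ (-ε)) := by field_simp; ring
      _ ≤ _ := by gcongr

open Classical in
/-- The local sum `∑_{z ∈ A_n} v(z)^β`, `β > -1`, is dominated by its outermost shell. -/
lemma sum_vol_on {n : ℕ} (hn : n ≤ A.len) {β : ℝ} (hβ : -1 < β) :
    ∑ z with z ∈ A.sub n, A.vol z ^ β ≤ (1 / (1 - 2 ^ (-(1 + β)))) * A.card n ^ (1 + β) := by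
  have hs : 0 < 1 + β := by linarith
  have h2 : (2 : ℝ) ^ (-(1 + β)) < 1 := by
    rw [Real.rpow_neg (by norm_num)]
    exact inv_lt_one_of_one_lt₀ (one_lt_two_rpow hs)
  have h2pos : (0 : ℝ) < 2 ^ (-(1 + β)) := by positivity
  have h2' : 0 < 1 - (2 : ℝ) ^ (-(1 + β)) := by linarith
  induction hn using Nat.decreasingInduction with
  | self =>
    have : (Finset.univ.filter fun z => z ∈ A.sub A.len) = {1} := by
      ext z; simp [A.sub_len]
    rw [this, Finset.sum_singleton, A.vol_one, A.card_len, Real.one_rpow, Real.one_rpow, mul_one,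
      le_div_iff₀ h2']
    linarith
  | of_succ m hm ih =>
    by_cases hne : A.sub m = A.sub (m + 1)
    · have : A.card m = A.card (m + 1) := by unfold card; rw [hne]
      rwa [hne, this]
    have hsplit : (Finset.univ.filter fun z => z ∈ A.sub m) =
        (Finset.univ.filter fun z => z ∈ A.sub (m + 1)) ∪
        (Finset.univ.filter fun z => z ∈ A.sub m ∧ z ∉ A.sub (m + 1)) := by
      ext z
      have : z ∈ A.sub (m + 1) → z ∈ A.sub m := fun h => A.anti (Nat.le_succ m) h
      simp only [Finset.mem_filter, Finset.mem_univ, true_and, Finset.mem_union]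
      tauto
    have hdisj : Disjoint (Finset.univ.filter fun z => z ∈ A.sub (m + 1))
        (Finset.univ.filter fun z => z ∈ A.sub m ∧ z ∉ A.sub (m + 1)) := by
      rw [Finset.disjoint_filter]
      tauto
    rw [hsplit, Finset.sum_union hdisj]
    have hp := A.card_pos m
    have hp1 := A.card_pos (m + 1)
    have hshell : ∑ z with z ∈ A.sub m ∧ z ∉ A.sub (m + 1), A.vol z ^ β
        ≤ A.card m ^ (1 + β) := by
      have : ∀ z ∈ Finset.univ.filter (fun z => z ∈ A.sub m ∧ z ∉ A.sub (m + 1)),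
          A.vol z ^ β = A.card m ^ β := by
        intro z hz
        rw [Finset.mem_filter] at hz
        rw [A.vol_eq_card hz.2.1 hz.2.2]
      rw [Finset.sum_congr rfl this, Finset.sum_const, nsmul_eq_mul]
      have hc : ((Finset.univ.filter (fun z => z ∈ A.sub m ∧ z ∉ A.sub (m + 1))).card : ℝ)
          ≤ A.card m := by
        rw [A.card_eq_card_filter]
        exact_mod_cast Finset.card_le_card fun z hz => by
          simp only [Finset.mem_filter, Finset.mem_univ, true_and] at hz ⊢
          exact hz.1
      calc _ ≤ A.card m * A.card m ^ β := by gcongr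
        _ = A.card m ^ (1 + β) := by rw [Real.rpow_add hp, Real.rpow_one]
    have h3 : A.card (m + 1) ^ (1 + β) ≤ 2 ^ (-(1 + β)) * A.card m ^ (1 + β) := by
      have h4 := rpow_neg_le_of_two_mul_le hp1 (A.two_mul_card_le (Nat.le_succ m) hne) hs
      rw [Real.rpow_neg (by norm_num), ← div_eq_inv_mul, le_div_iff₀ (by positivity), mul_comm]
      exact h4
    calc _ ≤ (1 / (1 - 2 ^ (-(1 + β)))) * A.card (m + 1) ^ (1 + β) + A.card m ^ (1 + β) :=
          add_le_add ih hshell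
      _ ≤ (1 / (1 - 2 ^ (-(1 + β)))) * (2 ^ (-(1 + β)) * A.card m ^ (1 + β))
          + A.card m ^ (1 + β) := by gcongr
      _ = _ := by field_simp; ring

/-- The Schur test for the Hardy kernel `1 / max (v x) (v y)` with the test function `v^β`. -/
lemma sum_vol_div_max (x : H) {β : ℝ} (hβ : -1 < β) (hβ' : β < 0) :
    ∑ z, A.vol z ^ β / max (A.vol x) (A.vol z)
      ≤ (1 / (1 - 2 ^ (-(1 + β))) + 1 / (2 ^ (-β) - 1)) * A.vol x ^ β := by
  classical
  have hle : A.lev x ≤ A.len := by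
    unfold lev; exact Nat.findGreatest_le _
  have hx := A.vol_pos x
  rw [← Finset.sum_filter_add_sum_filter_not _ (fun z => z ∈ A.sub (A.lev x)), add_mul]
  refine add_le_add ?_ ?_
  · calc ∑ z with z ∈ A.sub (A.lev x), A.vol z ^ β / max (A.vol x) (A.vol z)
        ≤ ∑ z with z ∈ A.sub (A.lev x), A.vol z ^ β * (A.vol x)⁻¹ := by
          refine Finset.sum_le_sum fun z _ => ?_
          rw [div_eq_mul_inv]
          have := A.vol_pos z
          gcongr
          exact le_max_left _ _
      _ = (∑ z with z ∈ A.sub (A.lev x), A.vol z ^ β) * (A.vol x)⁻¹ := by rw [Finset.sum_mul]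
      _ ≤ ((1 / (1 - 2 ^ (-(1 + β)))) * A.card (A.lev x) ^ (1 + β)) * (A.vol x)⁻¹ := by
          gcongr; exact A.sum_vol_on hle hβ
      _ = _ := by
          change ((1 / (1 - 2 ^ (-(1 + β)))) * A.vol x ^ (1 + β)) * (A.vol x)⁻¹ = _
          rw [mul_assoc, ← Real.rpow_neg_one, ← Real.rpow_add hx]
          congr 2; ring
  · calc ∑ z with z ∉ A.sub (A.lev x), A.vol z ^ β / max (A.vol x) (A.vol z)
        ≤ ∑ z with z ∉ A.sub (A.lev x), A.vol z ^ (-1 - -β) := by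
          refine Finset.sum_le_sum fun z _ => ?_
          have hz := A.vol_pos z
          have : A.vol z ^ (-1 - -β) = A.vol z ^ β / A.vol z := by
            rw [show -1 - -β = β - 1 by ring, Real.rpow_sub_one hz.ne']
          rw [this]
          gcongr
          exact le_max_right _ _
      _ ≤ _ := by
          have := A.sum_vol_off (A.lev x) (ε := -β) (by linarith)
          rw [neg_neg] at this
          exact this

end NormalChain

/-! ### Calderón–Zygmund kernels on a chain: the stopping-time step -/

/-- The convolution `f * K (x) = ∑ y, f(y) K(y⁻¹ x)` on a finite group. -/
def conv {H : Type*} [Group H] [Fintype H] (K f : H → ℂ) (x : H) : ℂ :=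
  ∑ y, f y * K (y⁻¹ * x)

/-- A Calderón–Zygmund convolution kernel on a finite group with a normal chain: the operator is
bounded on `ℓ²`, the kernel is of size `1 / v(z)`, and it is Hölder regular of order `ε`. The chain
is doubling with constant `D`. -/
structure IsCZKernel {H : Type*} [Group H] [Fintype H] (A : NormalChain H) (K : H → ℂ)
    (B C D ε : ℝ) : Prop where
  B_nonneg : 0 ≤ B
  C_nonneg : 0 ≤ C
  one_le_D : 1 ≤ D
  ε_pos : 0 < ε
  doubling : ∀ n, A.card n ≤ D * A.card (n + 1)
  l2 : ∀ f : H → ℂ, ∑ x, ‖conv K f x‖ ^ 2 ≤ B ^ 2 * ∑ x, ‖f x‖ ^ 2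
  size : ∀ l z, z ∉ A.sub l → ‖K z‖ ≤ C / A.card l
  reg : ∀ l m z g, l ≤ m → z ∉ A.sub l → g ∈ A.sub m →
    ‖K (z * g) - K z‖ ≤ C * A.card m ^ ε * A.card l ^ (-1 - ε)

section Average

variable {H : Type*} [Group H] [Fintype H] (A : NormalChain H)

open Classical in
/-- The coset `x A_n`. -/
def cube (n : ℕ) (x : H) : Finset H := Finset.univ.filter fun y => x⁻¹ * y ∈ A.sub n

lemma mem_cube {n : ℕ} {x y : H} : y ∈ cube A n x ↔ x⁻¹ * y ∈ A.sub n := by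
  simp [cube]

lemma cube_eq_of_mem {n : ℕ} {x y : H} (h : y ∈ cube A n x) : cube A n y = cube A n x := by
  rw [mem_cube] at h
  ext z
  rw [mem_cube, mem_cube, show x⁻¹ * z = (x⁻¹ * y) * (y⁻¹ * z) by group]
  exact (Subgroup.mul_mem_cancel_left _ h).symm

lemma mem_cube_comm {n : ℕ} {x y : H} : y ∈ cube A n x ↔ x ∈ cube A n y := by
  rw [mem_cube, mem_cube, ← inv_mem_iff]; simp

lemma cube_anti {m n : ℕ} (h : m ≤ n) (x : H) : cube A n x ⊆ cube A m x := fun y hy => by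
  rw [mem_cube] at *; exact A.anti h hy

lemma card_cube (n : ℕ) (x : H) : ((cube A n x).card : ℝ) = A.card n := by
  classical
  rw [A.card_eq_card_filter]
  congr 1
  refine Finset.card_bij (fun y _ => x⁻¹ * y) ?_ ?_ ?_
  · intro y hy; simpa [mem_cube] using hy
  · intro y _ z _ h; simpa using h
  · intro y hy
    refine ⟨x * y, ?_, by simp⟩
    simpa [mem_cube] using hy

/-- The average of `u` over the coset `x A_{τ(x)}`. -/
def avg {V : Type*} [AddCommGroup V] [Module ℝ V] (τ : H → ℕ) (u : H → V) (x : H) : V :=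
  (A.card (τ x))⁻¹ • ∑ y ∈ cube A (τ x) x, u y

/-- The cosets `x A_{τ(x)}` form a partition. -/
def IsStopping (τ : H → ℕ) : Prop := ∀ x y, y ∈ cube A (τ x) x → τ y = τ x

/-- `S` is a union of the cosets `x A_{τ(x)}`. -/
def Saturated (τ : H → ℕ) (S : Finset H) : Prop := ∀ x ∈ S, cube A (τ x) x ⊆ S

variable {A} {τ : H → ℕ}

lemma IsStopping.mem_comm (hτ : IsStopping A τ) {x y : H} :
    y ∈ cube A (τ x) x ↔ x ∈ cube A (τ y) y := by
  constructor
  · intro h; rw [hτ x y h]; exact (mem_cube_comm A).1 h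
  · intro h; rw [hτ y x h]; exact (mem_cube_comm A).1 h

lemma IsStopping.cube_eq (hτ : IsStopping A τ) {x y : H} (h : y ∈ cube A (τ x) x) :
    cube A (τ y) y = cube A (τ x) x := by
  rw [hτ x y h]; exact cube_eq_of_mem A h

lemma IsStopping.avg_eq {V : Type*} [AddCommGroup V] [Module ℝ V] (hτ : IsStopping A τ)
    (u : H → V) {x y : H} (h : y ∈ cube A (τ x) x) : avg A τ u y = avg A τ u x := by
  unfold avg; rw [hτ.cube_eq h, hτ x y h]

lemma avg_congr_const {V : Type*} [AddCommGroup V] [Module ℝ V] {u : H → V} {x : H}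
    (h : ∀ y ∈ cube A (τ x) x, u y = u x) : avg A τ u x = u x := by
  unfold avg
  rw [Finset.sum_congr rfl h, Finset.sum_const, ← Nat.cast_smul_eq_nsmul ℝ, card_cube, smul_smul,
    inv_mul_cancel₀ (A.card_pos _).ne', one_smul]

lemma avg_le {u : H → ℝ} {x : H} {M : ℝ} (h : ∀ y ∈ cube A (τ x) x, u y ≤ M) :
    avg A τ u x ≤ M := by
  unfold avg
  rw [smul_eq_mul, ← div_eq_inv_mul, div_le_iff₀ (A.card_pos _)]
  refine (Finset.sum_le_card_nsmul _ _ M h).trans_eq ?_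
  rw [nsmul_eq_mul, card_cube, mul_comm]

lemma avg_nonneg {u : H → ℝ} (h : ∀ y, 0 ≤ u y) (x : H) : 0 ≤ avg A τ u x := by
  unfold avg
  have := A.card_pos (τ x)
  exact smul_nonneg (by positivity) (Finset.sum_nonneg fun y _ => h y)

lemma norm_avg_le (u : H → ℂ) (x : H) : ‖avg A τ u x‖ ≤ avg A τ (fun y => ‖u y‖) x := by
  unfold avg
  rw [norm_smul, Real.norm_of_nonneg (inv_nonneg.2 (A.card_pos _).le), smul_eq_mul]
  have := A.card_pos (τ x)
  gcongr
  exact norm_sum_le _ _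

/-- Averaging over the cosets of a partition is self-adjoint. -/
lemma sum_avg_mul {V : Type*} [CommRing V] [Algebra ℝ V] (hτ : IsStopping A τ) {S : Finset H}
    (hS : Saturated A τ S) (u w : H → V) :
    ∑ x ∈ S, avg A τ u x * w x = ∑ x ∈ S, u x * avg A τ w x := by
  classical
  unfold avg
  simp only [Finset.smul_sum, Finset.sum_mul, Finset.mul_sum]
  rw [Finset.sum_comm' (t' := S) (s' := fun y => cube A (τ y) y)]
  · refine Finset.sum_congr rfl fun y _ => Finset.sum_congr rfl fun x hx => ?_
    rw [hτ y x hx, smul_mul_assoc, mul_smul_comm]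
  · intro x y
    constructor
    · rintro ⟨hx, hy⟩
      exact ⟨hτ.mem_comm.1 hy, hS x hx hy⟩
    · rintro ⟨hx, hy⟩
      exact ⟨hS y hy hx, hτ.mem_comm.1 hx⟩

lemma sum_avg {V : Type*} [CommRing V] [Algebra ℝ V] (hτ : IsStopping A τ) {S : Finset H}
    (hS : Saturated A τ S) (u : H → V) : ∑ x ∈ S, avg A τ u x = ∑ x ∈ S, u x := by
  have := sum_avg_mul hτ hS u (fun _ => (1 : V))
  simp only [mul_one] at this
  rw [this]
  refine Finset.sum_congr rfl fun x _ => ?_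
  rw [avg_congr_const (fun _ _ => rfl), mul_one]

end Average

section Kernel

variable {H : Type*} [Group H] [Fintype H] {A : NormalChain H} {K : H → ℂ} {B C D ε : ℝ}

namespace NormalChain

lemma notMem_sub_lev_succ {z : H} (hz : z ≠ 1) : z ∉ A.sub (A.lev z + 1) := by
  intro h
  rcases le_or_gt (A.lev z + 1) A.len with h1 | h1
  · have := A.le_lev h1 h
    omega
  · rw [A.sub_eq_bot (by omega)] at h
    exact hz (by simpa using h)

end NormalChain

namespace IsCZKernel

variable (hK : IsCZKernel A K B C D ε)
include hK

lemma vol_le (z : H) : A.vol z ≤ D * A.card (A.lev z + 1) := hK.doubling _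

lemma norm_le {z : H} (hz : z ≠ 1) : ‖K z‖ ≤ C * D / A.vol z := by
  refine (hK.size _ z (A.notMem_sub_lev_succ hz)).trans ?_
  rw [div_le_div_iff₀ (A.card_pos _) (A.vol_pos _), mul_assoc]
  have := hK.C_nonneg
  gcongr
  exact hK.vol_le z

lemma norm_sub_le {m : ℕ} {z g : H} (hz : z ∉ A.sub m) (hg : g ∈ A.sub m) :
    ‖K (z * g) - K z‖ ≤ C * D ^ (1 + ε) * A.card m ^ ε * A.vol z ^ (-1 - ε) := by
  have hz1 : z ≠ 1 := fun h => hz (h ▸ one_mem _)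
  refine (hK.reg (A.lev z + 1) m z g (A.lev_lt hz) (A.notMem_sub_lev_succ hz1) hg).trans ?_
  have hC := hK.C_nonneg
  have hD := hK.one_le_D
  have hε := hK.ε_pos
  have h1 := A.card_pos (A.lev z + 1)
  have h2 := A.vol_pos z
  have h3 := A.card_pos m
  have key : A.card (A.lev z + 1) ^ (-1 - ε) ≤ D ^ (1 + ε) * A.vol z ^ (-1 - ε) := by
    have : A.vol z ^ (1 + ε) ≤ D ^ (1 + ε) * A.card (A.lev z + 1) ^ (1 + ε) := by
      rw [← Real.mul_rpow (by positivity) h1.le]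
      exact Real.rpow_le_rpow h2.le (hK.vol_le z) (by positivity)
    rw [show -1 - ε = -(1 + ε) by ring, Real.rpow_neg h1.le, Real.rpow_neg h2.le,
      ← div_eq_mul_inv, le_div_iff₀ (by positivity), ← div_eq_inv_mul, div_le_iff₀ (by positivity)]
    exact this
  calc _ ≤ C * A.card m ^ ε * (D ^ (1 + ε) * A.vol z ^ (-1 - ε)) := by gcongr
    _ = _ := by ring

lemma norm_sub_le' {m : ℕ} {z g : H} (hz : z ∉ A.sub m) (hg : g ∈ A.sub m) :
    ‖K (g * z) - K z‖ ≤ C * D ^ (1 + ε) * A.card m ^ ε * A.vol z ^ (-1 - ε) := by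
  have hN := A.normal m
  have : g * z = z * (z⁻¹ * g * z⁻¹⁻¹) := by group
  rw [this]
  exact hK.norm_sub_le hz (hN.conj_mem g hg z⁻¹)

/-- The operator applied to the indicator of a subgroup of the chain is constant on it; the constant
is at most the `ℓ²` norm of the operator. -/
lemma norm_sum_cube_le (n : ℕ) (x : H) : ‖∑ y ∈ cube A n x, K (y⁻¹ * x)‖ ≤ B := by
  classical
  set κ := ∑ y ∈ cube A n x, K (y⁻¹ * x) with hκ
  have hconst : ∀ x' ∈ cube A n x, conv K (fun y => if y ∈ cube A n x then 1 else 0) x' = κ := by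
    intro x' hx'
    unfold conv
    simp only [ite_mul, one_mul, zero_mul, Finset.sum_ite_mem, Finset.univ_inter]
    rw [hκ]
    have hn := A.normal n
    rw [mem_cube] at hx'
    refine Finset.sum_bij (fun y _ => x * x'⁻¹ * y) ?_ ?_ ?_ ?_
    · intro y hy
      rw [mem_cube] at *
      have : x⁻¹ * (x * x'⁻¹ * y) = (x⁻¹ * x')⁻¹ * (x⁻¹ * y) := by group
      rw [this]
      exact mul_mem (inv_mem hx') hy
    · intro y _ z _ h; simpa using h
    · intro y hy
      refine ⟨x' * x⁻¹ * y, ?_, by group⟩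
      rw [mem_cube] at *
      have : x⁻¹ * (x' * x⁻¹ * y) = (x⁻¹ * x') * (x⁻¹ * y) := by group
      rw [this]
      exact mul_mem hx' hy
    · intro y _
      congr 1; group
  have h := hK.l2 (fun y => if y ∈ cube A n x then 1 else 0)
  have h1 : A.card n * ‖κ‖ ^ 2 ≤
      ∑ x', ‖conv K (fun y => if y ∈ cube A n x then 1 else 0) x'‖ ^ 2 := by
    rw [← card_cube A n x, ← nsmul_eq_mul, ← Finset.sum_const]
    rw [Finset.sum_congr rfl (fun x' hx' => by rw [← hconst x' hx'])]
    exact Finset.sum_le_sum_of_subset_of_nonneg (Finset.subset_univ _) fun _ _ _ => by positivity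
  have h2 : ∑ x', ‖(if x' ∈ cube A n x then (1 : ℂ) else 0)‖ ^ 2 = A.card n := by
    have : ∀ x', ‖(if x' ∈ cube A n x then (1 : ℂ) else 0)‖ ^ 2
        = if x' ∈ cube A n x then (1 : ℝ) else 0 := by
      intro x'; split_ifs <;> simp
    simp only [this, Finset.sum_ite_mem, Finset.univ_inter, Finset.sum_const, nsmul_eq_mul,
      mul_one]
    exact card_cube A n x
  rw [h2] at h
  have h3 := A.card_pos n
  have h4 : ‖κ‖ ^ 2 ≤ B ^ 2 := by
    have := h1.trans h
    rw [mul_comm] at this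
    exact le_of_mul_le_mul_right this h3
  exact (le_abs_self _).trans (abs_le_of_sq_le_sq h4 hK.B_nonneg)

end IsCZKernel

/-- The bilinear form of the operator, localized to a set `S`. -/
def form (K : H → ℂ) (S : Finset H) (f g : H → ℂ) : ℂ :=
  ∑ x ∈ S, ∑ y ∈ S, f y * K (y⁻¹ * x) * g x

open Classical in
lemma form_eq_sum_conv (K : H → ℂ) (S : Finset H) (f g : H → ℂ) :
    form K S f g = ∑ x ∈ S, conv K (fun y => if y ∈ S then f y else 0) x * g x := by
  unfold form conv
  refine Finset.sum_congr rfl fun x _ => ?_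
  simp only [ite_mul, zero_mul, Finset.sum_ite_mem, Finset.univ_inter, Finset.sum_mul]

lemma IsCZKernel.norm_form_le (hK : IsCZKernel A K B C D ε) {S : Finset H} {f g : H → ℂ}
    {a b : ℝ} (hf : ∀ x ∈ S, ‖f x‖ ≤ a) (hg : ∀ x ∈ S, ‖g x‖ ≤ b) (ha : 0 ≤ a) (hb : 0 ≤ b) :
    ‖form K S f g‖ ≤ B * a * b * S.card := by
  classical
  rw [form_eq_sum_conv]
  set F : H → ℂ := fun y => if y ∈ S then f y else 0
  have h1 : ∑ x ∈ S, ‖conv K F x‖ ^ 2 ≤ B ^ 2 * (S.card * a ^ 2) := by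
    calc ∑ x ∈ S, ‖conv K F x‖ ^ 2 ≤ ∑ x, ‖conv K F x‖ ^ 2 :=
          Finset.sum_le_sum_of_subset_of_nonneg (Finset.subset_univ _) fun _ _ _ => by positivity
      _ ≤ B ^ 2 * ∑ x, ‖F x‖ ^ 2 := hK.l2 F
      _ ≤ _ := by
        gcongr
        have : ∀ x, ‖F x‖ ^ 2 = if x ∈ S then ‖f x‖ ^ 2 else 0 := by
          intro x; simp only [F]; split_ifs <;> simp
        simp only [this, Finset.sum_ite_mem, Finset.univ_inter]
        rw [← nsmul_eq_mul]
        refine Finset.sum_le_card_nsmul _ _ _ fun x hx => ?_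
        gcongr; exact hf x hx
  have h2 : ∑ x ∈ S, ‖g x‖ ^ 2 ≤ S.card * b ^ 2 := by
    rw [← nsmul_eq_mul]
    refine Finset.sum_le_card_nsmul _ _ _ fun x hx => ?_
    gcongr; exact hg x hx
  have h3 : ‖∑ x ∈ S, conv K F x * g x‖ ≤ ∑ x ∈ S, ‖conv K F x‖ * ‖g x‖ :=
    (norm_sum_le _ _).trans_eq (by simp)
  refine h3.trans ((le_abs_self _).trans (abs_le_of_sq_le_sq ?_ ?_))
  · calc _ ≤ (∑ x ∈ S, ‖conv K F x‖ ^ 2) * ∑ x ∈ S, ‖g x‖ ^ 2 :=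
          Finset.sum_mul_sq_le_sq_mul_sq _ _ _
      _ ≤ (B ^ 2 * (S.card * a ^ 2)) * (S.card * b ^ 2) := by gcongr
      _ = _ := by ring
  · have := hK.B_nonneg
    positivity

section Oscillation

variable {τ : H → ℕ} {S : Finset H}

open Classical in
/-- Pairing a function with mean zero on every coset of the partition against off-diagonal
interactions only sees the oscillation of the kernel along the cosets. -/
lemma norm_sum_sub_avg_le (hτ : IsStopping A τ) (hS : Saturated A τ S) {k : H → H → ℂ}
    {W : H → H → ℝ} {u w : H → ℂ} {M : ℝ}
    (hk : ∀ x ∈ S, ∀ x' ∈ cube A (τ x) x, ∀ y ∈ S \ cube A (τ x) x, ‖k x y - k x' y‖ ≤ W x y)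
    (hW : ∀ x ∈ S, ∑ y ∈ S \ cube A (τ x) x, W x y * ‖u y‖ ≤ M) :
    ‖∑ x ∈ S, (w x - avg A τ w x) * ∑ y ∈ S \ cube A (τ x) x, k x y * u y‖
      ≤ M * ∑ x ∈ S, ‖w x‖ := by
  set Φ : H → ℂ := fun x => ∑ y ∈ S \ cube A (τ x) x, k x y * u y with hΦ
  have h1 : ∑ x ∈ S, (w x - avg A τ w x) * Φ x = ∑ x ∈ S, w x * (Φ x - avg A τ Φ x) := by
    simp only [sub_mul, mul_sub, Finset.sum_sub_distrib]
    rw [sum_avg_mul hτ hS]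
  rw [h1, Finset.mul_sum]
  refine (norm_sum_le _ _).trans (Finset.sum_le_sum fun x hx => ?_)
  rw [norm_mul, mul_comm]
  refine mul_le_mul_of_nonneg_right ?_ (norm_nonneg _)
  have h2 : Φ x - avg A τ Φ x = avg A τ (fun x' => Φ x - Φ x') x := by
    unfold avg
    rw [Finset.sum_sub_distrib, smul_sub, Finset.sum_const, ← Nat.cast_smul_eq_nsmul ℝ, card_cube,
      smul_smul, inv_mul_cancel₀ (A.card_pos _).ne', one_smul]
  rw [h2]
  refine (norm_avg_le _ _).trans (avg_le fun x' hx' => ?_)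
  simp only [hΦ]
  rw [hτ.cube_eq hx', ← Finset.sum_sub_distrib]
  refine (norm_sum_le _ _).trans (le_trans (Finset.sum_le_sum fun y hy => ?_) (hW x hx))
  rw [← sub_mul, norm_mul]
  exact mul_le_mul_of_nonneg_right (hk x hx x' hx' y hy) (norm_nonneg _)

open Classical in
lemma sum_vol_off_cube (n : ℕ) (x : H) (S : Finset H) (hε : 0 < ε) :
    ∑ y ∈ S \ cube A n x, A.vol (x⁻¹ * y) ^ (-1 - ε) ≤ (1 / (2 ^ ε - 1)) * A.card n ^ (-ε) := by
  refine le_trans ?_ (A.sum_vol_off n hε)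
  rw [← Finset.sum_image (s := S \ cube A n x) (g := fun y => x⁻¹ * y)
    (f := fun z => A.vol z ^ (-1 - ε)) (fun y _ z _ h => by simpa using h)]
  refine Finset.sum_le_sum_of_subset_of_nonneg ?_ fun z _ _ =>
    Real.rpow_nonneg (A.vol_pos z).le _
  intro z hz
  rw [Finset.mem_image] at hz
  obtain ⟨y, hy, rfl⟩ := hz
  rw [Finset.mem_sdiff, mem_cube] at hy
  simpa using hy.2

open Classical in
/-- The kernel oscillation, summed against `u` away from a coset, only sees the averages of `|u|`
over the other cosets, because the ultrametric is constant on them. -/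
lemma sum_vol_mul_norm_le (hτ : IsStopping A τ) (hS : Saturated A τ S) (hε : 0 < ε) {u : H → ℂ}
    {b : ℝ} (hb : 0 ≤ b) (hu : ∀ x ∈ S, avg A τ (fun y => ‖u y‖) x ≤ b) (x : H) :
    ∑ y ∈ S \ cube A (τ x) x, (A.card (τ x) ^ ε * A.vol (x⁻¹ * y) ^ (-1 - ε)) * ‖u y‖
      ≤ (1 / (2 ^ ε - 1)) * b := by
  set S' := S \ cube A (τ x) x
  have hS' : Saturated A τ S' := by
    intro y hy z hz
    rw [Finset.mem_sdiff] at *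
    refine ⟨hS y hy.1 hz, fun h => hy.2 ?_⟩
    have h1 := hτ.cube_eq h
    rw [← h1]
    exact hτ.mem_comm.1 hz
  have hconst : ∀ y ∈ S', ∀ y' ∈ cube A (τ y) y, A.vol (x⁻¹ * y') = A.vol (x⁻¹ * y) := by
    intro y hy y' hy'
    rw [Finset.mem_sdiff] at hy
    have : x⁻¹ * y' = (x⁻¹ * y) * (y⁻¹ * y') := by group
    rw [this]
    refine A.vol_mul_right (n := τ y) (fun h => hy.2 ?_) ((mem_cube A).1 hy')
    rw [hτ.mem_comm, mem_cube_comm]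
    exact (mem_cube A).2 h
  have h2 := one_lt_two_rpow hε
  have h2' : 0 < (2 : ℝ) ^ ε - 1 := by linarith
  have hc := A.card_pos (τ x)
  set W : H → ℝ := fun y => A.card (τ x) ^ ε * A.vol (x⁻¹ * y) ^ (-1 - ε) with hWdef
  have hW0 : ∀ y, 0 ≤ W y := fun y => by
    have := A.vol_pos (x⁻¹ * y)
    positivity
  calc ∑ y ∈ S', W y * ‖u y‖ = ∑ y ∈ S', avg A τ W y * ‖u y‖ := by
        refine Finset.sum_congr rfl fun y hy => ?_
        rw [avg_congr_const]
        intro y' hy'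
        simp only [hWdef, hconst y hy y' hy']
    _ = ∑ y ∈ S', W y * avg A τ (fun y => ‖u y‖) y := sum_avg_mul hτ hS' _ _
    _ ≤ ∑ y ∈ S', W y * b := by
        refine Finset.sum_le_sum fun y hy => ?_
        exact mul_le_mul_of_nonneg_left (hu y (Finset.mem_sdiff.1 hy).1) (hW0 y)
    _ = A.card (τ x) ^ ε * (∑ y ∈ S', A.vol (x⁻¹ * y) ^ (-1 - ε)) * b := by
        rw [← Finset.sum_mul, ← Finset.mul_sum]
    _ ≤ A.card (τ x) ^ ε * ((1 / (2 ^ ε - 1)) * A.card (τ x) ^ (-ε)) * b := by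
        gcongr
        exact sum_vol_off_cube _ x S hε
    _ = _ := by
        rw [Real.rpow_neg hc.le]
        have : A.card (τ x) ^ ε ≠ 0 := by positivity
        field_simp

end Oscillation

/-- The constant of the stopping-time step. -/
def stepConst (B C D ε : ℝ) : ℝ := 2 * B + 2 * (C * D ^ (1 + ε) * (1 / (2 ^ ε - 1)))

lemma IsCZKernel.stepConst_nonneg (hK : IsCZKernel A K B C D ε) : 0 ≤ stepConst B C D ε := by
  have := one_lt_two_rpow hK.ε_pos
  have h2' : 0 < (2 : ℝ) ^ ε - 1 := by linarith
  have := hK.B_nonneg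
  have := hK.C_nonneg
  have := hK.one_le_D
  unfold stepConst
  positivity

lemma sum_form_cube {τ : H → ℕ} {S : Finset H} (hτ : IsStopping A τ) (hS : Saturated A τ S)
    (f g : H → ℂ) :
    ∑ x ∈ S, ∑ y ∈ cube A (τ x) x, f y * K (y⁻¹ * x) * g x =
      ∑ x ∈ S, (A.card (τ x))⁻¹ • form K (cube A (τ x) x) f g := by
  set r : H → ℂ := fun x => ∑ y ∈ cube A (τ x) x, f y * K (y⁻¹ * x) * g x with hr
  rw [← sum_avg hτ hS r]
  refine Finset.sum_congr rfl fun x _ => ?_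
  unfold avg form
  congr 1
  refine Finset.sum_congr rfl fun x' hx' => ?_
  simp only [hr]
  rw [hτ.cube_eq hx']

/-- If the averages of `|f|` and `|g|` over the cosets of a partition of `S` are bounded by `a` and
`b`, then the form on `S` differs from the sum of the forms on these cosets by `O(a b |S|)`. -/
lemma IsCZKernel.norm_form_sub_le (hK : IsCZKernel A K B C D ε) {τ : H → ℕ} {S : Finset H}
    (hτ : IsStopping A τ) (hS : Saturated A τ S) {f g : H → ℂ} {a b : ℝ} (ha : 0 ≤ a)
    (hb : 0 ≤ b) (hf : ∀ x ∈ S, avg A τ (fun y => ‖f y‖) x ≤ a)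
    (hg : ∀ x ∈ S, avg A τ (fun y => ‖g y‖) x ≤ b) :
    ‖form K S f g - ∑ x ∈ S, (A.card (τ x))⁻¹ • form K (cube A (τ x) x) f g‖
      ≤ stepConst B C D ε * a * b * S.card := by
  classical
  have hB := hK.B_nonneg
  have hC := hK.C_nonneg
  have hD := hK.one_le_D
  have h2 := one_lt_two_rpow hK.ε_pos
  have h2' : 0 < (2 : ℝ) ^ ε - 1 := by linarith
  rw [← sum_form_cube hτ hS]
  set f₀ := avg A τ f with hf₀
  set g₀ := avg A τ g with hg₀
  have hsplit : ∀ u w : H → ℂ, form K S u w =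
      (∑ x ∈ S, ∑ y ∈ cube A (τ x) x, u y * K (y⁻¹ * x) * w x) +
      ∑ x ∈ S, ∑ y ∈ S \ cube A (τ x) x, u y * K (y⁻¹ * x) * w x := by
    intro u w
    unfold form
    rw [← Finset.sum_add_distrib]
    refine Finset.sum_congr rfl fun x hx => ?_
    rw [add_comm, Finset.sum_sdiff (hS x hx)]
  have hf₀' : ∀ x ∈ S, ‖f₀ x‖ ≤ a := fun x hx => (norm_avg_le f x).trans (hf x hx)
  have hg₀' : ∀ x ∈ S, ‖g₀ x‖ ≤ b := fun x hx => (norm_avg_le g x).trans (hg x hx)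
  have hdecomp : form K S f g - ∑ x ∈ S, ∑ y ∈ cube A (τ x) x, f y * K (y⁻¹ * x) * g x
      = form K S f₀ g₀ - (∑ x ∈ S, ∑ y ∈ cube A (τ x) x, f₀ y * K (y⁻¹ * x) * g₀ x)
        + ((∑ x ∈ S, (f x - f₀ x) * ∑ y ∈ S \ cube A (τ x) x, K (x⁻¹ * y) * g y)
        + ∑ x ∈ S, (g x - g₀ x) * ∑ y ∈ S \ cube A (τ x) x, K (y⁻¹ * x) * f₀ y) := by
    have hswap : ∑ x ∈ S, (f x - f₀ x) * ∑ y ∈ S \ cube A (τ x) x, K (x⁻¹ * y) * g y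
        = ∑ x ∈ S, ∑ y ∈ S \ cube A (τ x) x, (f y - f₀ y) * K (y⁻¹ * x) * g x := by
      simp only [Finset.mul_sum]
      rw [Finset.sum_comm' (t' := S) (s' := fun y => S \ cube A (τ y) y)]
      · exact Finset.sum_congr rfl fun x _ => Finset.sum_congr rfl fun y _ => by ring
      · intro x y
        rw [Finset.mem_sdiff, Finset.mem_sdiff, hτ.mem_comm]
        tauto
    rw [hsplit f g, hsplit f₀ g₀, hswap, add_sub_cancel_left, add_sub_cancel_left]
    rw [← Finset.sum_add_distrib, ← Finset.sum_add_distrib]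
    refine Finset.sum_congr rfl fun x _ => ?_
    rw [Finset.mul_sum, ← Finset.sum_add_distrib, ← Finset.sum_add_distrib]
    refine Finset.sum_congr rfl fun y _ => ?_
    ring
  rw [hdecomp]
  have hmain : ‖form K S f₀ g₀‖ ≤ B * a * b * S.card := hK.norm_form_le hf₀' hg₀' ha hb
  have hdiag : ‖∑ x ∈ S, ∑ y ∈ cube A (τ x) x, f₀ y * K (y⁻¹ * x) * g₀ x‖
      ≤ B * a * b * S.card := by
    refine (norm_sum_le _ _).trans ?_
    rw [mul_comm _ (S.card : ℝ), ← nsmul_eq_mul]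
    refine Finset.sum_le_card_nsmul _ _ _ fun x hx => ?_
    have : ∑ y ∈ cube A (τ x) x, f₀ y * K (y⁻¹ * x) * g₀ x
        = f₀ x * (∑ y ∈ cube A (τ x) x, K (y⁻¹ * x)) * g₀ x := by
      rw [Finset.mul_sum, Finset.sum_mul]
      refine Finset.sum_congr rfl fun y hy => ?_
      rw [hf₀, hτ.avg_eq f hy]
    rw [this, norm_mul, norm_mul]
    calc _ ≤ a * B * b := by
          gcongr
          · exact hf₀' x hx
          · exact hK.norm_sum_cube_le _ x
          · exact hg₀' x hx
      _ = _ := by ring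
  set C' := C * D ^ (1 + ε) with hC'
  have hC'0 : 0 ≤ C' := by positivity
  have hosc1 : ‖∑ x ∈ S, (f x - f₀ x) * ∑ y ∈ S \ cube A (τ x) x, K (x⁻¹ * y) * g y‖
      ≤ (C' * ((1 / (2 ^ ε - 1)) * b)) * ∑ x ∈ S, ‖f x‖ := by
    refine norm_sum_sub_avg_le hτ hS (k := fun x y => K (x⁻¹ * y))
      (W := fun x y => C' * (A.card (τ x) ^ ε * A.vol (x⁻¹ * y) ^ (-1 - ε))) ?_ ?_
    · intro x _ x' hx' y hy
      rw [Finset.mem_sdiff, mem_cube] at hy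
      rw [mem_cube] at hx'
      have := hK.norm_sub_le' (g := (x⁻¹ * x')⁻¹) hy.2 (inv_mem hx')
      rw [show (x⁻¹ * x')⁻¹ * (x⁻¹ * y) = x'⁻¹ * y by group, norm_sub_rev] at this
      rw [← mul_assoc]
      exact this
    · intro x hx
      have := sum_vol_mul_norm_le hτ hS hK.ε_pos hb hg x
      simp only [mul_assoc C', ← Finset.mul_sum]
      gcongr
  have hosc2 : ‖∑ x ∈ S, (g x - g₀ x) * ∑ y ∈ S \ cube A (τ x) x, K (y⁻¹ * x) * f₀ y‖
      ≤ (C' * ((1 / (2 ^ ε - 1)) * a)) * ∑ x ∈ S, ‖g x‖ := by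
    refine norm_sum_sub_avg_le hτ hS (k := fun x y => K (y⁻¹ * x))
      (W := fun x y => C' * (A.card (τ x) ^ ε * A.vol (x⁻¹ * y) ^ (-1 - ε))) ?_ ?_
    · intro x _ x' hx' y hy
      rw [Finset.mem_sdiff, mem_cube] at hy
      rw [mem_cube] at hx'
      have hz : y⁻¹ * x ∉ A.sub (τ x) := by
        rw [← inv_mem_iff]; simpa using hy.2
      have := hK.norm_sub_le hz hx'
      rw [show (y⁻¹ * x) * (x⁻¹ * x') = y⁻¹ * x' by group, norm_sub_rev, ← A.vol_inv (y⁻¹ * x),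
        show (y⁻¹ * x)⁻¹ = x⁻¹ * y by group] at this
      rw [← mul_assoc]
      exact this
    · intro x hx
      have := sum_vol_mul_norm_le hτ hS hK.ε_pos ha (u := f₀)
        (fun x hx => avg_le fun y hy => hf₀' y (hS x hx hy)) x
      simp only [mul_assoc C', ← Finset.mul_sum]
      gcongr
  have hsumf : ∑ x ∈ S, ‖f x‖ ≤ a * S.card := by
    rw [← sum_avg hτ hS, mul_comm, ← nsmul_eq_mul]
    exact Finset.sum_le_card_nsmul _ _ _ hf
  have hsumg : ∑ x ∈ S, ‖g x‖ ≤ b * S.card := by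
    rw [← sum_avg hτ hS, mul_comm, ← nsmul_eq_mul]
    exact Finset.sum_le_card_nsmul _ _ _ hg
  have hosc1' := hosc1.trans (mul_le_mul_of_nonneg_left hsumf (by positivity))
  have hosc2' := hosc2.trans (mul_le_mul_of_nonneg_left hsumg (by positivity))
  refine (norm_add_le_of_le (norm_sub_le_of_le hmain hdiag)
    (norm_add_le_of_le hosc1' hosc2')).trans_eq ?_
  unfold stepConst
  rw [← hC']
  ring

end Kernel

/-! ### The Bellman induction and `ℓ^r` bounds -/

lemma rpow_tangent_le {r w t : ℝ} (hr : 1 < r) (hw : 0 ≤ w) (ht : 0 ≤ t) :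
    r * t ^ (r - 1) * w - (r - 1) * t ^ r ≤ w ^ r := by
  rcases ht.eq_or_lt with rfl | ht
  · rw [Real.zero_rpow (by linarith), Real.zero_rpow (by linarith)]
    simpa using Real.rpow_nonneg hw r
  · have h := one_add_mul_self_le_rpow_one_add (s := w / t - 1) (p := r)
      (by have := div_nonneg hw ht.le; linarith) hr.le
    have h1 : (1 + (w / t - 1)) ^ r = w ^ r / t ^ r := by
      rw [← Real.div_rpow hw ht.le]; congr 1; ring
    rw [h1, le_div_iff₀ (by positivity)] at h
    have h2 : t ^ r = t ^ (r - 1) * t := by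
      rw [← Real.rpow_add_one ht.ne']; congr 1; ring
    calc r * t ^ (r - 1) * w - (r - 1) * t ^ r = (1 + r * (w / t - 1)) * t ^ r := by
          rw [h2]; field_simp; ring
      _ ≤ _ := h

open Classical in
/-- If at most half of the mass points of `Q` lie in `T`, then discounting the `r`-th powers on `T`
by `4^{1-r}` still leaves more than `4^{1-r}` times the `r`-th power of the mean. -/
lemma bellman_gain {X : Type*} {Q T : Finset X} (hT : T ⊆ Q) (hcard : 2 * (T.card : ℝ) ≤ Q.card)
    {r a : ℝ} (hr : 1 < r) (ha : 0 ≤ a) {w : X → ℝ} (hw : ∀ x, 0 ≤ w x)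
    (hsum : ∑ x ∈ Q, w x = a * Q.card) :
    3 ^ (1 - r) * a ^ r * Q.card ≤ ∑ x ∈ Q \ T, w x ^ r + 4 ^ (1 - r) * ∑ x ∈ T, w x ^ r := by
  have hr1 : 0 < r - 1 := by linarith
  -- tangent lines at `a / 3` and `4 a / 3`, whose weighted slopes agree
  have h1 : r * (a / 3) ^ (r - 1) * ∑ x ∈ Q \ T, w x - (r - 1) * (a / 3) ^ r * (Q \ T).card
      ≤ ∑ x ∈ Q \ T, w x ^ r := by
    calc _ = ∑ x ∈ Q \ T, (r * (a / 3) ^ (r - 1) * w x - (r - 1) * (a / 3) ^ r) := by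
          rw [Finset.sum_sub_distrib, Finset.mul_sum, Finset.sum_const, nsmul_eq_mul]; ring
      _ ≤ _ := Finset.sum_le_sum fun x _ => rpow_tangent_le hr (hw x) (by positivity)
  have h2 : r * (4 * (a / 3)) ^ (r - 1) * ∑ x ∈ T, w x - (r - 1) * (4 * (a / 3)) ^ r * T.card
      ≤ ∑ x ∈ T, w x ^ r := by
    calc _ = ∑ x ∈ T, (r * (4 * (a / 3)) ^ (r - 1) * w x - (r - 1) * (4 * (a / 3)) ^ r) := by
          rw [Finset.sum_sub_distrib, Finset.mul_sum, Finset.sum_const, nsmul_eq_mul]; ring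
      _ ≤ _ := Finset.sum_le_sum fun x _ => rpow_tangent_le hr (hw x) (by positivity)
  have h3 := mul_le_mul_of_nonneg_left h2 (show (0 : ℝ) ≤ 4 ^ (1 - r) by positivity)
  have hpos : (0 : ℝ) < 4 ^ (r - 1) := by positivity
  have e1 : (4 : ℝ) ^ (1 - r) = (4 ^ (r - 1))⁻¹ := by
    rw [← Real.rpow_neg (by norm_num)]; congr 1; ring
  have e2 : (4 * (a / 3)) ^ (r - 1) = 4 ^ (r - 1) * (a / 3) ^ (r - 1) :=
    Real.mul_rpow (by norm_num) (by positivity)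
  have e3 : (a / 3) ^ r = (a / 3) ^ (r - 1) * (a / 3) := by
    rw [← Real.rpow_add_one' (by positivity) (by linarith)]; congr 1; ring
  have e4 : (4 * (a / 3)) ^ r = 4 ^ (r - 1) * (a / 3) ^ (r - 1) * (4 * (a / 3)) := by
    rw [← e2, ← Real.rpow_add_one' (by positivity) (by linarith)]; congr 1; ring
  have e5 : (3 : ℝ) ^ (1 - r) * a ^ r = (a / 3) ^ (r - 1) * a := by
    have : a ^ r = a ^ (r - 1) * a := by
      rw [← Real.rpow_add_one' ha (by linarith)]; congr 1; ring
    rw [this, Real.div_rpow ha (by norm_num), show (1 : ℝ) - r = -(r - 1) by ring,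
      Real.rpow_neg (by norm_num)]
    field_simp
  have hs : ∑ x ∈ Q \ T, w x + ∑ x ∈ T, w x = a * Q.card := by
    rw [Finset.sum_sdiff hT, hsum]
  have hc : ((Q \ T).card : ℝ) + T.card = Q.card := by
    exact_mod_cast Finset.card_sdiff_add_card_eq_card hT
  set s := (a / 3) ^ (r - 1) with hsdef
  have hs0 : 0 ≤ s := by positivity
  rw [e2, e4, e1] at h3
  have h4 : (4 ^ (r - 1))⁻¹ * (r * (4 ^ (r - 1) * s) * ∑ x ∈ T, w x
      - (r - 1) * (4 ^ (r - 1) * s * (4 * (a / 3))) * T.card)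
      = r * s * ∑ x ∈ T, w x - (r - 1) * (s * (4 * (a / 3))) * T.card := by
    field_simp
  rw [h4] at h3
  rw [e3] at h1
  rw [e5, e1]
  refine le_trans ?_ (add_le_add h1 h3)
  have h5 : r * s * ∑ x ∈ Q \ T, w x - (r - 1) * (s * (a / 3)) * (Q \ T).card
      + (r * s * ∑ x ∈ T, w x - (r - 1) * (s * (4 * (a / 3))) * T.card)
      = r * s * (a * Q.card) - (r - 1) * s * (a / 3) * (Q.card + 3 * T.card) := by
    rw [← hs, ← hc]; ring
  rw [h5]
  have h6 : 0 ≤ (r - 1) * s * (a / 3) := by positivity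
  have h7 : (r - 1) * s * (a / 3) * (Q.card + 3 * T.card)
      ≤ (r - 1) * s * (a / 3) * (3 * Q.card) := by
    gcongr
    have : (0 : ℝ) ≤ Q.card := by positivity
    linarith
  linarith

/-- The Bellman functional: the `r`-th power sum over `Q`, reduced by a multiple of the `r`-th
power of the mean. -/
def energy {X : Type*} (r : ℝ) (Q : Finset X) (f : X → ℂ) : ℝ :=
  ∑ x ∈ Q, ‖f x‖ ^ r - 4 ^ (1 - r) * ((∑ x ∈ Q, ‖f x‖) / Q.card) ^ r * Q.card

/-- The gain in one stopping-time step. -/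
def gain (r : ℝ) : ℝ := 3 ^ (1 - r) - 4 ^ (1 - r)

lemma gain_pos {r : ℝ} (hr : 1 < r) : 0 < gain r := by
  have : (4 : ℝ) ^ (1 - r) < 3 ^ (1 - r) :=
    Real.rpow_lt_rpow_of_neg (by norm_num) (by norm_num) (by linarith)
  unfold gain; linarith

lemma energy_le {X : Type*} (r : ℝ) (Q : Finset X) (f : X → ℂ) :
    energy r Q f ≤ ∑ x ∈ Q, ‖f x‖ ^ r := by
  unfold energy
  have : 0 ≤ ∑ x ∈ Q, ‖f x‖ := Finset.sum_nonneg fun _ _ => norm_nonneg _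
  have : 0 ≤ 4 ^ (1 - r) * ((∑ x ∈ Q, ‖f x‖) / Q.card) ^ r * (Q.card : ℝ) := by positivity
  linarith

lemma gain_mul_le_energy_singleton {X : Type*} {r : ℝ} (hr : 1 < r) (x : X) (f : X → ℂ) :
    gain r * ‖f x‖ ^ r ≤ energy r {x} f := by
  unfold energy gain
  simp only [Finset.sum_singleton, Finset.card_singleton, Nat.cast_one, div_one, mul_one]
  have h3 : (3 : ℝ) ^ (1 - r) ≤ 1 :=
    Real.rpow_le_one_of_one_le_of_nonpos (by norm_num) (by linarith)
  have : 0 ≤ ‖f x‖ ^ r := by positivity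
  nlinarith

section Induction

variable {H : Type*} [Group H] [Fintype H] {A : NormalChain H} {K : H → ℂ} {B C D ε : ℝ}

lemma avg_energy (τ : H → ℕ) (r : ℝ) (f : H → ℂ) (x : H) :
    (A.card (τ x))⁻¹ * energy r (cube A (τ x) x) f
      = avg A τ (fun y => ‖f y‖ ^ r) x - 4 ^ (1 - r) * avg A τ (fun y => ‖f y‖) x ^ r := by
  unfold energy avg
  rw [card_cube, smul_eq_mul, smul_eq_mul]
  have := (A.card_pos (τ x)).ne'
  rw [div_eq_inv_mul]
  field_simp

lemma energy_step {τ : H → ℕ} {Q T : Finset H} (hτ : IsStopping A τ) (hT : T ⊆ Q)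
    (hTs : Saturated A τ T) (hcard : 2 * (T.card : ℝ) ≤ Q.card) (hQ : 0 < (Q.card : ℝ)) {r : ℝ}
    (hr : 1 < r) (f : H → ℂ) :
    ∑ x ∈ T, (A.card (τ x))⁻¹ * energy r (cube A (τ x) x) f
      + gain r * ((∑ x ∈ Q, ‖f x‖) / Q.card) ^ r * Q.card ≤ energy r Q f := by
  classical
  set w : H → ℝ := fun x => if x ∈ T then avg A τ (fun y => ‖f y‖) x else ‖f x‖ with hw
  set a := (∑ x ∈ Q, ‖f x‖) / Q.card with ha
  have hw0 : ∀ x, 0 ≤ w x := by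
    intro x
    simp only [hw]
    split_ifs
    · exact avg_nonneg (fun _ => norm_nonneg _) x
    · exact norm_nonneg _
  have hwT : ∀ x ∈ T, w x = avg A τ (fun y => ‖f y‖) x := fun x hx => by simp [hw, hx]
  have hwQ : ∀ x ∈ Q \ T, w x = ‖f x‖ := fun x hx => by
    simp [hw, (Finset.mem_sdiff.1 hx).2]
  have hsum : ∑ x ∈ Q, w x = a * Q.card := by
    rw [ha, div_mul_cancel₀ _ hQ.ne', ← Finset.sum_sdiff hT, ← Finset.sum_sdiff hT,
      Finset.sum_congr rfl hwQ, Finset.sum_congr rfl hwT, sum_avg hτ hTs]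
  have ha0 : 0 ≤ a := by
    rw [ha]; exact div_nonneg (Finset.sum_nonneg fun _ _ => norm_nonneg _) hQ.le
  have key := bellman_gain hT hcard hr ha0 hw0 hsum
  rw [Finset.sum_congr rfl (fun x hx => by rw [hwQ x hx] : ∀ x ∈ Q \ T, w x ^ r = ‖f x‖ ^ r),
    Finset.sum_congr rfl (fun x hx => by rw [hwT x hx] :
      ∀ x ∈ T, w x ^ r = avg A τ (fun y => ‖f y‖) x ^ r)] at key
  simp only [avg_energy, Finset.sum_sub_distrib, ← Finset.mul_sum]
  rw [sum_avg hτ hTs]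
  unfold energy gain
  rw [← ha, ← Finset.sum_sdiff hT (f := fun x => ‖f x‖ ^ r)]
  linarith

/-- Stopping cubes: the maximal proper subcosets on which one of the averages of `|f|`, `|g|`
exceeds four times its average over `Q = x₀ A_n`; points that are never stopped form cosets of
their own. -/
lemma exists_stopping (hK : IsCZKernel A K B C D ε) {n : ℕ} (hn : n < A.len) (x₀ : H)
    (u v : H → ℝ) (hu : ∀ x, 0 ≤ u x) (hv : ∀ x, 0 ≤ v x) {a b : ℝ}
    (ha : ∑ x ∈ cube A n x₀, u x = a * A.card n) (hb : ∑ x ∈ cube A n x₀, v x = b * A.card n) :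
    ∃ τ : H → ℕ, IsStopping A τ ∧ Saturated A τ (cube A n x₀) ∧ (∀ x, n < τ x ∧ τ x ≤ A.len) ∧
      (∀ x ∈ cube A n x₀, avg A τ u x ≤ D * (4 * a)) ∧
      (∀ x ∈ cube A n x₀, avg A τ v x ≤ D * (4 * b)) ∧
      ∀ x, 4 * a < avg A τ u x ∨ 4 * b < avg A τ v x ∨ τ x = A.len := by
  classical
  set P : H → ℕ → Prop := fun x m => n < m ∧
    (4 * a < avg A (fun _ => m) u x ∨ 4 * b < avg A (fun _ => m) v x ∨ A.len ≤ m) with hP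
  have hex : ∀ x, ∃ m, P x m := fun x => ⟨A.len, hn, Or.inr (Or.inr le_rfl)⟩
  set τ : H → ℕ := fun x => Nat.find (hex x) with hτdef
  have havg : ∀ (w : H → ℝ) (x : H), avg A τ w x = avg A (fun _ => τ x) w x := fun _ _ => rfl
  have hspec : ∀ x, P x (τ x) := fun x => Nat.find_spec (hex x)
  have hmin : ∀ x m, m < τ x → ¬ P x m := fun x m h => Nat.find_min (hex x) h
  have hle : ∀ x, τ x ≤ A.len := fun x => Nat.find_min' (hex x) ⟨hn, Or.inr (Or.inr le_rfl)⟩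
  have hPcongr : ∀ x y m, m ≤ τ x → y ∈ cube A (τ x) x → (P y m ↔ P x m) := by
    intro x y m hm hy
    have : cube A m y = cube A m x := cube_eq_of_mem A (cube_anti A hm x hy)
    simp only [hP, avg, this]
  have hstopping : IsStopping A τ := by
    intro x y hy
    refine le_antisymm (Nat.find_min' _ ((hPcongr x y _ le_rfl hy).2 (hspec x))) ?_
    by_contra! h
    exact hmin x _ h ((hPcongr x y _ h.le hy).1 (hspec y))
  have hcube : ∀ x ∈ cube A n x₀, cube A n x = cube A n x₀ := fun x hx => cube_eq_of_mem A hx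
  have hbound : ∀ (w : H → ℝ) (c : ℝ), (∀ x, 0 ≤ w x) →
      ∑ x ∈ cube A n x₀, w x = c * A.card n →
      (∀ x m, P x m ∨ m ≤ n ∨ avg A (fun _ => m) w x ≤ 4 * c) →
      ∀ x ∈ cube A n x₀, avg A τ w x ≤ D * (4 * c) := by
    intro w c hw hc hPw x hx
    have hc0 : 0 ≤ c := by
      have : 0 ≤ c * A.card n := hc ▸ Finset.sum_nonneg fun x _ => hw x
      exact nonneg_of_mul_nonneg_left this (A.card_pos n)
    obtain ⟨k, hk⟩ : ∃ k, τ x = k + 1 := ⟨τ x - 1, by have := (hspec x).1; omega⟩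
    have hnk : n ≤ k := by have := (hspec x).1; omega
    have hk4 : ∑ y ∈ cube A k x, w y ≤ 4 * c * A.card k := by
      rcases hnk.eq_or_lt with rfl | hlt
      · rw [hcube x hx, hc]
        have := A.card_pos n
        nlinarith [mul_nonneg hc0 this.le]
      · rcases hPw x k with h | h | h
        · exact absurd h (hmin x k (by omega))
        · omega
        · unfold avg at h
          rw [smul_eq_mul, ← div_eq_inv_mul, div_le_iff₀ (A.card_pos k)] at h
          exact h
    unfold avg
    rw [smul_eq_mul, ← div_eq_inv_mul, div_le_iff₀ (A.card_pos _), hk]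
    have h1 : ∑ y ∈ cube A (k + 1) x, w y ≤ ∑ y ∈ cube A k x, w y :=
      Finset.sum_le_sum_of_subset_of_nonneg (cube_anti A (Nat.le_succ k) x) fun y _ _ => hw y
    calc _ ≤ 4 * c * A.card k := h1.trans hk4
      _ ≤ 4 * c * (D * A.card (k + 1)) := by
          gcongr; exact hK.doubling k
      _ = _ := by ring
  refine ⟨τ, hstopping, ?_, fun x => ⟨(hspec x).1, hle x⟩, ?_, ?_, ?_⟩
  · intro x hx
    rw [← hcube x hx]
    exact cube_anti A (hspec x).1.le x
  · refine hbound u a hu ha fun x m => ?_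
    by_cases h : P x m
    · exact Or.inl h
    · by_cases h' : m ≤ n
      · exact Or.inr (Or.inl h')
      · refine Or.inr (Or.inr (not_lt.1 fun h'' => h ⟨by omega, Or.inl h''⟩))
  · refine hbound v b hv hb fun x m => ?_
    by_cases h : P x m
    · exact Or.inl h
    · by_cases h' : m ≤ n
      · exact Or.inr (Or.inl h')
      · refine Or.inr (Or.inr (not_lt.1 fun h'' => h ⟨by omega, Or.inr (Or.inl h'')⟩))
  · intro x
    rcases (hspec x).2 with h | h | h
    · exact Or.inl h
    · exact Or.inr (Or.inl h)
    · exact Or.inr (Or.inr (le_antisymm (hle x) h))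

open Classical in
lemma markov_avg {τ : H → ℕ} (hτ : IsStopping A τ) {Q : Finset H} (hQ : Saturated A τ Q)
    {u : H → ℝ} (hu : ∀ x, 0 ≤ u x) {a : ℝ} (ha : ∑ x ∈ Q, u x = a * Q.card) :
    4 * ((Q.filter fun x => 4 * a < avg A τ u x).card : ℝ) ≤ Q.card := by
  set T := Q.filter fun x => 4 * a < avg A τ u x
  rcases Q.eq_empty_or_nonempty with rfl | hne
  · simp [T]
  have hQpos : (0 : ℝ) < Q.card := by exact_mod_cast hne.card_pos
  have ha0 : 0 ≤ a := by
    have : 0 ≤ a * Q.card := ha ▸ Finset.sum_nonneg fun x _ => hu x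
    exact nonneg_of_mul_nonneg_left this hQpos
  have h1 : ∑ x ∈ T, avg A τ u x ≤ a * Q.card := by
    rw [← ha, ← sum_avg hτ hQ]
    exact Finset.sum_le_sum_of_subset_of_nonneg (Finset.filter_subset _ _) fun x _ _ =>
      avg_nonneg hu x
  rcases ha0.eq_or_lt with h0 | hpos
  · have : T = ∅ := by
      by_contra hT
      obtain ⟨x, hx⟩ := Finset.nonempty_iff_ne_empty.2 hT
      have h2 : 0 < ∑ x ∈ T, avg A τ u x := by
        refine Finset.sum_pos (fun y hy => ?_) ⟨x, hx⟩
        have := (Finset.mem_filter.1 hy).2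
        rw [← h0] at this
        linarith
      rw [← h0, zero_mul] at h1
      linarith
    rw [this]
    simp
  · have h2 : (T.card : ℝ) * (4 * a) ≤ ∑ x ∈ T, avg A τ u x := by
      rw [← nsmul_eq_mul]
      exact Finset.card_nsmul_le_sum _ _ _ fun x hx => (Finset.mem_filter.1 hx).2.le
    have h3 := h2.trans h1
    have h4 : a * (4 * (T.card : ℝ)) ≤ a * Q.card := by linarith
    exact le_of_mul_le_mul_left h4 hpos

/-- The constant in the bilinear bound. -/
def bilinConst (B C D ε r q : ℝ) : ℝ :=
  (stepConst B C D ε + B) * (D * 4) ^ 2 / min (gain r) (gain q)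

lemma mul_le_bilinConst (hK : IsCZKernel A K B C D ε) {r q : ℝ} (hrq : r.HolderConjugate q)
    {a b : ℝ} (ha : 0 ≤ a) (hb : 0 ≤ b) :
    (stepConst B C D ε + B) * (D * 4) ^ 2 * (a * b)
      ≤ bilinConst B C D ε r q * (gain r * a ^ r + gain q * b ^ q) := by
  have h1 := gain_pos hrq.lt
  have h2 := gain_pos hrq.symm.lt
  have h0 : 0 < min (gain r) (gain q) := lt_min h1 h2
  have hs := hK.stepConst_nonneg
  have hB := hK.B_nonneg
  have hD := hK.one_le_D
  have hy : a * b ≤ a ^ r + b ^ q := by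
    refine (Real.young_inequality_of_nonneg ha hb hrq).trans ?_
    have h3 : a ^ r / r ≤ a ^ r := div_le_self (by positivity) hrq.lt.le
    have h4 : b ^ q / q ≤ b ^ q := div_le_self (by positivity) hrq.symm.lt.le
    linarith
  unfold bilinConst
  rw [div_mul_eq_mul_div, le_div_iff₀ h0, mul_assoc]
  refine mul_le_mul_of_nonneg_left ?_ (by positivity)
  have ha' : 0 ≤ a ^ r := by positivity
  have hb' : 0 ≤ b ^ q := by positivity
  have h5 : min (gain r) (gain q) * a ^ r ≤ gain r * a ^ r :=
    mul_le_mul_of_nonneg_right (min_le_left _ _) ha'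
  have h6 : min (gain r) (gain q) * b ^ q ≤ gain q * b ^ q :=
    mul_le_mul_of_nonneg_right (min_le_right _ _) hb'
  calc a * b * min (gain r) (gain q) ≤ (a ^ r + b ^ q) * min (gain r) (gain q) := by gcongr
    _ ≤ _ := by linarith

lemma bilinConst_nonneg (hK : IsCZKernel A K B C D ε) {r q : ℝ} (hrq : r.HolderConjugate q) :
    0 ≤ bilinConst B C D ε r q := by
  have h1 := gain_pos hrq.lt
  have h2 := gain_pos hrq.symm.lt
  have hs := hK.stepConst_nonneg
  have hB := hK.B_nonneg
  have hD := hK.one_le_D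
  unfold bilinConst
  have h0 : 0 < min (gain r) (gain q) := lt_min h1 h2
  positivity

lemma cube_len (x : H) : cube A A.len x = {x} := by
  ext y
  rw [mem_cube, A.sub_len, Subgroup.mem_bot, Finset.mem_singleton, inv_mul_eq_one, eq_comm]

lemma IsCZKernel.norm_form_singleton_le (hK : IsCZKernel A K B C D ε) (x : H) (f g : H → ℂ) :
    ‖form K {x} f g‖ ≤ B * (‖f x‖ * ‖g x‖) := by
  have := hK.norm_form_le (S := {x}) (f := f) (g := g) (a := ‖f x‖) (b := ‖g x‖)
    (by simp) (by simp) (norm_nonneg _) (norm_nonneg _)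
  simpa [mul_assoc] using this

/-- By downward induction along the chain, the localized form is dominated by the Bellman
functionals of `f` and `g`. -/
lemma IsCZKernel.norm_form_cube_le (hK : IsCZKernel A K B C D ε) {r q : ℝ}
    (hrq : r.HolderConjugate q) (f g : H → ℂ) {n : ℕ} (hn : n ≤ A.len) :
    ∀ m, n ≤ m → m ≤ A.len → ∀ x, ‖form K (cube A m x) f g‖ ≤
      bilinConst B C D ε r q * (energy r (cube A m x) f + energy q (cube A m x) g) := by
  classical
  have hs := hK.stepConst_nonneg
  have hB := hK.B_nonneg
  have hD := hK.one_le_D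
  set M := bilinConst B C D ε r q with hM
  have hM0 : 0 ≤ M := bilinConst_nonneg hK hrq
  induction hn using Nat.decreasingInduction with
  | self =>
    intro m h1 h2 x
    obtain rfl := le_antisymm h1 h2
    rw [cube_len]
    refine (hK.norm_form_singleton_le x f g).trans ?_
    have h3 := mul_le_bilinConst hK hrq (norm_nonneg (f x)) (norm_nonneg (g x))
    have h4 : B * (‖f x‖ * ‖g x‖) ≤
        (stepConst B C D ε + B) * (D * 4) ^ 2 * (‖f x‖ * ‖g x‖) := by
      gcongr
      have : 1 ≤ (D * 4) ^ 2 := by nlinarith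
      nlinarith
    refine h4.trans (h3.trans ?_)
    rw [← hM]
    gcongr
    · exact gain_mul_le_energy_singleton hrq.lt x f
    · exact gain_mul_le_energy_singleton hrq.symm.lt x g
  | of_succ n hn ih =>
    intro m h1 h2 x₀
    rcases h1.lt_or_eq with h1 | rfl
    · exact ih m h1 h2 x₀
    set Q := cube A n x₀ with hQ
    have hQc : (Q.card : ℝ) = A.card n := card_cube A n x₀
    have hQpos : (0 : ℝ) < Q.card := hQc ▸ A.card_pos n
    set a := (∑ x ∈ Q, ‖f x‖) / Q.card with ha
    set b := (∑ x ∈ Q, ‖g x‖) / Q.card with hb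
    have ha0 : 0 ≤ a := div_nonneg (Finset.sum_nonneg fun _ _ => norm_nonneg _) hQpos.le
    have hb0 : 0 ≤ b := div_nonneg (Finset.sum_nonneg fun _ _ => norm_nonneg _) hQpos.le
    have ha' : ∑ x ∈ Q, ‖f x‖ = a * Q.card := by rw [ha, div_mul_cancel₀ _ hQpos.ne']
    have hb' : ∑ x ∈ Q, ‖g x‖ = b * Q.card := by rw [hb, div_mul_cancel₀ _ hQpos.ne']
    clear_value a b
    obtain ⟨τ, hτ, hsat, hτn, hfa, hgb, hstopping⟩ := exists_stopping hK hn x₀ (fun x => ‖f x‖)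
      (fun x => ‖g x‖) (fun _ => norm_nonneg _) (fun _ => norm_nonneg _) (hQc ▸ ha') (hQc ▸ hb')
    -- `T` consists of the points stopped because an average has grown; all others are singletons
    set T₁ := Q.filter fun x => 4 * a < avg A τ (fun x => ‖f x‖) x
    set T₂ := Q.filter fun x => 4 * b < avg A τ (fun x => ‖g x‖) x
    set T := T₁ ∪ T₂ with hTdef
    have hTQ : T ⊆ Q := Finset.union_subset (Finset.filter_subset _ _) (Finset.filter_subset _ _)
    have hTs : Saturated A τ T := by
      intro x hx y hy
      have hyQ := hsat x (hTQ hx) hy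
      simp only [hTdef, T₁, T₂, Finset.mem_union, Finset.mem_filter] at hx ⊢
      rw [hτ.avg_eq _ hy, hτ.avg_eq _ hy]
      tauto
    have hcard : 2 * (T.card : ℝ) ≤ Q.card := by
      have h3 := markov_avg hτ hsat (fun x => norm_nonneg (f x)) ha'
      have h4 := markov_avg hτ hsat (fun x => norm_nonneg (g x)) hb'
      have h5 : (T.card : ℝ) ≤ T₁.card + T₂.card := by exact_mod_cast Finset.card_union_le _ _
      linarith
    have hstep := hK.norm_form_sub_le hτ hsat (f := f) (g := g) (a := D * (4 * a))
      (b := D * (4 * b)) (by positivity) (by positivity) hfa hgb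
    have hrest : ∀ x ∈ Q \ T, ‖(A.card (τ x))⁻¹ • form K (cube A (τ x) x) f g‖
        ≤ B * ((D * (4 * a)) * (D * (4 * b))) := by
      intro x hx
      rw [Finset.mem_sdiff] at hx
      have hx' : τ x = A.len := by
        rcases hstopping x with h | h | h
        · exact absurd (Finset.mem_union_left _ (Finset.mem_filter.2 ⟨hx.1, h⟩)) hx.2
        · exact absurd (Finset.mem_union_right _ (Finset.mem_filter.2 ⟨hx.1, h⟩)) hx.2
        · exact h
      have havg : ∀ w : H → ℝ, avg A τ w x = w x := fun w => avg_congr_const fun y hy => by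
        rw [hx', cube_len, Finset.mem_singleton] at hy
        rw [hy]
      have h3 := hfa x hx.1
      have h4 := hgb x hx.1
      rw [havg] at h3 h4
      rw [hx', A.card_len, inv_one, one_smul, cube_len]
      refine (hK.norm_form_singleton_le x f g).trans ?_
      gcongr
    have hT : ∀ x ∈ T, ‖(A.card (τ x))⁻¹ • form K (cube A (τ x) x) f g‖
        ≤ M * ((A.card (τ x))⁻¹ * energy r (cube A (τ x) x) f
          + (A.card (τ x))⁻¹ * energy q (cube A (τ x) x) g) := by
      intro x _
      have hc := A.card_pos (τ x)
      rw [norm_smul, Real.norm_of_nonneg (by positivity), ← mul_add, mul_left_comm]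
      gcongr
      exact ih (τ x) (hτn x).1 (hτn x).2 x
    have hsumT := Finset.sum_le_sum hT
    have hsumR := Finset.sum_le_card_nsmul _ _ _ hrest
    rw [← Finset.mul_sum, Finset.sum_add_distrib] at hsumT
    have e1 := energy_step hτ hTQ hTs hcard hQpos hrq.lt f
    have e2 := energy_step hτ hTQ hTs hcard hQpos hrq.symm.lt g
    rw [← ha] at e1
    rw [← hb] at e2
    have hy := mul_le_bilinConst hK hrq ha0 hb0
    rw [← hM] at hy
    have hnorm : ‖form K Q f g‖ ≤ stepConst B C D ε * (D * (4 * a)) * (D * (4 * b)) * Q.card +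
        (∑ x ∈ Q \ T, ‖(A.card (τ x))⁻¹ • form K (cube A (τ x) x) f g‖
          + ∑ x ∈ T, ‖(A.card (τ x))⁻¹ • form K (cube A (τ x) x) f g‖) := by
      rw [Finset.sum_sdiff hTQ]
      calc ‖form K Q f g‖ = ‖(form K Q f g - ∑ x ∈ Q, (A.card (τ x))⁻¹ •
            form K (cube A (τ x) x) f g) + ∑ x ∈ Q, (A.card (τ x))⁻¹ •
            form K (cube A (τ x) x) f g‖ := by rw [sub_add_cancel]
        _ ≤ _ := norm_add_le_of_le hstep (norm_sum_le _ _)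
    have hcard2 : ((Q \ T).card : ℝ) ≤ Q.card := by
      exact_mod_cast Finset.card_le_card Finset.sdiff_subset
    have hR' : ∑ x ∈ Q \ T, ‖(A.card (τ x))⁻¹ • form K (cube A (τ x) x) f g‖
        ≤ Q.card * (B * ((D * (4 * a)) * (D * (4 * b)))) := by
      refine hsumR.trans ?_
      rw [nsmul_eq_mul]
      gcongr
    have hgain : (stepConst B C D ε + B) * (D * 4) ^ 2 * (a * b) * Q.card
        ≤ M * (gain r * a ^ r * Q.card + gain q * b ^ q * Q.card) := by
      calc _ ≤ M * (gain r * a ^ r + gain q * b ^ q) * Q.card :=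
            mul_le_mul_of_nonneg_right hy hQpos.le
        _ = _ := by ring
    calc ‖form K Q f g‖ ≤ (stepConst B C D ε + B) * (D * 4) ^ 2 * (a * b) * Q.card
          + M * (∑ x ∈ T, (A.card (τ x))⁻¹ * energy r (cube A (τ x) x) f
            + ∑ x ∈ T, (A.card (τ x))⁻¹ * energy q (cube A (τ x) x) g) := by
          refine hnorm.trans ?_
          refine (add_le_add_right (add_le_add hR' hsumT) _).trans_eq ?_
          ring
      _ ≤ M * (gain r * a ^ r * Q.card + gain q * b ^ q * Q.card)
          + M * (∑ x ∈ T, (A.card (τ x))⁻¹ * energy r (cube A (τ x) x) f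
            + ∑ x ∈ T, (A.card (τ x))⁻¹ * energy q (cube A (τ x) x) g) := by gcongr
      _ = M * ((∑ x ∈ T, (A.card (τ x))⁻¹ * energy r (cube A (τ x) x) f
            + gain r * a ^ r * Q.card) + (∑ x ∈ T, (A.card (τ x))⁻¹ * energy q (cube A (τ x) x) g
            + gain q * b ^ q * Q.card)) := by ring
      _ ≤ M * (energy r Q f + energy q Q g) := mul_le_mul_of_nonneg_left (add_le_add e1 e2) hM0

lemma IsCZKernel.norm_sum_conv_mul_le (hK : IsCZKernel A K B C D ε) {r q : ℝ}
    (hrq : r.HolderConjugate q) (f g : H → ℂ) :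
    ‖∑ x, conv K f x * g x‖ ≤
      bilinConst B C D ε r q * (∑ x, ‖f x‖ ^ r + ∑ x, ‖g x‖ ^ q) := by
  have h := hK.norm_form_cube_le hrq f g (Nat.zero_le _) 0 le_rfl (Nat.zero_le _) 1
  have hcube : cube A 0 (1 : H) = Finset.univ := by
    ext y; simp [mem_cube, A.sub_zero]
  rw [hcube, form_eq_sum_conv] at h
  simp only [Finset.mem_univ, if_true] at h
  refine h.trans ?_
  have := bilinConst_nonneg hK hrq
  gcongr
  · exact energy_le _ _ _
  · exact energy_le _ _ _

end Induction

/-- The `ℓ^r` bound of a Calderón–Zygmund operator. -/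
def lrConst (B C D ε r : ℝ) : ℝ :=
  2 * bilinConst B C D ε r r.conjExponent * (2 * bilinConst B C D ε r r.conjExponent + 1) ^ (r - 1)

section Weighted

variable {H : Type*} [Group H] [Fintype H] {A : NormalChain H} {K : H → ℂ} {B C D ε : ℝ}

lemma IsCZKernel.sum_norm_conv_rpow_le (hK : IsCZKernel A K B C D ε) {r : ℝ} (hr : 1 < r)
    (f : H → ℂ) :
    ∑ x, ‖conv K f x‖ ^ r ≤ lrConst B C D ε r * ∑ x, ‖f x‖ ^ r := by
  set q := r.conjExponent with hq
  have hrq : r.HolderConjugate q := Real.HolderConjugate.conjExponent hr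
  unfold lrConst
  rw [← hq]
  set M := bilinConst B C D ε r q
  have hM : 0 ≤ M := bilinConst_nonneg hK hrq
  have hmul : (r - 1) * (q - 1) = 1 := by
    have := hrq.sub_one_mul_conj
    linarith
  -- test against a multiple of `conj u |u|^{r-2}`, the multiple being small enough to absorb
  set s : ℝ := (2 * M + 1) ^ (-(r - 1)) with hs
  have hspos : 0 < s := by positivity
  have hsq : s ^ q = s * (2 * M + 1)⁻¹ := by
    have : q = 1 + (q - 1) := by ring
    rw [this, Real.rpow_add hspos, Real.rpow_one]
    congr 1
    rw [hs, ← Real.rpow_mul (by positivity), neg_mul, hmul, Real.rpow_neg_one]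
  set u := conv K f with hu
  have hnorm : ∀ x, ‖(s : ℂ) * ((starRingEnd ℂ) (u x) * ((‖u x‖ ^ (r - 2) : ℝ) : ℂ))‖ ^ q
      = s ^ q * ‖u x‖ ^ r := by
    intro x
    rw [norm_mul, norm_mul, RCLike.norm_conj, Complex.norm_real, Complex.norm_real,
      Real.norm_of_nonneg hspos.le, Real.norm_of_nonneg (by positivity),
      Real.mul_rpow hspos.le (by positivity)]
    congr 1
    rcases (norm_nonneg (u x)).eq_or_lt with h0 | h0
    · rw [← h0, zero_mul, Real.zero_rpow hrq.symm.ne_zero, Real.zero_rpow hrq.ne_zero]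
    · rw [← Real.rpow_one_add' h0.le (by linarith), ← Real.rpow_mul h0.le]
      congr 1
      have := hrq.sub_one_mul_conj
      linarith
  have hmulu : ∀ x, u x * ((s : ℂ) * ((starRingEnd ℂ) (u x) * ((‖u x‖ ^ (r - 2) : ℝ) : ℂ)))
      = ((s * ‖u x‖ ^ r : ℝ) : ℂ) := by
    intro x
    have h1 : u x * ((s : ℂ) * ((starRingEnd ℂ) (u x) * ((‖u x‖ ^ (r - 2) : ℝ) : ℂ)))
        = s * ((u x * (starRingEnd ℂ) (u x)) * ((‖u x‖ ^ (r - 2) : ℝ) : ℂ)) := by ring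
    rw [h1, Complex.mul_conj']
    norm_cast
    congr 1
    rcases (norm_nonneg (u x)).eq_or_lt with h0 | h0
    · rw [← h0, Real.zero_rpow hrq.ne_zero]; simp
    · rw [← Real.rpow_natCast, ← Real.rpow_add h0]
      congr 1; push_cast; ring
  have h := hK.norm_sum_conv_mul_le hrq f
    (fun x => (s : ℂ) * ((starRingEnd ℂ) (u x) * ((‖u x‖ ^ (r - 2) : ℝ) : ℂ)))
  simp only [hnorm, ← hu, hmulu] at h
  rw [← Complex.ofReal_sum, Complex.norm_real, ← Finset.mul_sum, ← Finset.mul_sum] at h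
  set U := ∑ x, ‖u x‖ ^ r with hU
  set F := ∑ x, ‖f x‖ ^ r with hF
  have hU0 : 0 ≤ U := Finset.sum_nonneg fun _ _ => by positivity
  have hF0 : 0 ≤ F := Finset.sum_nonneg fun _ _ => by positivity
  rw [Real.norm_of_nonneg (by positivity), hsq] at h
  have h2 : M * (s * (2 * M + 1)⁻¹ * U) ≤ s / 2 * U := by
    have : M * (2 * M + 1)⁻¹ ≤ 1 / 2 := by
      rw [← div_eq_mul_inv, div_le_div_iff₀ (by positivity) (by norm_num)]
      linarith
    calc M * (s * (2 * M + 1)⁻¹ * U) = (M * (2 * M + 1)⁻¹) * (s * U) := by ring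
      _ ≤ 1 / 2 * (s * U) := by gcongr
      _ = _ := by ring
  have h3 : s * U ≤ 2 * M * F := by linarith
  have h4 : (2 * M + 1) ^ (r - 1) = s⁻¹ := by
    rw [hs, Real.rpow_neg (by positivity), inv_inv]
  rw [h4]
  calc U = s⁻¹ * (s * U) := by field_simp
    _ ≤ s⁻¹ * (2 * M * F) := by gcongr
    _ = _ := by ring

/-- The constant of the Schur test for the Hardy kernel with test function `v^β`. -/
def hardyConst (β : ℝ) : ℝ := 1 / (1 - 2 ^ (-(1 + β))) + 1 / (2 ^ (-β) - 1)

lemma hardyConst_nonneg {β : ℝ} (hβ : -1 < β) (hβ' : β < 0) : 0 ≤ hardyConst β := by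
  have h1 : (2 : ℝ) ^ (-(1 + β)) < 1 :=
    Real.rpow_lt_one_of_one_lt_of_neg (by norm_num) (by linarith)
  have h2 : (1 : ℝ) < 2 ^ (-β) := one_lt_two_rpow (by linarith)
  unfold hardyConst
  have h1' : 0 < 1 - (2 : ℝ) ^ (-(1 + β)) := by linarith
  have h2' : 0 < (2 : ℝ) ^ (-β) - 1 := by linarith
  positivity

/-- Power weights of Muckenhoupt type are admissible for the Hardy operator. -/
lemma sum_hardy_rpow_le (A : NormalChain H) {r a s : ℝ} (hr : 1 < r) (hs0 : 0 < s) (hs1 : s < 1)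
    (h1 : -1 < a - s * (r - 1)) (h2 : a - s * (r - 1) < 0) (f : H → ℝ) (hf : ∀ x, 0 ≤ f x) :
    ∑ x, (∑ y, f y / max (A.vol x) (A.vol y)) ^ r * A.vol x ^ a
      ≤ hardyConst (-s) ^ (r - 1) * hardyConst (a - s * (r - 1)) *
        ∑ x, f x ^ r * A.vol x ^ a := by
  have hc1 := hardyConst_nonneg (β := -s) (by linarith) (by linarith)
  have hc2 := hardyConst_nonneg h1 h2
  have hmax : ∀ x y, 0 < max (A.vol x) (A.vol y) := fun x y => lt_max_of_lt_left (A.vol_pos x)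
  have hpt : ∀ x, (∑ y, f y / max (A.vol x) (A.vol y)) ^ r ≤
      hardyConst (-s) ^ (r - 1) * A.vol x ^ (-(s * (r - 1))) *
        ∑ y, f y ^ r * A.vol y ^ (s * (r - 1)) / max (A.vol x) (A.vol y) := by
    intro x
    have hx := A.vol_pos x
    have hol := Real.inner_le_weight_mul_Lp_of_nonneg Finset.univ hr.le
      (fun y => A.vol y ^ (-s) / max (A.vol x) (A.vol y)) (fun y => f y * A.vol y ^ s)
      (fun y => by have := A.vol_pos y; have := hmax x y; positivity)
      (fun y => by have := A.vol_pos y; have := hf y; positivity)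
    have e1 : ∀ y, A.vol y ^ (-s) / max (A.vol x) (A.vol y) * (f y * A.vol y ^ s)
        = f y / max (A.vol x) (A.vol y) := by
      intro y
      have hy := A.vol_pos y
      rw [Real.rpow_neg hy.le]
      have : A.vol y ^ s ≠ 0 := by positivity
      field_simp
    have e2 : ∀ y, A.vol y ^ (-s) / max (A.vol x) (A.vol y) * (f y * A.vol y ^ s) ^ r
        = f y ^ r * A.vol y ^ (s * (r - 1)) / max (A.vol x) (A.vol y) := by
      intro y
      have hy := A.vol_pos y
      rw [Real.mul_rpow (hf y) (by positivity), ← Real.rpow_mul hy.le,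
        show s * (r - 1) = -s + s * r by ring, Real.rpow_add hy]
      ring
    simp only [e1, e2] at hol
    set X := ∑ y, f y / max (A.vol x) (A.vol y)
    set Y := ∑ y, f y ^ r * A.vol y ^ (s * (r - 1)) / max (A.vol x) (A.vol y)
    set Z := ∑ y, A.vol y ^ (-s) / max (A.vol x) (A.vol y)
    have hX : 0 ≤ X := Finset.sum_nonneg fun y _ => by
      have := hf y; have := hmax x y; positivity
    have hY : 0 ≤ Y := Finset.sum_nonneg fun y _ => by
      have := hf y; have := hmax x y; have := A.vol_pos y; positivity
    have hZ : 0 ≤ Z := Finset.sum_nonneg fun y _ => by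
      have := hmax x y; have := A.vol_pos y; positivity
    have hZ' : Z ≤ hardyConst (-s) * A.vol x ^ (-s) :=
      A.sum_vol_div_max x (by linarith) (by linarith)
    clear_value X Y Z
    calc X ^ r ≤ (Z ^ (1 - r⁻¹) * Y ^ r⁻¹) ^ r := by gcongr
      _ = Z ^ (r - 1) * Y := by
          rw [Real.mul_rpow (by positivity) (by positivity), ← Real.rpow_mul hZ,
            ← Real.rpow_mul hY, inv_mul_cancel₀ (by linarith), Real.rpow_one]
          congr 2; field_simp
      _ ≤ (hardyConst (-s) * A.vol x ^ (-s)) ^ (r - 1) * Y := by gcongr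
      _ = _ := by
          rw [Real.mul_rpow hc1 (by positivity), ← Real.rpow_mul hx.le]
          congr 3; ring
  calc ∑ x, (∑ y, f y / max (A.vol x) (A.vol y)) ^ r * A.vol x ^ a
      ≤ ∑ x, (hardyConst (-s) ^ (r - 1) * A.vol x ^ (-(s * (r - 1))) *
        ∑ y, f y ^ r * A.vol y ^ (s * (r - 1)) / max (A.vol x) (A.vol y)) * A.vol x ^ a := by
        refine Finset.sum_le_sum fun x _ => ?_
        have := A.vol_pos x
        gcongr
        exact hpt x
    _ = hardyConst (-s) ^ (r - 1) * ∑ y, f y ^ r * A.vol y ^ (s * (r - 1)) *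
          ∑ x, A.vol x ^ (a - s * (r - 1)) / max (A.vol y) (A.vol x) := by
        simp only [Finset.mul_sum, Finset.sum_mul]
        rw [Finset.sum_comm]
        refine Finset.sum_congr rfl fun y _ => Finset.sum_congr rfl fun x _ => ?_
        rw [show a - s * (r - 1) = -(s * (r - 1)) + a by ring, Real.rpow_add (A.vol_pos x),
          max_comm (A.vol y)]
        ring
    _ ≤ hardyConst (-s) ^ (r - 1) * ∑ y, f y ^ r * A.vol y ^ (s * (r - 1)) *
          (hardyConst (a - s * (r - 1)) * A.vol y ^ (a - s * (r - 1))) := by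
        gcongr with y _
        · have := A.vol_pos y; have := hf y; positivity
        · exact A.sum_vol_div_max y h1 h2
    _ = _ := by
        rw [mul_assoc, Finset.mul_sum (a := hardyConst (a - s * (r - 1)))]
        congr 1
        refine Finset.sum_congr rfl fun y _ => ?_
        have hy := A.vol_pos y
        have : A.vol y ^ a = A.vol y ^ (s * (r - 1)) * A.vol y ^ (a - s * (r - 1)) := by
          rw [← Real.rpow_add hy]; congr 1; ring
        rw [this]; ring

/-- The constant of the weighted bound. -/
def weightedConst (B C D ε r a s : ℝ) : ℝ :=
  2 ^ (r - 1) * (lrConst B C D ε r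
    + (C * D) ^ r * (hardyConst (-s) ^ (r - 1) * hardyConst (a - s * (r - 1))))

lemma add_rpow_le {x y r : ℝ} (hx : 0 ≤ x) (hy : 0 ≤ y) (hr : 1 ≤ r) :
    (x + y) ^ r ≤ 2 ^ (r - 1) * (x ^ r + y ^ r) := by
  lift x to NNReal using hx
  lift y to NNReal using hy
  exact_mod_cast NNReal.rpow_add_le_mul_rpow_add_rpow x y hr

/-- The weighted bound. On a sphere `{v = c}` the weight is constant, so the unweighted bound
applies to the part of `f` living there; the other spheres interact through the Hardy kernel. -/
lemma IsCZKernel.sum_norm_conv_rpow_mul_vol_le (hK : IsCZKernel A K B C D ε) {r a s : ℝ}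
    (hr : 1 < r) (hs0 : 0 < s) (hs1 : s < 1) (h1 : -1 < a - s * (r - 1))
    (h2 : a - s * (r - 1) < 0) (f : H → ℂ) :
    ∑ x, ‖conv K f x‖ ^ r * A.vol x ^ a ≤
      weightedConst B C D ε r a s * ∑ x, ‖f x‖ ^ r * A.vol x ^ a := by
  classical
  have hC := hK.C_nonneg
  have hD := hK.one_le_D
  set loc : ℝ → H → ℂ := fun c y => if A.vol y = c then f y else 0 with hloc
  have hpt : ∀ x, ‖conv K f x‖ ≤ ‖conv K (loc (A.vol x)) x‖
      + (C * D) * ∑ y, ‖f y‖ / max (A.vol x) (A.vol y) := by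
    intro x
    have hsplit : conv K f x = conv K (loc (A.vol x)) x
        + ∑ y with A.vol y ≠ A.vol x, f y * K (y⁻¹ * x) := by
      unfold conv
      rw [← Finset.sum_filter_add_sum_filter_not Finset.univ (fun y => A.vol y = A.vol x)]
      congr 1
      rw [Finset.sum_filter]
      refine Finset.sum_congr rfl fun y _ => ?_
      simp only [hloc]
      split_ifs <;> simp
    rw [hsplit]
    refine norm_add_le_of_le le_rfl ((norm_sum_le _ _).trans ?_)
    rw [Finset.mul_sum]
    calc _ ≤ ∑ y with A.vol y ≠ A.vol x, C * D * (‖f y‖ / max (A.vol x) (A.vol y)) := by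
          refine Finset.sum_le_sum fun y hy => ?_
          have hne := (Finset.mem_filter.1 hy).2
          have hne1 : y⁻¹ * x ≠ 1 := fun h => hne (by rw [inv_mul_eq_one] at h; rw [h])
          have := hK.norm_le hne1
          rw [A.vol_inv_mul_eq_max hne.symm] at this
          rw [norm_mul]
          calc _ ≤ ‖f y‖ * (C * D / max (A.vol x) (A.vol y)) := by gcongr
            _ = _ := by ring
      _ ≤ _ := Finset.sum_le_sum_of_subset_of_nonneg (Finset.filter_subset _ _) fun y _ _ => by
          have : 0 < max (A.vol x) (A.vol y) := lt_max_of_lt_left (A.vol_pos x)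
          positivity
  have hlocal : ∑ x, ‖conv K (loc (A.vol x)) x‖ ^ r * A.vol x ^ a
      ≤ lrConst B C D ε r * ∑ x, ‖f x‖ ^ r * A.vol x ^ a := by
    have hmaps : ∀ x ∈ (Finset.univ : Finset H), A.vol x ∈ Finset.univ.image A.vol :=
      fun x hx => Finset.mem_image_of_mem _ hx
    rw [← Finset.sum_fiberwise_of_maps_to hmaps, ← Finset.sum_fiberwise_of_maps_to hmaps,
      Finset.mul_sum]
    refine Finset.sum_le_sum fun c hc => ?_
    have hc0 : 0 < c := by
      obtain ⟨x, _, rfl⟩ := Finset.mem_image.1 hc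
      exact A.vol_pos x
    calc ∑ x with A.vol x = c, ‖conv K (loc (A.vol x)) x‖ ^ r * A.vol x ^ a
        = (∑ x with A.vol x = c, ‖conv K (loc c) x‖ ^ r) * c ^ a := by
          rw [Finset.sum_mul]
          refine Finset.sum_congr rfl fun x hx => ?_
          rw [(Finset.mem_filter.1 hx).2]
      _ ≤ (∑ x, ‖conv K (loc c) x‖ ^ r) * c ^ a := by
          gcongr
          exact Finset.filter_subset _ _
      _ ≤ (lrConst B C D ε r * ∑ x, ‖loc c x‖ ^ r) * c ^ a := by
          gcongr
          exact hK.sum_norm_conv_rpow_le hr _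
      _ = _ := by
          rw [mul_assoc, Finset.sum_mul, Finset.sum_filter]
          congr 1
          refine Finset.sum_congr rfl fun x _ => ?_
          simp only [hloc]
          split_ifs with h
          · rw [h]
          · rw [norm_zero, Real.zero_rpow (by linarith), zero_mul]
  have hhardy := sum_hardy_rpow_le A hr hs0 hs1 h1 h2 (fun x => ‖f x‖) (fun _ => norm_nonneg _)
  have hh0 : ∀ x, 0 ≤ ∑ y, ‖f y‖ / max (A.vol x) (A.vol y) := fun x =>
    Finset.sum_nonneg fun y _ => by
      have : 0 < max (A.vol x) (A.vol y) := lt_max_of_lt_left (A.vol_pos x)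
      positivity
  calc ∑ x, ‖conv K f x‖ ^ r * A.vol x ^ a
      ≤ ∑ x, (2 ^ (r - 1) * (‖conv K (loc (A.vol x)) x‖ ^ r
          + ((C * D) * ∑ y, ‖f y‖ / max (A.vol x) (A.vol y)) ^ r)) * A.vol x ^ a := by
        refine Finset.sum_le_sum fun x _ => ?_
        have hx := A.vol_pos x
        have hh := hh0 x
        gcongr
        refine (Real.rpow_le_rpow (norm_nonneg _) (hpt x) (by linarith)).trans ?_
        exact add_rpow_le (norm_nonneg _) (by positivity) hr.le
    _ = 2 ^ (r - 1) * (∑ x, ‖conv K (loc (A.vol x)) x‖ ^ r * A.vol x ^ a + (C * D) ^ r *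
          ∑ x, (∑ y, ‖f y‖ / max (A.vol x) (A.vol y)) ^ r * A.vol x ^ a) := by
        rw [Finset.mul_sum, ← Finset.sum_add_distrib, Finset.mul_sum]
        refine Finset.sum_congr rfl fun x _ => ?_
        rw [Real.mul_rpow (by positivity) (hh0 x)]
        ring
    _ ≤ 2 ^ (r - 1) * (lrConst B C D ε r * ∑ x, ‖f x‖ ^ r * A.vol x ^ a + (C * D) ^ r *
          (hardyConst (-s) ^ (r - 1) * hardyConst (a - s * (r - 1)) *
            ∑ x, ‖f x‖ ^ r * A.vol x ^ a)) := by gcongr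
    _ = _ := by unfold weightedConst; ring

end Weighted

lemma exists_schur_exponent {r a : ℝ} (hr : 1 < r) (ha : -1 < a) (ha' : a < r - 1) :
    ∃ s, 0 < s ∧ s < 1 ∧ -1 < a - s * (r - 1) ∧ a - s * (r - 1) < 0 := by
  have hr1 : 0 < r - 1 := by linarith
  obtain ⟨s, h1, h2⟩ : ∃ s, max 0 (a / (r - 1)) < s ∧ s < min 1 ((a + 1) / (r - 1)) := by
    refine exists_between (max_lt (lt_min one_pos ?_) (lt_min ?_ ?_))
    · exact div_pos (by linarith) hr1
    · rw [div_lt_one hr1]; exact ha'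
    · exact div_lt_div_of_pos_right (by linarith) hr1
  rw [max_lt_iff] at h1
  rw [lt_min_iff] at h2
  have h3 := (div_lt_iff₀ hr1).1 h1.2
  have h4 := (lt_div_iff₀ hr1).1 h2.2
  exact ⟨s, h1.1, h2.1, by linarith, by linarith⟩

/-- Calderón–Zygmund operators on finite groups are bounded on `ℓ^r(v^a)`, `-1 < a < r - 1`, with a
bound that depends only on the structure constants. -/
theorem exists_weighted_bound (B C D ε : ℝ) {r a : ℝ} (hr : 1 < r) (ha : -1 < a)
    (ha' : a < r - 1) :
    ∃ M : ℝ, 0 ≤ M ∧ ∀ {H : Type} [Group H] [Fintype H] {A : NormalChain H} {K : H → ℂ},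
      IsCZKernel A K B C D ε → ∀ f : H → ℂ,
        ∑ x, ‖conv K f x‖ ^ r * A.vol x ^ a ≤ M * ∑ x, ‖f x‖ ^ r * A.vol x ^ a := by
  obtain ⟨s, h1, h2, h3, h4⟩ := exists_schur_exponent hr ha ha'
  refine ⟨max 0 (weightedConst B C D ε r a s), le_max_left _ _, fun hK f => ?_⟩
  refine (hK.sum_norm_conv_rpow_mul_vol_le hr h1 h2 h3 h4 f).trans ?_
  refine mul_le_mul_of_nonneg_right (le_max_right _ _) (Finset.sum_nonneg fun x _ => ?_)
  have := NormalChain.vol_pos ‹_› x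
  positivity

/-! ### Complete reducibility and Schur orthogonality -/

section Reducibility

variable {ι κ : Type} [Fintype ι] [DecidableEq ι] [Fintype κ] [DecidableEq κ]

/-- The permutation matrix of a bijection between index types. -/
def permUnitary (e : ι ≃ κ) : Matrix κ ι ℂ := (1 : Matrix ι ι ℂ).submatrix e.symm id

lemma permUnitary_conjTranspose (e : ι ≃ κ) :
    (permUnitary e)ᴴ = (1 : Matrix ι ι ℂ).submatrix id e.symm := by
  simp [permUnitary, Matrix.conjTranspose_submatrix]

lemma permUnitary_mul_conjTranspose (e : ι ≃ κ) : permUnitary e * (permUnitary e)ᴴ = 1 := by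
  rw [permUnitary_conjTranspose, permUnitary,
    ← Matrix.submatrix_mul _ _ _ _ _ Function.bijective_id, Matrix.mul_one,
    Matrix.submatrix_one_equiv]

lemma conjTranspose_mul_permUnitary (e : ι ≃ κ) : (permUnitary e)ᴴ * permUnitary e = 1 := by
  rw [permUnitary_conjTranspose, permUnitary,
    ← Matrix.submatrix_mul _ _ _ _ _ e.symm.bijective, Matrix.mul_one, Matrix.submatrix_id_id]

lemma permUnitary_conj (e : ι ≃ κ) (A : Matrix ι ι ℂ) :
    permUnitary e * A * (permUnitary e)ᴴ = A.submatrix e.symm e.symm := by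
  ext i j
  simp [permUnitary, Matrix.mul_apply, Matrix.one_apply]

variable {G : Type*} [Group G] [TopologicalSpace G]

namespace UnitaryRep

lemma ext_toHom {π π' : UnitaryRep G ι} (h : ∀ x, π.toHom x = π'.toHom x) : π = π' := by
  cases π; cases π'
  congr
  exact MonoidHom.ext h

lemma mul_conjTranspose (π : UnitaryRep G ι) (x : G) : π.toHom x * (π.toHom x)ᴴ = 1 :=
  Matrix.mem_unitaryGroup_iff.1 (π.unitary x)

lemma conjTranspose_mul (π : UnitaryRep G ι) (x : G) : (π.toHom x)ᴴ * π.toHom x = 1 :=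
  Matrix.mem_unitaryGroup_iff'.1 (π.unitary x)

lemma toHom_inv (π : UnitaryRep G ι) (x : G) : π.toHom x⁻¹ = (π.toHom x)ᴴ := by
  have h : π.toHom x⁻¹ * π.toHom x = 1 := by rw [← map_mul, inv_mul_cancel, map_one]
  calc π.toHom x⁻¹ = π.toHom x⁻¹ * (π.toHom x * (π.toHom x)ᴴ) := by
        rw [π.mul_conjTranspose, mul_one]
    _ = _ := by rw [← Matrix.mul_assoc, h, one_mul]

/-- Change of orthonormal basis. -/
def conj (U : Matrix κ ι ℂ) (h1 : U * Uᴴ = 1) (h2 : Uᴴ * U = 1) (π : UnitaryRep G ι) :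
    UnitaryRep G κ where
  toHom :=
    { toFun := fun x => U * π.toHom x * Uᴴ
      map_one' := by simp [h1]
      map_mul' := by
        intro x y
        rw [map_mul]
        calc U * (π.toHom x * π.toHom y) * Uᴴ
            = U * π.toHom x * (1 * π.toHom y * Uᴴ) := by simp only [Matrix.mul_assoc, one_mul]
          _ = _ := by rw [← h2]; simp only [Matrix.mul_assoc] }
  unitary x := by
    rw [Matrix.mem_unitaryGroup_iff, Matrix.star_eq_conjTranspose]
    change U * π.toHom x * Uᴴ * (U * π.toHom x * Uᴴ)ᴴ = 1
    rw [Matrix.conjTranspose_mul, Matrix.conjTranspose_mul, Matrix.conjTranspose_conjTranspose]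
    calc U * π.toHom x * Uᴴ * (U * ((π.toHom x)ᴴ * Uᴴ))
        = U * π.toHom x * (Uᴴ * U) * (π.toHom x)ᴴ * Uᴴ := by simp only [Matrix.mul_assoc]
      _ = U * (π.toHom x * (π.toHom x)ᴴ) * Uᴴ := by
          rw [h2, Matrix.mul_one]; simp only [Matrix.mul_assoc]
      _ = 1 := by rw [π.mul_conjTranspose, Matrix.mul_one, h1]
  continuous_toHom :=
    (continuous_const.matrix_mul π.continuous_toHom).matrix_mul continuous_const

lemma isUnitaryEquiv_conj (U : Matrix κ ι ℂ) (h1 : U * Uᴴ = 1) (h2 : Uᴴ * U = 1)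
    (π : UnitaryRep G ι) : IsUnitaryEquiv U π (π.conj U h1 h2) :=
  ⟨h1, h2, fun _ => rfl⟩

lemma IsUnitaryEquiv.symm {U : Matrix κ ι ℂ} {π : UnitaryRep G ι} {π' : UnitaryRep G κ}
    (h : IsUnitaryEquiv U π π') : IsUnitaryEquiv Uᴴ π' π := by
  obtain ⟨h1, h2, h3⟩ := h
  refine ⟨by simpa using h2, by simpa using h1, fun x => ?_⟩
  rw [h3 x, Matrix.conjTranspose_conjTranspose]
  calc π.toHom x = (Uᴴ * U) * π.toHom x * (Uᴴ * U) := by simp [h2]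
    _ = Uᴴ * (U * π.toHom x * Uᴴ) * U := by simp only [Matrix.mul_assoc]

lemma IsUnitaryEquiv.irreducible {U : Matrix κ ι ℂ} {π : UnitaryRep G ι} {π' : UnitaryRep G κ}
    (h : IsUnitaryEquiv U π π') (hne : Nonempty κ) (hπ : π.Irreducible) : π'.Irreducible := by
  obtain ⟨h1, h2, h3⟩ := h
  refine ⟨hne, fun W hW => ?_⟩
  have hUU : ∀ w, U *ᵥ (Uᴴ *ᵥ w) = w := fun w => by
    rw [Matrix.mulVec_mulVec, h1, Matrix.one_mulVec]
  have hinv : ∀ x, ∀ v ∈ W.comap (Matrix.mulVecLin U),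
      π.toHom x *ᵥ v ∈ W.comap (Matrix.mulVecLin U) := by
    intro x v hv
    have hv' : U *ᵥ v ∈ W := hv
    change U *ᵥ (π.toHom x *ᵥ v) ∈ W
    have h4 : U *ᵥ (π.toHom x *ᵥ v) = π'.toHom x *ᵥ (U *ᵥ v) := by
      rw [h3, Matrix.mulVec_mulVec, Matrix.mulVec_mulVec, Matrix.mul_assoc _ Uᴴ U, h2,
        Matrix.mul_one]
    rw [h4]
    exact hW x _ hv'
  rcases hπ.2 _ hinv with h | h
  · left
    rw [eq_bot_iff]
    intro w hw
    have : Uᴴ *ᵥ w ∈ W.comap (Matrix.mulVecLin U) := by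
      simpa [hUU w] using hw
    rw [h, Submodule.mem_bot] at this
    rw [Submodule.mem_bot, ← hUU w, this, Matrix.mulVec_zero]
  · right
    rw [eq_top_iff]
    intro w _
    have : Uᴴ *ᵥ w ∈ W.comap (Matrix.mulVecLin U) := by rw [h]; trivial
    simpa [hUU w] using this

/-- An irreducible representation, with its index type replaced by `Fin n`. -/
lemma Irreducible.exists_irrep {π : UnitaryRep G ι} (hπ : π.Irreducible) :
    ∃ (ξ : Irrep G) (U : Matrix ι (Fin ξ.dim) ℂ), IsUnitaryEquiv U ξ.rep π := by
  set e : ι ≃ Fin (Fintype.card ι) := Fintype.equivFin ι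
  have h1 := permUnitary_mul_conjTranspose e
  have h2 := conjTranspose_mul_permUnitary e
  have h := isUnitaryEquiv_conj (permUnitary e) h1 h2 π
  have hne : Nonempty (Fin (Fintype.card ι)) := hπ.1.map e
  exact ⟨⟨_, π.conj (permUnitary e) h1 h2, h.irreducible hne hπ⟩, _, h.symm⟩

/-- A representation on a direct sum whose lower left block vanishes splits. -/
lemma exists_eq_sum_of_block_zero (π : UnitaryRep G (ι ⊕ κ))
    (h : ∀ x, (π.toHom x).toBlocks₂₁ = 0) :
    ∃ (π₁ : UnitaryRep G ι) (π₂ : UnitaryRep G κ), π = π₁.sum π₂ := by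
  have h' : ∀ x, (π.toHom x).toBlocks₁₂ = 0 := by
    intro x
    have := h x⁻¹
    rw [π.toHom_inv] at this
    ext i j
    have h3 := congrFun (congrFun this j) i
    simp only [Matrix.toBlocks₂₁, Matrix.conjTranspose_apply, Matrix.of_apply,
      Matrix.zero_apply, star_eq_zero] at h3
    simpa [Matrix.toBlocks₁₂] using h3
  have hb : ∀ x, π.toHom x =
      Matrix.fromBlocks (π.toHom x).toBlocks₁₁ 0 0 (π.toHom x).toBlocks₂₂ := by
    intro x
    conv_lhs => rw [← Matrix.fromBlocks_toBlocks (π.toHom x), h x, h' x]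
  have hmul : ∀ x y, π.toHom (x * y) =
      Matrix.fromBlocks ((π.toHom x).toBlocks₁₁ * (π.toHom y).toBlocks₁₁) 0 0
        ((π.toHom x).toBlocks₂₂ * (π.toHom y).toBlocks₂₂) := by
    intro x y
    rw [map_mul, hb x, hb y, Matrix.fromBlocks_multiply]
    simp
  have huni : ∀ x, Matrix.fromBlocks
      ((π.toHom x).toBlocks₁₁ * ((π.toHom x).toBlocks₁₁)ᴴ) 0 0
      ((π.toHom x).toBlocks₂₂ * ((π.toHom x).toBlocks₂₂)ᴴ) = (1 : Matrix (ι ⊕ κ) (ι ⊕ κ) ℂ) := by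
    intro x
    have := π.mul_conjTranspose x
    rw [hb x, Matrix.fromBlocks_conjTranspose, Matrix.fromBlocks_multiply] at this
    simpa using this
  refine ⟨⟨⟨⟨fun x => (π.toHom x).toBlocks₁₁, ?_⟩, ?_⟩, ?_, ?_⟩,
    ⟨⟨⟨fun x => (π.toHom x).toBlocks₂₂, ?_⟩, ?_⟩, ?_, ?_⟩, ?_⟩
  · rw [map_one, ← Matrix.fromBlocks_one, Matrix.toBlocks_fromBlocks₁₁]
  · intro x y
    change (π.toHom (x * y)).toBlocks₁₁ = _
    rw [hmul, Matrix.toBlocks_fromBlocks₁₁]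
  · intro x
    have := congrArg Matrix.toBlocks₁₁ (huni x)
    rw [← Matrix.fromBlocks_one, Matrix.toBlocks_fromBlocks₁₁, Matrix.toBlocks_fromBlocks₁₁] at this
    exact Matrix.mem_unitaryGroup_iff.2 this
  · exact continuous_matrix fun i j => π.continuous_toHom.matrix_elem (Sum.inl i) (Sum.inl j)
  · rw [map_one, ← Matrix.fromBlocks_one, Matrix.toBlocks_fromBlocks₂₂]
  · intro x y
    change (π.toHom (x * y)).toBlocks₂₂ = _
    rw [hmul, Matrix.toBlocks_fromBlocks₂₂]
  · intro x
    have := congrArg Matrix.toBlocks₂₂ (huni x)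
    rw [← Matrix.fromBlocks_one, Matrix.toBlocks_fromBlocks₂₂, Matrix.toBlocks_fromBlocks₂₂] at this
    exact Matrix.mem_unitaryGroup_iff.2 this
  · exact continuous_matrix fun i j => π.continuous_toHom.matrix_elem (Sum.inr i) (Sum.inr j)
  · exact ext_toHom hb

/-- An invariant subspace and its orthogonal complement give a splitting. -/
lemma exists_isUnitaryEquiv_sum (π : UnitaryRep G ι) (W : Submodule ℂ (ι → ℂ))
    (hW : ∀ x, ∀ v ∈ W, π.toHom x *ᵥ v ∈ W) (hbot : W ≠ ⊥) (htop : W ≠ ⊤) :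
    ∃ (a b : ℕ) (π₁ : UnitaryRep G (Fin a)) (π₂ : UnitaryRep G (Fin b))
      (U : Matrix (Fin a ⊕ Fin b) ι ℂ), a < Fintype.card ι ∧ b < Fintype.card ι ∧
      IsUnitaryEquiv U π (π₁.sum π₂) := by
  set L := WithLp.linearEquiv 2 ℂ (ι → ℂ)
  set E : Submodule ℂ (EuclideanSpace ℂ ι) := W.comap L.toLinearMap with hE
  set v : OrthonormalBasis _ ℂ (EuclideanSpace ℂ ι) :=
    ((stdOrthonormalBasis ℂ E).prod (stdOrthonormalBasis ℂ Eᗮ)).map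
      E.orthogonalDecomposition.symm with hv
  have hvl : ∀ i, v (Sum.inl i) ∈ E := by
    intro i
    have : v (Sum.inl i) = (stdOrthonormalBasis ℂ E i : EuclideanSpace ℂ ι) := by
      simp [hv]
    rw [this]; exact Subtype.property _
  have hvr : ∀ i, v (Sum.inr i) ∈ Eᗮ := by
    intro i
    have : v (Sum.inr i) = (stdOrthonormalBasis ℂ Eᗮ i : EuclideanSpace ℂ ι) := by
      simp [hv]
    rw [this]; exact Subtype.property _
  set U : Matrix _ ι ℂ := Matrix.of fun k i => star (v k i) with hU
  have h1 : U * Uᴴ = 1 := by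
    ext k l
    have := orthonormal_iff_ite.1 v.orthonormal k l
    rw [Matrix.mul_apply, Matrix.one_apply, ← this, EuclideanSpace.inner_eq_star_dotProduct]
    simp [hU, dotProduct, mul_comm]
  have hcardeq := Module.finrank_eq_card_basis v.toBasis
  rw [finrank_euclideanSpace] at hcardeq
  have h2 : Uᴴ * U = 1 := (Matrix.mul_eq_one_comm_of_card_eq ι _ ℂ hcardeq).2 h1
  have hfin : Module.finrank ℂ E + Module.finrank ℂ Eᗮ = Fintype.card ι := by
    rw [E.finrank_add_finrank_orthogonal, finrank_euclideanSpace]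
  have hE0 : 0 < Module.finrank ℂ E := by
    rw [Module.finrank_pos_iff, Submodule.nontrivial_iff_ne_bot]
    intro h
    apply hbot
    rw [eq_bot_iff]
    intro w hw
    have : L.symm w ∈ E := by simpa [hE] using hw
    rw [h, Submodule.mem_bot] at this
    simpa using this
  have hE1 : 0 < Module.finrank ℂ Eᗮ := by
    rw [Module.finrank_pos_iff, Submodule.nontrivial_iff_ne_bot]
    intro h
    apply htop
    rw [Submodule.orthogonal_eq_bot_iff] at h
    rw [eq_top_iff]
    intro w _
    have : L.symm w ∈ E := by rw [h]; trivial
    simpa [hE] using this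
  have hblock : ∀ x, ((π.conj U h1 h2).toHom x).toBlocks₂₁ = 0 := by
    intro x
    ext k l
    have hmem : WithLp.toLp 2 (π.toHom x *ᵥ (v (Sum.inl l)).ofLp) ∈ E := hW x _ (hvl l)
    have horth := (Submodule.mem_orthogonal' E _).1 (hvr k) _ hmem
    rw [EuclideanSpace.inner_eq_star_dotProduct] at horth
    change (U * π.toHom x * Uᴴ) (Sum.inr k) (Sum.inl l) = 0
    rw [Matrix.mul_assoc, Matrix.mul_apply, ← horth, dotProduct]
    refine Finset.sum_congr rfl fun i _ => ?_
    rw [mul_comm]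
    simp [hU, Matrix.mul_apply, Matrix.mulVec, dotProduct]
  obtain ⟨π₁, π₂, h⟩ := exists_eq_sum_of_block_zero _ hblock
  refine ⟨_, _, π₁, π₂, U, by omega, by omega, ?_⟩
  rw [← h]
  exact isUnitaryEquiv_conj U h1 h2 π

/-- Complete reducibility, as an induction principle: a property of unitary representations that is
invariant under unitary equivalence and direct sums needs only be checked on irreducible ones. -/
theorem induction_on_irrep
    {P : ∀ {ι : Type} [Fintype ι] [DecidableEq ι], UnitaryRep G ι → Prop}
    (irrep : ∀ ξ : Irrep G, P ξ.rep)
    (empty : ∀ {ι : Type} [Fintype ι] [DecidableEq ι] [IsEmpty ι] (π : UnitaryRep G ι), P π)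
    (equiv : ∀ {ι κ : Type} [Fintype ι] [DecidableEq ι] [Fintype κ] [DecidableEq κ]
      (U : Matrix κ ι ℂ) (π : UnitaryRep G ι) (π' : UnitaryRep G κ),
      IsUnitaryEquiv U π π' → P π → P π')
    (sum : ∀ {ι κ : Type} [Fintype ι] [DecidableEq ι] [Fintype κ] [DecidableEq κ]
      (π : UnitaryRep G ι) (π' : UnitaryRep G κ), P π → P π' → P (π.sum π'))
    {ι : Type} [Fintype ι] [DecidableEq ι] (π : UnitaryRep G ι) : P π := by
  obtain ⟨n, hn⟩ : ∃ n, Fintype.card ι = n := ⟨_, rfl⟩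
  induction n using Nat.strong_induction_on generalizing ι with
  | _ n ih =>
    rcases isEmpty_or_nonempty ι with he | hne
    · exact empty π
    by_cases hirr : π.Irreducible
    · obtain ⟨ξ, U, hU⟩ := hirr.exists_irrep
      exact equiv U ξ.rep π hU (irrep ξ)
    · unfold Irreducible at hirr
      push Not at hirr
      obtain ⟨W, hW, hbot, htop⟩ := hirr hne
      obtain ⟨a, b, π₁, π₂, U, ha, hb, hU⟩ := π.exists_isUnitaryEquiv_sum W hW hbot htop
      refine equiv _ _ _ hU.symm (sum π₁ π₂ ?_ ?_)
      · exact ih a (by omega) π₁ (by simp)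
      · exact ih b (by omega) π₂ (by simp)

/-- Schur's lemma: the commutant of an irreducible representation is scalar. -/
lemma Irreducible.exists_eq_smul_one {π : UnitaryRep G ι} (hπ : π.Irreducible) {M : Matrix ι ι ℂ}
    (hM : ∀ x, π.toHom x * M = M * π.toHom x) : ∃ c : ℂ, M = c • 1 := by
  have := hπ.1
  obtain ⟨c, hc⟩ := Module.End.exists_eigenvalue (Matrix.mulVecLin M)
  refine ⟨c, ?_⟩
  have hinv : ∀ x, ∀ v ∈ Module.End.eigenspace (Matrix.mulVecLin M) c,
      π.toHom x *ᵥ v ∈ Module.End.eigenspace (Matrix.mulVecLin M) c := by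
    intro x v hv
    have hv' : M *ᵥ v = c • v := Module.End.mem_eigenspace_iff.1 hv
    rw [Module.End.mem_eigenspace_iff, Matrix.mulVecLin_apply, Matrix.mulVec_mulVec, ← hM,
      ← Matrix.mulVec_mulVec, hv', Matrix.mulVec_smul]
  rcases hπ.2 _ hinv with h | h
  · exact absurd h hc
  · apply Matrix.ext_of_mulVec_single
    intro i
    have : (Pi.single i 1 : ι → ℂ) ∈ Module.End.eigenspace (Matrix.mulVecLin M) c := by
      rw [h]; trivial
    rw [Module.End.mem_eigenspace_iff, Matrix.mulVecLin_apply] at this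
    rw [this, Matrix.smul_mulVec, Matrix.one_mulVec]

open scoped ComplexOrder in
/-- Schur's lemma: an intertwiner of inequivalent irreducible representations vanishes. -/
lemma eq_zero_of_intertwine {π : UnitaryRep G ι} {π' : UnitaryRep G κ} (hπ : π.Irreducible)
    (hπ' : π'.Irreducible) (hne : ∀ U : Matrix κ ι ℂ, ¬ IsUnitaryEquiv U π π')
    {M : Matrix κ ι ℂ} (hM : ∀ x, π'.toHom x * M = M * π.toHom x) : M = 0 := by
  have hM' : ∀ x, π.toHom x * Mᴴ = Mᴴ * π'.toHom x := by
    intro x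
    have := congrArg Matrix.conjTranspose (hM x⁻¹)
    rw [Matrix.conjTranspose_mul, Matrix.conjTranspose_mul, π.toHom_inv, π'.toHom_inv,
      Matrix.conjTranspose_conjTranspose, Matrix.conjTranspose_conjTranspose] at this
    exact this.symm
  obtain ⟨c, hc⟩ := hπ.exists_eq_smul_one (M := Mᴴ * M) fun x => by
    rw [← Matrix.mul_assoc, hM', Matrix.mul_assoc, hM, Matrix.mul_assoc]
  obtain ⟨c', hc'⟩ := hπ'.exists_eq_smul_one (M := M * Mᴴ) fun x => by
    rw [← Matrix.mul_assoc, hM, Matrix.mul_assoc, hM', Matrix.mul_assoc]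
  by_contra hM0
  have hcc : c = c' := by
    have h1 : M * (Mᴴ * M) = c • M := by rw [hc]; simp
    have h2 : M * (Mᴴ * M) = c' • M := by rw [← Matrix.mul_assoc, hc']; simp
    exact smul_left_injective ℂ hM0 (h1.symm.trans h2)
  obtain ⟨i⟩ := hπ.1
  have hdiag : c = ((∑ k, ‖M k i‖ ^ 2 : ℝ) : ℂ) := by
    have := congrFun (congrFun hc i) i
    rw [Matrix.mul_apply, Matrix.smul_apply, Matrix.one_apply_eq, smul_eq_mul, mul_one] at this
    rw [← this]
    push_cast
    refine Finset.sum_congr rfl fun k _ => ?_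
    rw [Matrix.conjTranspose_apply, Complex.star_def, Complex.conj_mul']
  set t := ∑ k, ‖M k i‖ ^ 2
  have ht : 0 < t := by
    refine lt_of_le_of_ne (Finset.sum_nonneg fun k _ => by positivity) fun h0 => hM0 ?_
    rw [← h0, Complex.ofReal_zero] at hdiag
    rw [hdiag, zero_smul] at hc
    exact Matrix.conjTranspose_mul_self_eq_zero.1 hc
  have hs : ((Real.sqrt t : ℝ) : ℂ)⁻¹ * ((Real.sqrt t : ℝ) : ℂ)⁻¹ * c = 1 := by
    rw [hdiag, ← mul_inv, ← Complex.ofReal_mul, Real.mul_self_sqrt ht.le, inv_mul_cancel₀]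
    exact_mod_cast ht.ne'
  set s : ℂ := ((Real.sqrt t : ℝ) : ℂ)⁻¹ with hsdef
  have hstar : star s = s := by simp [hsdef]
  refine hne (s • M) ?_
  have e1 : s • M * (s • M)ᴴ = 1 := by
    rw [Matrix.conjTranspose_smul, hstar, Matrix.smul_mul, Matrix.mul_smul, smul_smul, hc', ← hcc,
      smul_smul, hs, one_smul]
  have e2 : (s • M)ᴴ * s • M = 1 := by
    rw [Matrix.conjTranspose_smul, hstar, Matrix.smul_mul, Matrix.mul_smul, smul_smul, hc,
      smul_smul, hs, one_smul]
  refine ⟨e1, e2, fun x => ?_⟩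
  have : s • M * π.toHom x = π'.toHom x * s • M := by
    rw [Matrix.smul_mul, ← hM, Matrix.mul_smul]
  rw [this, Matrix.mul_assoc, e1, mul_one]

end UnitaryRep

end Reducibility

section Orthogonality

variable {G : Type*} [Group G] [TopologicalSpace G] [IsTopologicalGroup G] [CompactSpace G]
  [MeasurableSpace G] [BorelSpace G]
variable (μ : Measure G) [IsProbabilityMeasure μ] [μ.IsMulLeftInvariant]
variable {ι κ : Type} [Fintype ι] [DecidableEq ι] [Fintype κ] [DecidableEq κ]

lemma integrable_of_continuous {f : G → ℂ} (hf : Continuous f) : Integrable f μ :=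
  hf.integrable_of_hasCompactSupport (HasCompactSupport.of_compactSpace f)

namespace UnitaryRep

lemma continuous_entry (π : UnitaryRep G ι) (i j : ι) : Continuous fun x => π.toHom x i j :=
  π.continuous_toHom.matrix_elem i j

/-- The intertwiner `∫ π'(z) E_{jk} π(z)* dz`. -/
def averaged (π' : UnitaryRep G κ) (π : UnitaryRep G ι) (j : κ) (k : ι) : Matrix κ ι ℂ :=
  Matrix.of fun i l => ∫ z, π'.toHom z i j * star (π.toHom z l k) ∂μ

lemma averaged_intertwine (π' : UnitaryRep G κ) (π : UnitaryRep G ι) (j : κ) (k : ι) (g : G) :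
    π'.toHom g * averaged μ π' π j k = averaged μ π' π j k * π.toHom g := by
  have hint : ∀ i l, Integrable (fun z => π'.toHom z i j * star (π.toHom z l k)) μ := fun i l =>
    integrable_of_continuous μ ((π'.continuous_entry i j).mul (π.continuous_entry l k).star)
  have h : π'.toHom g * averaged μ π' π j k * (π.toHom g)ᴴ = averaged μ π' π j k := by
    ext i l
    have h1 : averaged μ π' π j k i l =
        ∫ z, ∑ b, ∑ a, π'.toHom g i a * (π'.toHom z a j * star (π.toHom z b k))
          * star (π.toHom g l b) ∂μ := by
      simp only [averaged, Matrix.of_apply]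
      rw [← integral_mul_left_eq_self _ g]
      congr 1
      ext z
      rw [map_mul, map_mul, Matrix.mul_apply, Matrix.mul_apply, star_sum, Finset.sum_mul_sum,
        Finset.sum_comm]
      refine Finset.sum_congr rfl fun b _ => Finset.sum_congr rfl fun a _ => ?_
      rw [star_mul']
      ring
    rw [h1, integral_finsetSum _ fun b _ => integrable_finsetSum _ fun a _ =>
      ((hint a b).const_mul _).mul_const _, Matrix.mul_apply]
    refine Finset.sum_congr rfl fun b _ => ?_
    rw [integral_finsetSum _ fun a _ => ((hint a b).const_mul _).mul_const _, Matrix.mul_apply,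
      Finset.sum_mul]
    refine Finset.sum_congr rfl fun a _ => ?_
    rw [integral_mul_const, integral_const_mul]
    rfl
  calc π'.toHom g * averaged μ π' π j k
      = π'.toHom g * averaged μ π' π j k * ((π.toHom g)ᴴ * π.toHom g) := by
        rw [π.conjTranspose_mul, Matrix.mul_one]
    _ = _ := by rw [← Matrix.mul_assoc, h]

/-- Schur orthogonality for inequivalent irreducible representations. -/
lemma integral_entry_mul_star_of_not_equiv {π : UnitaryRep G ι} {π' : UnitaryRep G κ}
    (hπ : π.Irreducible) (hπ' : π'.Irreducible)
    (hne : ∀ U : Matrix κ ι ℂ, ¬ IsUnitaryEquiv U π π') (i j : κ) (l k : ι) :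
    ∫ z, π'.toHom z i j * star (π.toHom z l k) ∂μ = 0 :=
  congrFun (congrFun (eq_zero_of_intertwine hπ hπ' hne (averaged_intertwine μ π' π j k)) i) l

/-- Schur orthogonality for the entries of one irreducible representation. -/
lemma Irreducible.integral_entry_mul_star {π : UnitaryRep G ι} (hπ : π.Irreducible)
    (i j l k : ι) :
    ∫ z, π.toHom z i j * star (π.toHom z l k) ∂μ
      = if i = l ∧ j = k then (Fintype.card ι : ℂ)⁻¹ else 0 := by
  obtain ⟨c, hc⟩ := hπ.exists_eq_smul_one (averaged_intertwine μ π π j k)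
  have hent : ∀ i l, ∫ z, π.toHom z i j * star (π.toHom z l k) ∂μ = c * (1 : Matrix ι ι ℂ) i l :=
    fun i l => congrFun (congrFun hc i) l
  have := hπ.1
  have hcard : (Fintype.card ι : ℂ) ≠ 0 := by exact_mod_cast Fintype.card_ne_zero
  have htr : (Fintype.card ι : ℂ) * c = if j = k then 1 else 0 := by
    have h1 : ∑ i, ∫ z, π.toHom z i j * star (π.toHom z i k) ∂μ = (Fintype.card ι : ℂ) * c := by
      rw [Finset.sum_congr rfl fun i _ => hent i i]
      simp
    have hint : ∀ i, Integrable (fun z => π.toHom z i j * star (π.toHom z i k)) μ := fun i =>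
      integrable_of_continuous μ ((π.continuous_entry i j).mul (π.continuous_entry i k).star)
    rw [← h1, ← integral_finsetSum _ fun i _ => hint i]
    have h2 : ∀ z, ∑ i, π.toHom z i j * star (π.toHom z i k) = if j = k then 1 else 0 := by
      intro z
      have := congrFun (congrFun (π.conjTranspose_mul z) k) j
      rw [Matrix.mul_apply, Matrix.one_apply] at this
      simp only [Matrix.conjTranspose_apply] at this
      simp only [eq_comm (a := j)]
      rw [← this]
      exact Finset.sum_congr rfl fun i _ => mul_comm _ _
    rw [integral_congr_ae (Filter.Eventually.of_forall h2)]
    simp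
  rw [hent, Matrix.one_apply]
  have hc' : c = (Fintype.card ι : ℂ)⁻¹ * (if j = k then 1 else 0) := by
    rw [← htr]; field_simp
  rw [hc']
  by_cases h1 : i = l <;> by_cases h2 : j = k <;> simp [h1, h2]

end UnitaryRep

end Orthogonality

/-! ### Operator norms and difference operators on reducible representations -/

section OpNorm

variable {ι κ : Type} [Fintype ι] [DecidableEq ι] [Fintype κ] [DecidableEq κ]

lemma sum_norm_mulVec_sq_le (A : Matrix ι ι ℂ) (v : ι → ℂ) :
    ∑ i, ‖(A *ᵥ v) i‖ ^ 2 ≤ opNorm A ^ 2 * ∑ i, ‖v i‖ ^ 2 := by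
  have h := (Matrix.toEuclideanCLM (𝕜 := ℂ) A).le_opNorm (WithLp.toLp 2 v)
  have h2 := pow_le_pow_left₀ (norm_nonneg _) h 2
  rw [mul_pow, EuclideanSpace.norm_sq_eq, EuclideanSpace.norm_sq_eq,
    Matrix.ofLp_toEuclideanCLM] at h2
  exact h2

lemma opNorm_le_of_forall {A : Matrix ι ι ℂ} {c : ℝ} (hc : 0 ≤ c)
    (h : ∀ v : ι → ℂ, ∑ i, ‖(A *ᵥ v) i‖ ^ 2 ≤ c ^ 2 * ∑ i, ‖v i‖ ^ 2) : opNorm A ≤ c := by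
  refine ContinuousLinearMap.opNorm_le_bound _ hc fun v => ?_
  refine (le_abs_self _).trans (abs_le_of_sq_le_sq ?_ (by positivity))
  rw [mul_pow, EuclideanSpace.norm_sq_eq, EuclideanSpace.norm_sq_eq, Matrix.ofLp_toEuclideanCLM]
  exact h v.ofLp

lemma opNorm_nonneg (A : Matrix ι ι ℂ) : 0 ≤ opNorm A := norm_nonneg _

lemma opNorm_zero : opNorm (0 : Matrix ι ι ℂ) = 0 := by simp [opNorm]

lemma opNorm_smul (c : ℂ) (A : Matrix ι ι ℂ) : opNorm (c • A) = ‖c‖ * opNorm A := by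
  simp [opNorm, norm_smul]

lemma norm_entry_le_opNorm (A : Matrix ι ι ℂ) (i j : ι) : ‖A i j‖ ≤ opNorm A := by
  have h := sum_norm_mulVec_sq_le A (Pi.single j 1)
  have h1 : ∑ i, ‖(Pi.single j 1 : ι → ℂ) i‖ ^ 2 = 1 := by
    rw [Finset.sum_eq_single j] <;> simp +contextual
  rw [h1, mul_one] at h
  refine (le_abs_self _).trans (abs_le_of_sq_le_sq (le_trans ?_ h) (opNorm_nonneg A))
  refine le_trans ?_ (Finset.single_le_sum (f := fun i => ‖(A *ᵥ Pi.single j 1) i‖ ^ 2)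
    (fun _ _ => by positivity) (Finset.mem_univ i))
  simp

lemma opNorm_fromBlocks_le {A : Matrix ι ι ℂ} {B : Matrix κ κ ℂ} {c : ℝ}
    (hA : opNorm A ≤ c) (hB : opNorm B ≤ c) : opNorm (Matrix.fromBlocks A 0 0 B) ≤ c := by
  have hc : 0 ≤ c := (opNorm_nonneg A).trans hA
  refine opNorm_le_of_forall hc fun v => ?_
  rw [Fintype.sum_sum_type, Fintype.sum_sum_type, mul_add]
  have h1 := sum_norm_mulVec_sq_le A (v ∘ Sum.inl)
  have h2 := sum_norm_mulVec_sq_le B (v ∘ Sum.inr)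
  simp only [Matrix.fromBlocks_mulVec, Sum.elim_inl, Sum.elim_inr, Matrix.zero_mulVec, add_zero,
    zero_add]
  have hA2 : opNorm A ^ 2 ≤ c ^ 2 := pow_le_pow_left₀ (opNorm_nonneg A) hA 2
  have hB2 : opNorm B ^ 2 ≤ c ^ 2 := pow_le_pow_left₀ (opNorm_nonneg B) hB 2
  refine add_le_add (h1.trans ?_) (h2.trans ?_)
  · exact mul_le_mul_of_nonneg_right hA2 (Finset.sum_nonneg fun _ _ => by positivity)
  · exact mul_le_mul_of_nonneg_right hB2 (Finset.sum_nonneg fun _ _ => by positivity)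

lemma opNorm_of_isEmpty [IsEmpty ι] (A : Matrix ι ι ℂ) : opNorm A = 0 := by
  rw [Subsingleton.elim A 0, opNorm_zero]

open scoped Matrix.Norms.L2Operator in
lemma opNorm_conj_le {U : Matrix κ ι ℂ} (h : Uᴴ * U = 1) (A : Matrix ι ι ℂ) :
    opNorm (U * A * Uᴴ) ≤ opNorm A := by
  have hU : ‖U‖ ≤ 1 := by
    have h1 := Matrix.l2_opNorm_conjTranspose_mul_self U
    rw [h] at h1
    rcases isEmpty_or_nonempty ι with he | he
    · have : U = 0 := by ext i j; exact he.elim j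
      rw [this, norm_zero]; exact zero_le_one
    · rw [norm_one] at h1
      nlinarith [norm_nonneg U]
  have hU' : ‖Uᴴ‖ ≤ 1 := by rwa [Matrix.l2_opNorm_conjTranspose]
  unfold opNorm
  rw [← Matrix.cstar_norm_def, ← Matrix.cstar_norm_def]
  calc ‖U * A * Uᴴ‖ ≤ ‖U‖ * ‖A‖ * ‖Uᴴ‖ :=
        (Matrix.l2_opNorm_mul _ _).trans (by gcongr; exact Matrix.l2_opNorm_mul _ _)
    _ ≤ 1 * ‖A‖ * 1 := by gcongr
    _ = _ := by ring

end OpNorm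

section Tensor

variable {G : Type*} [Group G] [TopologicalSpace G]
variable {ι κ ι' κ' : Type} [Fintype ι] [DecidableEq ι] [Fintype κ] [DecidableEq κ]
  [Fintype ι'] [DecidableEq ι'] [Fintype κ'] [DecidableEq κ']

namespace UnitaryRep

/-- `π` is trivial on the subgroup `L`. -/
def TrivialOn (L : Subgroup G) (π : UnitaryRep G ι) : Prop := ∀ x ∈ L, π.toHom x = 1

lemma TrivialOn.of_equiv {L : Subgroup G} {U : Matrix κ ι ℂ} {π : UnitaryRep G ι}
    {π' : UnitaryRep G κ} (h : IsUnitaryEquiv U π π') (hπ' : π'.TrivialOn L) : π.TrivialOn L := by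
  intro x hx
  rw [h.symm.2.2 x, hπ' x hx, Matrix.mul_one, h.symm.1]

lemma TrivialOn.left_of_sum {L : Subgroup G} {π : UnitaryRep G ι} {π' : UnitaryRep G κ}
    (h : (π.sum π').TrivialOn L) : π.TrivialOn L := by
  intro x hx
  have := congrArg Matrix.toBlocks₁₁ (h x hx)
  rw [← Matrix.fromBlocks_one, Matrix.toBlocks_fromBlocks₁₁] at this
  exact this

lemma TrivialOn.right_of_sum {L : Subgroup G} {π : UnitaryRep G ι} {π' : UnitaryRep G κ}
    (h : (π.sum π').TrivialOn L) : π'.TrivialOn L := by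
  intro x hx
  have := congrArg Matrix.toBlocks₂₂ (h x hx)
  rw [← Matrix.fromBlocks_one, Matrix.toBlocks_fromBlocks₂₂] at this
  exact this

lemma TrivialOn.mono {L L' : Subgroup G} (hL : L ≤ L') {π : UnitaryRep G ι}
    (h : π.TrivialOn L') : π.TrivialOn L := fun x hx => h x (hL hx)

lemma TrivialOn.tensor {L : Subgroup G} {π : UnitaryRep G ι} {π' : UnitaryRep G κ}
    (h : π.TrivialOn L) (h' : π'.TrivialOn L) : (π.tensor π').TrivialOn L := by
  intro x hx
  change π.toHom x ⊗ₖ π'.toHom x = 1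
  rw [h x hx, h' x hx, Matrix.one_kronecker_one]

lemma trivialOn_one (L : Subgroup G) : (one G ι).TrivialOn L := fun _ _ => rfl

lemma TrivialOn.toHom_mul_right {L : Subgroup G} {π : UnitaryRep G ι} (h : π.TrivialOn L) (x : G)
    {y : G} (hy : y ∈ L) : π.toHom (x * y) = π.toHom x := by
  rw [map_mul, h y hy, mul_one]

lemma isUnitaryEquiv_refl (π : UnitaryRep G ι) : IsUnitaryEquiv 1 π π :=
  ⟨by simp, by simp, by simp⟩

lemma isUnitaryEquiv_one {U : Matrix κ ι ℂ} (h1 : U * Uᴴ = 1) (h2 : Uᴴ * U = 1) :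
    IsUnitaryEquiv U (one G ι) (one G κ) :=
  ⟨h1, h2, fun x => by
    change (1 : Matrix κ κ ℂ) = U * (1 : Matrix ι ι ℂ) * Uᴴ
    rw [Matrix.mul_one, h1]⟩

lemma IsUnitaryEquiv.tensor {U : Matrix κ ι ℂ} {V : Matrix κ' ι' ℂ} {π : UnitaryRep G ι}
    {π' : UnitaryRep G κ} {ξ : UnitaryRep G ι'} {ξ' : UnitaryRep G κ'}
    (h : IsUnitaryEquiv U π π') (h' : IsUnitaryEquiv V ξ ξ') :
    IsUnitaryEquiv (U ⊗ₖ V) (π.tensor ξ) (π'.tensor ξ') := by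
  refine ⟨?_, ?_, fun x => ?_⟩
  · rw [Matrix.conjTranspose_kronecker, ← Matrix.mul_kronecker_mul, h.1, h'.1,
      Matrix.one_kronecker_one]
  · rw [Matrix.conjTranspose_kronecker, ← Matrix.mul_kronecker_mul, h.2.1, h'.2.1,
      Matrix.one_kronecker_one]
  · change π'.toHom x ⊗ₖ ξ'.toHom x = U ⊗ₖ V * (π.toHom x ⊗ₖ ξ.toHom x) * (U ⊗ₖ V)ᴴ
    rw [Matrix.conjTranspose_kronecker, ← Matrix.mul_kronecker_mul, ← Matrix.mul_kronecker_mul,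
      h.2.2, h'.2.2]

lemma one_sum_one : one G (ι ⊕ κ) = (one G ι).sum (one G κ) :=
  ext_toHom fun _ => Matrix.fromBlocks_one.symm

end UnitaryRep

open UnitaryRep

namespace Symbol

variable (σ : Symbol G)

lemma toFun_reindex (e : ι ≃ κ) {π : UnitaryRep G ι} {π' : UnitaryRep G κ}
    (h : ∀ x, π'.toHom x = (π.toHom x).submatrix e.symm e.symm) :
    σ.toFun π' = (σ.toFun π).submatrix e.symm e.symm := by
  rw [σ.equiv (permUnitary e) π π' ⟨permUnitary_mul_conjTranspose e,
    conjTranspose_mul_permUnitary e, fun x => by rw [h, permUnitary_conj]⟩, permUnitary_conj]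

lemma opNorm_submatrix_le (e : ι ≃ κ) (A : Matrix ι ι ℂ) :
    opNorm (A.submatrix e.symm e.symm) ≤ opNorm A := by
  rw [← permUnitary_conj]
  exact opNorm_conj_le (conjTranspose_mul_permUnitary e) A

lemma toFun_sum_tensor (π : UnitaryRep G ι) (π' : UnitaryRep G κ) (ξ : UnitaryRep G ι') :
    σ.toFun ((π.sum π').tensor ξ) =
      (Matrix.fromBlocks (σ.toFun (π.tensor ξ)) 0 0 (σ.toFun (π'.tensor ξ))).submatrix
        (Equiv.sumProdDistrib ι κ ι') (Equiv.sumProdDistrib ι κ ι') := by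
  rw [← σ.sum]
  refine σ.toFun_reindex (Equiv.sumProdDistrib ι κ ι').symm fun x => ?_
  ext ⟨i | i, k⟩ ⟨j | j, l⟩ <;> simp [UnitaryRep.sum, UnitaryRep.tensor]

lemma toFun_tensor_sum (η : UnitaryRep G ι') (π : UnitaryRep G ι) (π' : UnitaryRep G κ) :
    σ.toFun (η.tensor (π.sum π')) =
      (Matrix.fromBlocks (σ.toFun (η.tensor π)) 0 0 (σ.toFun (η.tensor π'))).submatrix
        (Equiv.prodSumDistrib ι' ι κ) (Equiv.prodSumDistrib ι' ι κ) := by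
  rw [← σ.sum]
  refine σ.toFun_reindex (Equiv.prodSumDistrib ι' ι κ).symm fun x => ?_
  ext ⟨k, i | i⟩ ⟨l, j | j⟩ <;> simp [UnitaryRep.sum, UnitaryRep.tensor]

lemma fromBlocks_sub_fromBlocks (A A' : Matrix ι ι ℂ) (B B' : Matrix κ κ ℂ) :
    Matrix.fromBlocks A 0 0 B - Matrix.fromBlocks A' 0 0 B'
      = Matrix.fromBlocks (A - A') 0 0 (B - B') := by
  ext (i | i) (j | j) <;> simp

lemma opNorm_diff_sum_left {π : UnitaryRep G ι} {π' : UnitaryRep G κ} {ξ : UnitaryRep G ι'}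
    {c : ℝ} (h : opNorm (σ.diff π ξ) ≤ c) (h' : opNorm (σ.diff π' ξ) ≤ c) :
    opNorm (σ.diff (π.sum π') ξ) ≤ c := by
  have : σ.diff (π.sum π') ξ = (Matrix.fromBlocks (σ.diff π ξ) 0 0 (σ.diff π' ξ)).submatrix
      (Equiv.sumProdDistrib ι κ ι') (Equiv.sumProdDistrib ι κ ι') := by
    unfold diff
    rw [one_sum_one, toFun_sum_tensor, toFun_sum_tensor, ← fromBlocks_sub_fromBlocks]
    rfl
  rw [this]
  exact (opNorm_submatrix_le (Equiv.sumProdDistrib ι κ ι').symm _).trans (opNorm_fromBlocks_le h h')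

lemma opNorm_diff_sum_right {η : UnitaryRep G ι'} {π : UnitaryRep G ι} {π' : UnitaryRep G κ}
    {c : ℝ} (h : opNorm (σ.diff η π) ≤ c) (h' : opNorm (σ.diff η π') ≤ c) :
    opNorm (σ.diff η (π.sum π')) ≤ c := by
  have : σ.diff η (π.sum π') = (Matrix.fromBlocks (σ.diff η π) 0 0 (σ.diff η π')).submatrix
      (Equiv.prodSumDistrib ι' ι κ) (Equiv.prodSumDistrib ι' ι κ) := by
    unfold diff
    rw [toFun_tensor_sum, toFun_tensor_sum, ← fromBlocks_sub_fromBlocks]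
    rfl
  rw [this]
  exact (opNorm_submatrix_le (Equiv.prodSumDistrib ι' ι κ).symm _).trans (opNorm_fromBlocks_le h h')

lemma opNorm_diff_equiv_le {U : Matrix κ ι ℂ} {V : Matrix κ' ι' ℂ} {η : UnitaryRep G ι}
    {η' : UnitaryRep G κ} {ξ : UnitaryRep G ι'} {ξ' : UnitaryRep G κ'}
    (h : IsUnitaryEquiv U η η') (h' : IsUnitaryEquiv V ξ ξ') :
    opNorm (σ.diff η' ξ') ≤ opNorm (σ.diff η ξ) := by
  have h1 := h.tensor h'
  have h2 := (isUnitaryEquiv_one (G := G) h.1 h.2.1).tensor h'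
  have : σ.diff η' ξ' = (U ⊗ₖ V) * σ.diff η ξ * (U ⊗ₖ V)ᴴ := by
    unfold diff
    rw [σ.equiv _ _ _ h1, σ.equiv _ _ _ h2, Matrix.mul_sub, Matrix.sub_mul]
  rw [this]
  exact opNorm_conj_le h1.2.1 _

/-- A bound for the differences at irreducible representations carries over to all
representations with the same level bounds. -/
theorem opNorm_diff_le {L₁ L₂ : Subgroup G} {c : ℝ} (hc : 0 ≤ c)
    (h : ∀ η ξ : Irrep G, η.rep.TrivialOn L₁ → ξ.rep.TrivialOn L₂ →
      opNorm (σ.diff η.rep ξ.rep) ≤ c)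
    (η : UnitaryRep G ι) (ξ : UnitaryRep G κ) (hη : η.TrivialOn L₁) (hξ : ξ.TrivialOn L₂) :
    opNorm (σ.diff η ξ) ≤ c := by
  have step : ∀ ξ : Irrep G, ξ.rep.TrivialOn L₂ → η.TrivialOn L₁ →
      opNorm (σ.diff η ξ.rep) ≤ c := by
    intro ξ hξ
    refine UnitaryRep.induction_on_irrep
      (P := fun {ι} _ _ η => η.TrivialOn L₁ → opNorm (σ.diff η ξ.rep) ≤ c) ?_ ?_ ?_ ?_ η
    · exact fun η hη => h η ξ hη hξ
    · intro ι _ _ _ π _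
      rw [opNorm_of_isEmpty]; exact hc
    · intro ι κ _ _ _ _ U π π' hU ih hπ'
      exact (σ.opNorm_diff_equiv_le hU (isUnitaryEquiv_refl _)).trans (ih (hπ'.of_equiv hU))
    · intro ι κ _ _ _ _ π π' ih ih' hs
      exact σ.opNorm_diff_sum_left (ih hs.left_of_sum) (ih' hs.right_of_sum)
  refine UnitaryRep.induction_on_irrep
    (P := fun {κ} _ _ ξ => ξ.TrivialOn L₂ → opNorm (σ.diff η ξ) ≤ c) ?_ ?_ ?_ ?_ ξ hξ
  · exact fun ξ hξ => step ξ hξ hη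
  · intro ι _ _ _ π _
    rw [opNorm_of_isEmpty]; exact hc
  · intro ι κ _ _ _ _ U π π' hU ih hπ'
    exact (σ.opNorm_diff_equiv_le (isUnitaryEquiv_refl _) hU).trans (ih (hπ'.of_equiv hU))
  · intro ι κ _ _ _ _ π π' ih ih' hs
    exact σ.opNorm_diff_sum_right (ih hs.left_of_sum) (ih' hs.right_of_sum)

lemma opNorm_toFun_le {B : ℝ} (hB : 0 ≤ B) (h : ∀ ξ : Irrep G, opNorm (σ.toFun ξ.rep) ≤ B)
    (π : UnitaryRep G ι) : opNorm (σ.toFun π) ≤ B := by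
  refine UnitaryRep.induction_on_irrep (P := fun {ι} _ _ π => opNorm (σ.toFun π) ≤ B) h ?_ ?_ ?_ π
  · intro ι _ _ _ π
    rw [opNorm_of_isEmpty]; exact hB
  · intro ι κ _ _ _ _ U π π' hU ih
    rw [σ.equiv U π π' hU]
    exact (opNorm_conj_le hU.2.1 _).trans ih
  · intro ι κ _ _ _ _ π π' ih ih'
    rw [σ.sum]
    exact opNorm_fromBlocks_le ih ih'

end Symbol

end Tensor

/-! ### Fourier transforms and the kernel of a symbol -/

section Fourier

variable {G : Type*} [Group G] [TopologicalSpace G] [IsTopologicalGroup G]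

lemma continuous_of_right_invariant {X : Type*} [TopologicalSpace X] {L : Subgroup G}
    (hL : IsOpen (L : Set G)) {f : G → X} (hf : ∀ x, ∀ y ∈ L, f (x * y) = f x) :
    Continuous f := by
  refine IsLocallyConstant.continuous ((IsLocallyConstant.iff_exists_open f).2 fun x => ?_)
  refine ⟨(fun y => x⁻¹ * y) ⁻¹' (L : Set G), hL.preimage (continuous_const_mul _), by simp,
    fun x' hx' => ?_⟩
  rw [← hf x _ hx']
  simp

variable [CompactSpace G] [MeasurableSpace G] [BorelSpace G]
variable (μ : Measure G) [IsProbabilityMeasure μ] [μ.IsMulLeftInvariant]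
variable {ι κ : Type} [Fintype ι] [DecidableEq ι] [Fintype κ] [DecidableEq κ]

/-- The entrywise integral of a matrix-valued function. -/
def matInt (M : G → Matrix ι κ ℂ) : Matrix ι κ ℂ := Matrix.of fun i j => ∫ x, M x i j ∂μ

lemma mul_matInt_mul {ι' κ' : Type} [Fintype ι'] [Fintype κ'] {M : G → Matrix ι κ ℂ}
    (hM : Continuous M) (A : Matrix ι' ι ℂ) (B : Matrix κ κ' ℂ) :
    A * matInt μ M * B = matInt μ fun x => A * M x * B := by
  have hint : ∀ i j, Integrable (fun x => M x i j) μ := fun i j =>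
    integrable_of_continuous μ (hM.matrix_elem i j)
  ext i j
  simp only [matInt, Matrix.mul_apply, Matrix.of_apply]
  rw [integral_finsetSum _ fun b _ => (integrable_finsetSum _ fun a _ =>
    (hint a b).const_mul _).mul_const _]
  refine Finset.sum_congr rfl fun b _ => ?_
  rw [integral_mul_const, integral_finsetSum _ fun a _ => (hint a b).const_mul _]
  congr 1
  refine Finset.sum_congr rfl fun a _ => ?_
  rw [integral_const_mul]

lemma trace_matInt {M : G → Matrix ι ι ℂ} (hM : Continuous M) :
    (matInt μ M).trace = ∫ x, (M x).trace ∂μ := by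
  simp only [Matrix.trace, Matrix.diag_apply, matInt, Matrix.of_apply]
  rw [integral_finsetSum _ fun i _ => integrable_of_continuous μ (hM.matrix_elem i i)]

namespace UnitaryRep

lemma fourier_eq_matInt (f : G → ℂ) (π : UnitaryRep G ι) :
    π.fourier μ f = matInt μ fun x => f x • (π.toHom x)ᴴ := rfl

lemma fourier_apply (f : G → ℂ) (π : UnitaryRep G ι) (i j : ι) :
    π.fourier μ f i j = ∫ x, f x * star (π.toHom x j i) ∂μ := rfl

lemma continuous_smul_conjTranspose {f : G → ℂ} (hf : Continuous f) (π : UnitaryRep G ι) :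
    Continuous fun x => f x • (π.toHom x)ᴴ :=
  hf.smul π.continuous_toHom.matrix_conjTranspose

lemma fourier_equiv {f : G → ℂ} (hf : Continuous f) {U : Matrix κ ι ℂ} {π : UnitaryRep G ι}
    {π' : UnitaryRep G κ} (h : IsUnitaryEquiv U π π') :
    π'.fourier μ f = U * π.fourier μ f * Uᴴ := by
  rw [fourier_eq_matInt, fourier_eq_matInt,
    mul_matInt_mul μ (continuous_smul_conjTranspose hf π)]
  congr 1
  ext1 x
  rw [h.2.2 x, Matrix.conjTranspose_mul, Matrix.conjTranspose_mul,
    Matrix.conjTranspose_conjTranspose, Matrix.mul_smul, Matrix.smul_mul, Matrix.mul_assoc]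

lemma fourier_sum (f : G → ℂ) (π : UnitaryRep G ι) (π' : UnitaryRep G κ) :
    (π.sum π').fourier μ f = Matrix.fromBlocks (π.fourier μ f) 0 0 (π'.fourier μ f) := by
  ext (i | i) (j | j) <;> simp [fourier_apply, UnitaryRep.sum]

/-- The Fourier transform of a function that is right invariant under a normal subgroup `L` vanishes
at the irreducible representations that are not trivial on `L`. -/
lemma Irreducible.fourier_eq_zero {L : Subgroup G} [L.Normal] {π : UnitaryRep G ι}
    (hπ : π.Irreducible) (hL : ¬ π.TrivialOn L) {f : G → ℂ} (hfc : Continuous f)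
    (hf : ∀ x, ∀ y ∈ L, f (x * y) = f x) : π.fourier μ f = 0 := by
  set M := π.fourier μ f with hM
  have hinv : ∀ y ∈ L, M * (π.toHom y)ᴴ = M := by
    intro y hy
    have h1 : M = matInt μ fun x => f (y * x) • (π.toHom (y * x))ᴴ := by
      ext i j
      exact (integral_mul_left_eq_self (fun x => f x * star (π.toHom x j i)) y).symm
    have h2 := mul_matInt_mul μ (continuous_smul_conjTranspose hfc π) (1 : Matrix ι ι ℂ)
      (π.toHom y)ᴴ
    rw [← fourier_eq_matInt, ← hM, Matrix.one_mul] at h2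
    rw [h2, h1]
    congr 1
    ext1 x
    have h3 : f (y * x) = f x := by
      have : y * x = x * (x⁻¹ * y * x⁻¹⁻¹) := by group
      rw [this, hf x _ (Subgroup.Normal.conj_mem ‹_› y hy x⁻¹)]
    rw [h3, map_mul, Matrix.conjTranspose_mul, Matrix.one_mul, Matrix.smul_mul]
  -- the vectors fixed by `L` form an invariant subspace
  let W : Submodule ℂ (ι → ℂ) :=
    { carrier := {v | ∀ y ∈ L, π.toHom y *ᵥ v = v}
      add_mem' := fun {a b} ha hb y hy => by rw [Matrix.mulVec_add, ha y hy, hb y hy]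
      zero_mem' := fun y _ => Matrix.mulVec_zero _
      smul_mem' := fun c v hv y hy => by rw [Matrix.mulVec_smul, hv y hy] }
  have hW : ∀ x, ∀ v ∈ W, π.toHom x *ᵥ v ∈ W := by
    intro x v hv y hy
    have h1 : y * x = x * (x⁻¹ * y * x⁻¹⁻¹) := by group
    rw [Matrix.mulVec_mulVec, ← map_mul, h1, map_mul, ← Matrix.mulVec_mulVec,
      hv _ (Subgroup.Normal.conj_mem ‹_› y hy x⁻¹)]
  rcases hπ.2 W hW with h | h
  · have hcol : ∀ i, (fun j => star (M i j)) ∈ W := by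
      intro i y hy
      have h1 := congrArg Matrix.conjTranspose (hinv y hy)
      rw [Matrix.conjTranspose_mul, Matrix.conjTranspose_conjTranspose] at h1
      ext j
      have h2 := congrFun (congrFun h1 j) i
      rw [Matrix.mul_apply] at h2
      exact h2
    ext i j
    have := hcol i
    rw [h, Submodule.mem_bot] at this
    have h2 := congrFun this j
    simpa using h2
  · refine absurd (fun y hy => ?_) hL
    apply Matrix.ext_of_mulVec_single
    intro i
    have : (Pi.single i 1 : ι → ℂ) ∈ W := by rw [h]; trivial
    rw [this y hy, Matrix.one_mulVec]

lemma Irreducible.fourier_tensor_eq_zero {L : Subgroup G} [L.Normal] {π : UnitaryRep G ι}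
    (hπ : π.Irreducible) (hL : ¬ π.TrivialOn L) {η : UnitaryRep G κ} (hη : η.TrivialOn L)
    {f : G → ℂ} (hfc : Continuous f) (hf : ∀ x, ∀ y ∈ L, f (x * y) = f x) :
    (η.tensor π).fourier μ f = 0 := by
  ext ⟨k, i⟩ ⟨l, j⟩
  have h := hπ.fourier_eq_zero μ hL (f := fun x => f x * star (η.toHom x l k))
    (hfc.mul (η.continuous_entry l k).star)
    (fun x y hy => by rw [hf x y hy, hη.toHom_mul_right x hy])
  have h2 := congrFun (congrFun h i) j
  rw [fourier_apply] at h2 ⊢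
  rw [Matrix.zero_apply] at h2 ⊢
  rw [← h2]
  congr 1
  ext x
  simp [UnitaryRep.tensor]
  ring

end UnitaryRep

/-- The Fourier transform of a continuous function is a symbol. -/
def Symbol.ofFun {f : G → ℂ} (hf : Continuous f) : Symbol G where
  toFun := fun π => π.fourier μ f
  equiv := fun _ _ _ h => UnitaryRep.fourier_equiv μ hf h
  sum := fun π π' => UnitaryRep.fourier_sum μ f π π'

/-- The classes of irreducible representations that are trivial on `L`. -/
def dualTrivialOn (L : Subgroup G) : Set (UnitaryDual G) := {c | c.out.rep.TrivialOn L}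

/-- The convolution kernel of the part of the multiplier `T_σ` that lives on the representations
trivial on `L`. -/
def symbolKernel (σ : Symbol G) (L : Subgroup G) (z : G) : ℂ :=
  ∑ᶠ c ∈ dualTrivialOn L, (c.out.dim : ℂ) * (c.out.rep.toHom z * σ.toFun c.out.rep).trace

lemma not_isUnitaryEquiv_out {c c' : UnitaryDual G} (h : c ≠ c')
    (U : Matrix (Fin c'.out.dim) (Fin c.out.dim) ℂ) :
    ¬ UnitaryRep.IsUnitaryEquiv U c.out.rep c'.out.rep := by
  intro hU
  apply h
  have h1 : (irrepSetoid G).r c.out c'.out := ⟨U, hU⟩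
  have h2 := Quotient.sound (s := irrepSetoid G) h1
  exact (Quotient.out_eq c).symm.trans (h2.trans (Quotient.out_eq c'))

section Quotient

variable {H : Type} [Group H] [Fintype H] {q : G →* H}

include μ in
/-- The characters of inequivalent irreducible representations of a finite quotient are linearly
independent, so there are finitely many of them. -/
lemma dualTrivialOn_finite (hq : Function.Surjective q) : (dualTrivialOn q.ker).Finite := by
  classical
  have hfac : ∀ (c : dualTrivialOn q.ker) (z : G),
      c.1.out.rep.toHom (Function.surjInv hq (q z)) = c.1.out.rep.toHom z := by
    intro c z
    have hmem : z⁻¹ * Function.surjInv hq (q z) ∈ q.ker := by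
      rw [MonoidHom.mem_ker, map_mul, map_inv, Function.surjInv_eq hq, inv_mul_cancel]
    have := UnitaryRep.TrivialOn.toHom_mul_right c.2 z hmem
    rwa [mul_inv_cancel_left] at this
  have hlin : LinearIndependent ℂ (fun (c : dualTrivialOn q.ker) (h : H) =>
      (c.1.out.rep.toHom (Function.surjInv hq h)).trace) := by
    rw [linearIndependent_iff']
    intro s a hs c hc
    obtain ⟨i⟩ := c.1.out.irreducible.1
    have h1 : ∀ z, ∑ c' ∈ s, a c' * (c'.1.out.rep.toHom z).trace = 0 := by
      intro z
      have := congrFun hs (q z)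
      simp only [Finset.sum_apply, Pi.smul_apply, smul_eq_mul, Pi.zero_apply, hfac] at this
      exact this
    have h2 : ∀ c' ∈ s, ∫ z, a c' * ((c'.1.out.rep.toHom z).trace *
        star (c.1.out.rep.toHom z i i)) ∂μ
        = if c' = c then a c * (c.1.out.dim : ℂ)⁻¹ else 0 := by
      intro c' _
      simp only [Matrix.trace, Matrix.diag_apply, Finset.sum_mul]
      have hint : ∀ k, Integrable (fun z => c'.1.out.rep.toHom z k k *
          star (c.1.out.rep.toHom z i i)) μ := fun k => integrable_of_continuous μ
        ((c'.1.out.rep.continuous_entry k k).mul (c.1.out.rep.continuous_entry i i).star)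
      rw [integral_const_mul, integral_finsetSum _ fun k _ => hint k]
      split_ifs with heq
      · subst heq
        simp only [c'.1.out.irreducible.integral_entry_mul_star μ]
        simp
      · have hne : c.1 ≠ c'.1 := fun h => heq (Subtype.ext h.symm)
        simp only [UnitaryRep.integral_entry_mul_star_of_not_equiv μ c.1.out.irreducible
          c'.1.out.irreducible (not_isUnitaryEquiv_out hne)]
        simp
    have h3 : ∑ c' ∈ s, ∫ z, a c' * ((c'.1.out.rep.toHom z).trace *
        star (c.1.out.rep.toHom z i i)) ∂μ = 0 := by
      have hint : ∀ c' : dualTrivialOn q.ker, Integrable (fun z => a c' *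
          ((c'.1.out.rep.toHom z).trace * star (c.1.out.rep.toHom z i i))) μ := fun c' =>
        integrable_of_continuous μ (continuous_const.mul
          (c'.1.out.rep.continuous_toHom.matrix_trace.mul
            (c.1.out.rep.continuous_entry i i).star))
      rw [← integral_finsetSum _ fun c' _ => hint c']
      have : ∀ z, ∑ c' ∈ s, a c' * ((c'.1.out.rep.toHom z).trace *
          star (c.1.out.rep.toHom z i i)) = 0 := by
        intro z
        simp only [← mul_assoc]
        rw [← Finset.sum_mul, h1, zero_mul]
      rw [integral_congr_ae (Filter.Eventually.of_forall this)]
      simp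
    rw [Finset.sum_congr rfl h2, Finset.sum_ite_eq' s c, if_pos hc] at h3
    have hd : (c.1.out.dim : ℂ)⁻¹ ≠ 0 := by
      have : c.1.out.dim ≠ 0 := fun h0 => by
        have hi := i.2
        omega
      exact inv_ne_zero (by exact_mod_cast this)
    exact (mul_eq_zero.1 h3).resolve_right hd
  have := hlin.finite
  exact Set.toFinite _

lemma symbolKernel_eq_sum (hq : Function.Surjective q) (σ : Symbol G) (z : G) :
    symbolKernel σ q.ker z = ∑ c ∈ (dualTrivialOn_finite μ hq).toFinset,
      (c.out.dim : ℂ) * (c.out.rep.toHom z * σ.toFun c.out.rep).trace :=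
  finsum_mem_eq_finite_toFinset_sum _ _

omit [IsTopologicalGroup G] [CompactSpace G] [MeasurableSpace G] [BorelSpace G] in
lemma symbolKernel_mul_right (σ : Symbol G) (L : Subgroup G) (x : G) {y : G} (hy : y ∈ L) :
    symbolKernel σ L (x * y) = symbolKernel σ L x := by
  refine finsum_mem_congr rfl fun c hc => ?_
  rw [UnitaryRep.TrivialOn.toHom_mul_right hc x hy]

/-- The symbol is the Fourier transform of its kernel, on all representations that are trivial on
the given subgroup. -/
theorem fourier_symbolKernel (hq : Function.Surjective q) (hopen : IsOpen (q.ker : Set G))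
    (σ : Symbol G) (π : UnitaryRep G ι) (hπ : π.TrivialOn q.ker) :
    π.fourier μ (symbolKernel σ q.ker) = σ.toFun π := by
  classical
  have hcont : Continuous (symbolKernel σ q.ker) :=
    continuous_of_right_invariant hopen fun x y hy => symbolKernel_mul_right σ q.ker x hy
  have hout : ∀ c ∈ dualTrivialOn q.ker,
      c.out.rep.fourier μ (symbolKernel σ q.ker) = σ.toFun c.out.rep := by
    intro c hc
    ext i j
    rw [UnitaryRep.fourier_apply]
    have hterm : ∀ c' : UnitaryDual G, ∫ z, (c'.out.dim : ℂ) *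
        (c'.out.rep.toHom z * σ.toFun c'.out.rep).trace * star (c.out.rep.toHom z j i) ∂μ
        = if c' = c then σ.toFun c.out.rep i j else 0 := by
      intro c'
      have h1 : ∀ z, (c'.out.dim : ℂ) *
          (c'.out.rep.toHom z * σ.toFun c'.out.rep).trace * star (c.out.rep.toHom z j i)
          = ∑ a, ∑ b, ((c'.out.dim : ℂ) * σ.toFun c'.out.rep b a) *
            (c'.out.rep.toHom z a b * star (c.out.rep.toHom z j i)) := by
        intro z
        simp only [Matrix.trace, Matrix.diag_apply, Matrix.mul_apply, Finset.mul_sum,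
          Finset.sum_mul]
        exact Finset.sum_congr rfl fun a _ => Finset.sum_congr rfl fun b _ => by ring
      have hint : ∀ a b, Integrable (fun z => ((c'.out.dim : ℂ) * σ.toFun c'.out.rep b a) *
            (c'.out.rep.toHom z a b * star (c.out.rep.toHom z j i))) μ := fun a b =>
        integrable_of_continuous μ (continuous_const.mul
          ((c'.out.rep.continuous_entry a b).mul (c.out.rep.continuous_entry j i).star))
      rw [integral_congr_ae (Filter.Eventually.of_forall h1),
        integral_finsetSum _ fun a _ => integrable_finsetSum _ fun b _ => hint a b]
      simp only [integral_finsetSum _ fun b _ => hint _ b, integral_const_mul]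
      split_ifs with heq
      · subst heq
        simp only [c'.out.irreducible.integral_entry_mul_star μ]
        have hd : (c'.out.dim : ℂ) ≠ 0 := by
          have : c'.out.dim ≠ 0 := fun h0 => by
            have hi := i.2
            omega
          exact_mod_cast this
        rw [Finset.sum_eq_single j, Finset.sum_eq_single i]
        · simp
          field_simp
        · intro b _ hb; simp [hb]
        · simp
        · intro a _ ha; simp [ha]
        · simp
      · simp only [UnitaryRep.integral_entry_mul_star_of_not_equiv μ c.out.irreducible
          c'.out.irreducible (not_isUnitaryEquiv_out (Ne.symm heq))]
        simp
    simp only [symbolKernel_eq_sum μ hq, Finset.sum_mul]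
    have hint : ∀ c' : UnitaryDual G, Integrable (fun z => (c'.out.dim : ℂ) *
        (c'.out.rep.toHom z * σ.toFun c'.out.rep).trace * star (c.out.rep.toHom z j i)) μ :=
      fun c' => integrable_of_continuous μ ((continuous_const.mul
        (c'.out.rep.continuous_toHom.matrix_mul continuous_const).matrix_trace).mul
          (c.out.rep.continuous_entry j i).star)
    rw [integral_finsetSum _ fun c' _ => hint c', Finset.sum_congr rfl fun c' _ => hterm c',
      Finset.sum_ite_eq', if_pos ((dualTrivialOn_finite μ hq).mem_toFinset.2 hc)]
  refine UnitaryRep.induction_on_irrep (P := fun {ι} _ _ π => π.TrivialOn q.ker →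
    π.fourier μ (symbolKernel σ q.ker) = σ.toFun π) ?_ ?_ ?_ ?_ π hπ
  · intro ξ hξ
    obtain ⟨U, hU⟩ : (irrepSetoid G).r (Quotient.mk (irrepSetoid G) ξ).out ξ :=
      Quotient.mk_out (s := irrepSetoid G) ξ
    have hc : (Quotient.mk (irrepSetoid G) ξ : UnitaryDual G) ∈ dualTrivialOn q.ker :=
      hξ.of_equiv hU
    rw [UnitaryRep.fourier_equiv μ hcont hU, σ.equiv U _ _ hU]
    exact congrArg (fun M => U * M * Uᴴ) (hout _ hc)
  · intro ι _ _ _ π _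
    exact Subsingleton.elim _ _
  · intro ι κ _ _ _ _ U π π' hU ih hπ'
    rw [UnitaryRep.fourier_equiv μ hcont hU, σ.equiv U _ _ hU, ih (hπ'.of_equiv hU)]
  · intro ι κ _ _ _ _ π π' ih ih' hs
    rw [UnitaryRep.fourier_sum, σ.sum, ih hs.left_of_sum, ih' hs.right_of_sum]

/-- On functions that are invariant under an open normal subgroup, the multiplier is a convolution
operator. -/
theorem multiplier_eq_integral (hq : Function.Surjective q) (hopen : IsOpen (q.ker : Set G))
    (σ : Symbol G) {f : G → ℂ} (hf : ∀ x, ∀ y ∈ q.ker, f (x * y) = f x) (x : G) :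
    σ.multiplier μ f x = ∫ y, f y * symbolKernel σ q.ker (y⁻¹ * x) ∂μ := by
  have hfc := continuous_of_right_invariant hopen hf
  unfold Symbol.multiplier
  rw [tsum_eq_sum (s := (dualTrivialOn_finite μ hq).toFinset)]
  · simp only [symbolKernel_eq_sum μ hq, Finset.mul_sum]
    have hint : ∀ c : UnitaryDual G, Integrable (fun y => f y * ((c.out.dim : ℂ) *
        (c.out.rep.toHom (y⁻¹ * x) * σ.toFun c.out.rep).trace)) μ := fun c =>
      integrable_of_continuous μ (hfc.mul (continuous_const.mul
        ((c.out.rep.continuous_toHom.comp (continuous_inv.mul continuous_const)).matrix_mul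
          continuous_const).matrix_trace))
    rw [integral_finsetSum _ fun c _ => hint c]
    refine Finset.sum_congr rfl fun c _ => ?_
    have hM := UnitaryRep.continuous_smul_conjTranspose hfc c.out.rep
    have h1 := mul_matInt_mul μ hM (c.out.rep.toHom x * σ.toFun c.out.rep)
      (1 : Matrix (Fin c.out.dim) (Fin c.out.dim) ℂ)
    rw [Matrix.mul_one, ← UnitaryRep.fourier_eq_matInt] at h1
    rw [h1, trace_matInt μ ((continuous_const.matrix_mul hM).matrix_mul continuous_const),
      ← integral_const_mul]
    congr 1
    ext y
    rw [Matrix.mul_one, Matrix.mul_smul, Matrix.trace_smul, smul_eq_mul, map_mul,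
      UnitaryRep.toHom_inv, Matrix.trace_mul_comm, Matrix.mul_assoc]
    ring
  · intro c hc
    rw [(dualTrivialOn_finite μ hq).mem_toFinset] at hc
    rw [c.out.irreducible.fourier_eq_zero μ hc hfc hf]
    simp

end Quotient

end Fourier

/-! ### Regular representations of finite quotients and kernel estimates -/

section Regular

variable {G : Type*} [Group G] [TopologicalSpace G] [IsTopologicalGroup G]
variable {H : Type} [Group H] [Fintype H] [DecidableEq H]

lemma eq_of_quotient_eq {X : Type*} {q : G →* H} {f : G → X}
    (hf : ∀ x, ∀ y ∈ q.ker, f (x * y) = f x) {x y : G} (h : q x = q y) : f x = f y := by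
  have hmem : x⁻¹ * y ∈ q.ker := by
    rw [MonoidHom.mem_ker, map_mul, map_inv, h, inv_mul_cancel]
  have := hf x _ hmem
  rwa [mul_inv_cancel_left, eq_comm] at this

lemma continuous_comp_quotient {X : Type*} [TopologicalSpace X] {q : G →* H}
    (hopen : IsOpen (q.ker : Set G)) (φ : H → X) : Continuous fun x => φ (q x) :=
  continuous_of_right_invariant hopen fun x y hy => by
    rw [map_mul, MonoidHom.mem_ker.1 hy, mul_one]

/-- The right regular representation of a finite quotient `H` of `G`, as a representation of `G`. -/
def regularRep (q : G →* H) (hopen : IsOpen (q.ker : Set G)) : UnitaryRep G H where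
  toHom :=
    { toFun := fun x => Matrix.of fun h h' => if h * q x = h' then 1 else 0
      map_one' := by
        ext h h'
        simp [Matrix.one_apply]
      map_mul' := fun x y => by
        ext h h'
        simp only [Matrix.of_apply, Matrix.mul_apply]
        rw [Finset.sum_eq_single (h * q x)]
        · simp [mul_assoc]
        · intro b _ hb
          rw [if_neg (Ne.symm hb), zero_mul]
        · simp }
  unitary x := by
    rw [Matrix.mem_unitaryGroup_iff]
    ext h h'
    simp [Matrix.mul_apply, Matrix.star_apply, Matrix.one_apply, eq_comm]
  continuous_toHom := by
    refine continuous_matrix fun h h' => ?_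
    exact continuous_comp_quotient hopen (fun a => if h * a = h' then (1 : ℂ) else 0)

lemma regularRep_apply (q : G →* H) (hopen : IsOpen (q.ker : Set G)) (x : G) (h h' : H) :
    (regularRep q hopen).toHom x h h' = if h * q x = h' then 1 else 0 := rfl

lemma regularRep_trivialOn (q : G →* H) (hopen : IsOpen (q.ker : Set G)) :
    (regularRep q hopen).TrivialOn q.ker := by
  intro x hx
  ext h h'
  rw [regularRep_apply, MonoidHom.mem_ker.1 hx, mul_one, Matrix.one_apply]

variable [CompactSpace G] [MeasurableSpace G] [BorelSpace G]
variable (μ : Measure G) [IsProbabilityMeasure μ] [μ.IsMulLeftInvariant]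

/-- The Haar measure projects to the uniform distribution on a finite quotient. -/
lemma integral_comp_quotient {q : G →* H} (hq : Function.Surjective q)
    (hopen : IsOpen (q.ker : Set G)) (φ : H → ℂ) :
    ∫ x, φ (q x) ∂μ = (Fintype.card H : ℂ)⁻¹ * ∑ h, φ h := by
  have h1 : ∀ a : H, ∫ x, φ (a * q x) ∂μ = ∫ x, φ (q x) ∂μ := by
    intro a
    obtain ⟨g, rfl⟩ := hq a
    rw [← integral_mul_left_eq_self (fun x => φ (q x)) g]
    simp only [map_mul]
  have hint : ∀ a : H, Integrable (fun x => φ (a * q x)) μ := fun a =>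
    integrable_of_continuous μ (continuous_comp_quotient hopen fun h => φ (a * h))
  have h2 : ∑ _a : H, ∫ x, φ (q x) ∂μ = ∑ h, φ h := by
    rw [← Finset.sum_congr rfl fun a _ => h1 a, ← integral_finsetSum _ fun a _ => hint a]
    have : ∀ x, ∑ a, φ (a * q x) = ∑ h, φ h := fun x =>
      Fintype.sum_equiv (Equiv.mulRight (q x)) _ _ fun _ => rfl
    simp [this]
  rw [Finset.sum_const, Finset.card_univ, nsmul_eq_mul] at h2
  rw [← h2, inv_mul_cancel_left₀ (Nat.cast_ne_zero.2 Fintype.card_ne_zero)]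

open Classical in
lemma measureReal_comap {q : G →* H} (hq : Function.Surjective q)
    (hopen : IsOpen (q.ker : Set G)) (A : Subgroup H) :
    μ.real (A.comap q : Set G) = Nat.card A / Fintype.card H := by
  have hmeas : MeasurableSet (A.comap q : Set G) := by
    have h1 : (q.ker : Subgroup G) ≤ A.comap q := fun x hx => by
      rw [Subgroup.mem_comap, MonoidHom.mem_ker.1 hx]
      exact A.one_mem
    exact (Subgroup.isOpen_mono h1 hopen).measurableSet
  have h := integral_comp_quotient μ hq hopen fun h => if h ∈ A then (1 : ℂ) else 0
  have h2 : ∀ x, (if q x ∈ A then (1 : ℂ) else 0)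
      = (A.comap q : Set G).indicator (fun _ => (1 : ℂ)) x := by
    intro x
    simp [Set.indicator_apply]
  simp only [h2] at h
  rw [integral_indicator hmeas, setIntegral_const, Finset.sum_boole] at h
  have h3 : (Finset.univ.filter fun z => z ∈ A).card = Nat.card A := by
    rw [Nat.card_eq_fintype_card, Fintype.card_subtype]
  rw [h3, Complex.real_smul, mul_one] at h
  rw [div_eq_inv_mul]
  refine Complex.ofReal_injective (Eq.trans h ?_)
  push_cast
  rfl

/-- The kernel on the finite quotient `H` of the part of the multiplier that lives on the
representations of `H`, normalized for counting measure. -/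
def quotientKernel {q : G →* H} (hq : Function.Surjective q) (σ : Symbol G) (h : H) : ℂ :=
  (Fintype.card H : ℂ)⁻¹ * symbolKernel σ q.ker (Function.surjInv hq h)

lemma quotientKernel_apply {q : G →* H} (hq : Function.Surjective q) (σ : Symbol G) (x : G) :
    quotientKernel hq σ (q x) = (Fintype.card H : ℂ)⁻¹ * symbolKernel σ q.ker x := by
  unfold quotientKernel
  congr 1
  exact eq_of_quotient_eq (fun x y hy => symbolKernel_mul_right σ q.ker x hy)
    (Function.surjInv_eq hq (q x))

include μ in
/-- Convolution with the quotient kernel is the value of the symbol at the regular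
representation. -/
lemma conv_quotientKernel {q : G →* H} (hq : Function.Surjective q)
    (hopen : IsOpen (q.ker : Set G)) (σ : Symbol G) (f : H → ℂ) :
    conv (quotientKernel hq σ) f = σ.toFun (regularRep q hopen) *ᵥ f := by
  rw [← fourier_symbolKernel μ hq hopen σ _ (regularRep_trivialOn q hopen)]
  ext x
  simp only [conv, Matrix.mulVec, dotProduct]
  refine Finset.sum_congr rfl fun y _ => ?_
  rw [mul_comm]
  congr 1
  rw [UnitaryRep.fourier_apply]
  have h1 : ∀ z, symbolKernel σ q.ker z * star ((regularRep q hopen).toHom z y x)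
      = (fun h => symbolKernel σ q.ker (Function.surjInv hq h) *
          (if y * h = x then 1 else 0)) (q z) := by
    intro z
    rw [regularRep_apply]
    have h2 : symbolKernel σ q.ker (Function.surjInv hq (q z)) = symbolKernel σ q.ker z :=
      eq_of_quotient_eq (fun x y hy => symbolKernel_mul_right σ q.ker x hy)
        (Function.surjInv_eq hq (q z))
    simp only [h2]
    split_ifs <;> simp
  rw [integral_congr_ae (Filter.Eventually.of_forall h1),
    integral_comp_quotient μ hq hopen fun h => symbolKernel σ q.ker (Function.surjInv hq h) *
      if y * h = x then 1 else 0, Finset.sum_eq_single (y⁻¹ * x)]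
  · simp [quotientKernel]
  · intro b _ hb
    rw [if_neg, mul_zero]
    rintro rfl
    exact hb (by group)
  · simp

include μ in
lemma sum_norm_conv_quotientKernel_le {q : G →* H} (hq : Function.Surjective q)
    (hopen : IsOpen (q.ker : Set G)) (σ : Symbol G) {B : ℝ} (hB : 0 ≤ B)
    (h : ∀ ξ : Irrep G, opNorm (σ.toFun ξ.rep) ≤ B) (f : H → ℂ) :
    ∑ x, ‖conv (quotientKernel hq σ) f x‖ ^ 2 ≤ B ^ 2 * ∑ x, ‖f x‖ ^ 2 := by
  classical
  rw [conv_quotientKernel μ hq hopen]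
  refine (sum_norm_mulVec_sq_le _ f).trans ?_
  gcongr
  · exact opNorm_nonneg _
  · exact σ.opNorm_toFun_le hB h _

include μ in
lemma norm_quotientKernel_le {q : G →* H} (hq : Function.Surjective q)
    (hopen : IsOpen (q.ker : Set G)) (σ : Symbol G) {B : ℝ} (hB : 0 ≤ B)
    (h : ∀ ξ : Irrep G, opNorm (σ.toFun ξ.rep) ≤ B) (x : H) :
    ‖quotientKernel hq σ x‖ ≤ B := by
  classical
  have h1 := congrFun (conv_quotientKernel μ hq hopen σ (Pi.single 1 1)) x
  rw [Matrix.mulVec_single_one] at h1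
  have h2 : conv (quotientKernel hq σ) (Pi.single 1 1) x = quotientKernel hq σ x := by
    unfold conv
    rw [Finset.sum_eq_single 1]
    · simp
    · intro b _ hb
      simp [hb]
    · simp
  rw [← h2, h1]
  exact (norm_entry_le_opNorm _ x 1).trans (σ.opNorm_toFun_le hB h _)

variable {H' H₀ : Type} [Group H'] [Fintype H'] [Group H₀] [Fintype H₀]
  [DecidableEq H₀]

include μ in
/-- The contribution `k` to the kernel of the representations that are trivial on `ker q` but not on
`ker q'` is controlled off `ker q₀` by the differences of the symbol: at a point `z ∉ ker q₀` the
value `k z` is, up to normalization, a matrix entry of the difference of the symbol of `k` at the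
regular representations of `G ⧸ ker q₀` and `G ⧸ ker q`. -/
theorem norm_symbolKernel_sub_le {q : G →* H} {q' : G →* H'} {q₀ : G →* H₀}
    (hq : Function.Surjective q) (hq' : Function.Surjective q')
    (hopen : IsOpen (q.ker : Set G)) (hle : q.ker ≤ q'.ker) (hle' : q'.ker ≤ q₀.ker)
    (σ : Symbol G) {δ : ℝ} (hδ : 0 ≤ δ)
    (h : ∀ η ξ : Irrep G, η.rep.TrivialOn q₀.ker → ξ.rep.TrivialOn q.ker →
      ¬ ξ.rep.TrivialOn q'.ker → opNorm (σ.diff η.rep ξ.rep) ≤ δ)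
    {z : G} (hz : z ∉ q₀.ker) :
    ‖symbolKernel σ q.ker z - symbolKernel σ q'.ker z‖ ≤ δ * Fintype.card H := by
  classical
  have hopen' : IsOpen (q'.ker : Set G) := Subgroup.isOpen_mono hle hopen
  have hopen₀ : IsOpen (q₀.ker : Set G) := Subgroup.isOpen_mono hle' hopen'
  have hK : Continuous (symbolKernel σ q.ker) :=
    continuous_of_right_invariant hopen fun x y hy => symbolKernel_mul_right σ q.ker x hy
  have hK' : Continuous (symbolKernel σ q'.ker) :=
    continuous_of_right_invariant hopen' fun x y hy => symbolKernel_mul_right σ q'.ker x hy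
  set k : G → ℂ := fun z => symbolKernel σ q.ker z - symbolKernel σ q'.ker z with hk
  have hkc : Continuous k := hK.sub hK'
  set τ : Symbol G := Symbol.ofFun μ hkc with hτ
  have hτ_apply : ∀ {ι : Type} [Fintype ι] [DecidableEq ι] (π : UnitaryRep G ι),
      τ.toFun π = π.fourier μ (symbolKernel σ q.ker) - π.fourier μ (symbolKernel σ q'.ker) := by
    intro ι _ _ π
    ext i j
    change ∫ x, k x * star (π.toHom x j i) ∂μ
      = ∫ x, symbolKernel σ q.ker x * star (π.toHom x j i) ∂μ
        - ∫ x, symbolKernel σ q'.ker x * star (π.toHom x j i) ∂μ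
    have hi1 : Integrable (fun x => symbolKernel σ q.ker x * star (π.toHom x j i)) μ :=
      integrable_of_continuous μ (hK.mul (π.continuous_entry j i).star)
    have hi2 : Integrable (fun x => symbolKernel σ q'.ker x * star (π.toHom x j i)) μ :=
      integrable_of_continuous μ (hK'.mul (π.continuous_entry j i).star)
    rw [← integral_sub hi1 hi2]
    simp only [hk, sub_mul]
  have hdiff : ∀ η ξ : Irrep G, η.rep.TrivialOn q₀.ker → ξ.rep.TrivialOn q.ker →
      opNorm (τ.diff η.rep ξ.rep) ≤ δ := by
    intro η ξ hη hξ
    have hη' : η.rep.TrivialOn q'.ker := hη.mono hle'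
    have ht : (η.rep.tensor ξ.rep).TrivialOn q.ker := (hη'.mono hle).tensor hξ
    have ht1 : ((UnitaryRep.one G (Fin η.dim)).tensor ξ.rep).TrivialOn q.ker :=
      (UnitaryRep.trivialOn_one _).tensor hξ
    by_cases hξ' : ξ.rep.TrivialOn q'.ker
    · have : τ.diff η.rep ξ.rep = 0 := by
        unfold Symbol.diff
        rw [hτ_apply, hτ_apply, fourier_symbolKernel μ hq hopen σ _ ht,
          fourier_symbolKernel μ hq' hopen' σ _ (hη'.tensor hξ'),
          fourier_symbolKernel μ hq hopen σ _ ht1,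
          fourier_symbolKernel μ hq' hopen' σ _ ((UnitaryRep.trivialOn_one _).tensor hξ')]
        simp
      rw [this, opNorm_zero]
      exact hδ
    · have hinv := fun (x y : G) (hy : y ∈ q'.ker) => symbolKernel_mul_right σ q'.ker x hy
      have : τ.diff η.rep ξ.rep = σ.diff η.rep ξ.rep := by
        unfold Symbol.diff
        rw [hτ_apply, hτ_apply, fourier_symbolKernel μ hq hopen σ _ ht,
          fourier_symbolKernel μ hq hopen σ _ ht1,
          ξ.irreducible.fourier_tensor_eq_zero μ hξ' hη' hK' hinv,
          ξ.irreducible.fourier_tensor_eq_zero μ hξ' (UnitaryRep.trivialOn_one _) hK' hinv,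
          sub_zero, sub_zero]
      rw [this]
      exact h η ξ hη hξ hξ'
  -- at `(q₀ z, q z), (1, 1)` the regular representations pick out the single value `k z`
  have hmain := (norm_entry_le_opNorm _ (q₀ z, q z) (1, 1)).trans
    (τ.opNorm_diff_le hδ hdiff _ _ (regularRep_trivialOn q₀ hopen₀) (regularRep_trivialOn q hopen))
  have hentry : τ.diff (regularRep q₀ hopen₀) (regularRep q hopen) (q₀ z, q z) (1, 1)
      = (Fintype.card H : ℂ)⁻¹ * k z := by
    have h1 : τ.toFun ((regularRep q₀ hopen₀).tensor (regularRep q hopen)) (q₀ z, q z) (1, 1)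
        = (Fintype.card H : ℂ)⁻¹ * k z := by
      change ∫ x, k x * star ((regularRep q₀ hopen₀).toHom x 1 (q₀ z) *
        (regularRep q hopen).toHom x 1 (q z)) ∂μ = _
      have h2 : ∀ x, k x * star ((regularRep q₀ hopen₀).toHom x 1 (q₀ z) *
          (regularRep q hopen).toHom x 1 (q z))
          = (fun h => if h = q z then k z else 0) (q x) := by
        intro x
        simp only [regularRep_apply, one_mul]
        by_cases hx : q x = q z
        · have h3 : q₀ x = q₀ z := eq_of_quotient_eq (q := q) (fun x y hy => by
            rw [map_mul, MonoidHom.mem_ker.1 (hle' (hle hy)), mul_one]) hx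
          have h4 : k x = k z := eq_of_quotient_eq (q := q) (fun x y hy => by
            simp only [hk]
            rw [symbolKernel_mul_right σ q.ker x hy,
              symbolKernel_mul_right σ q'.ker x (hle hy)]) hx
          simp [hx, h3, h4]
        · simp [hx]
      rw [integral_congr_ae (Filter.Eventually.of_forall h2),
        integral_comp_quotient μ hq hopen fun h => if h = q z then k z else 0,
        Finset.sum_ite_eq' Finset.univ, if_pos (Finset.mem_univ _)]
    have h3 : τ.toFun ((UnitaryRep.one G H₀).tensor (regularRep q hopen)) (q₀ z, q z) (1, 1)
        = 0 := by
      change ∫ x, k x * star ((1 : Matrix H₀ H₀ ℂ) 1 (q₀ z) *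
        (regularRep q hopen).toHom x 1 (q z)) ∂μ = _
      -- this is where `z ∉ ker q₀` enters
      rw [Matrix.one_apply_ne (fun h => hz (MonoidHom.mem_ker.2 h.symm))]
      simp
    change τ.toFun _ _ _ - τ.toFun _ _ _ = _
    rw [h1, h3, sub_zero]
  rw [hentry, norm_mul, norm_inv, Complex.norm_natCast, inv_mul_le_iff₀
    (by exact_mod_cast Fintype.card_pos), mul_comm] at hmain
  exact hmain

end Regular

/-! ### Kernels of multipliers on a filtered compact group -/

section Filtration

variable {G : Type*} [Group G] [TopologicalSpace G] [IsTopologicalGroup G] [CompactSpace G]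
variable [MeasurableSpace G] [BorelSpace G]
variable (μ : Measure G) [IsProbabilityMeasure μ] [μ.IsMulLeftInvariant]

/-- A decreasing filtration `G = F 0 ⊇ F 1 ⊇ …` by open normal subgroups which is doubling with
constant `D`. -/
structure IsFiltration (F : ℕ → Subgroup G) (D : ℝ) : Prop where
  normal : ∀ n, (F n).Normal
  isOpen : ∀ n, IsOpen (F n : Set G)
  anti : Antitone F
  zero : F 0 = ⊤
  one_le : 1 ≤ D
  doubling : ∀ n, μ.real (F n : Set G) ≤ D * μ.real (F (n + 1) : Set G)

/-- The bound for the differences of the symbol that makes its kernel a Calderón–Zygmund kernel. It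
is imposed at the representations `ξ` of level exactly `n + 1` and `η` of level at most `l ≤ n`. -/
def IsDiffBound (F : ℕ → Subgroup G) (σ : Symbol G) (C b : ℝ) : Prop :=
  ∀ l n, l ≤ n → ∀ η ξ : Irrep G, η.rep.TrivialOn (F l) → ξ.rep.TrivialOn (F (n + 1)) →
    ¬ ξ.rep.TrivialOn (F n) →
      opNorm (σ.diff η.rep ξ.rep) ≤ C * (μ.real (F (n + 1) : Set G) / μ.real (F l : Set G)) ^ b

/-- A quotient by an open normal subgroup is finite, and it is realized here in the lowest
universe. -/
lemma exists_quotient (L : Subgroup G) [L.Normal] (hL : IsOpen (L : Set G)) :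
    ∃ (H : Type) (_ : Group H) (_ : Fintype H) (_ : DecidableEq H) (q : G →* H),
      Function.Surjective q ∧ q.ker = L := by
  classical
  have : Finite (G ⧸ L) := L.quotient_finite_of_isOpen hL
  let e : Shrink.{0} (G ⧸ L) ≃* G ⧸ L := Shrink.mulEquiv
  have : Finite (Shrink.{0} (G ⧸ L)) := Finite.of_equiv _ e.symm.toEquiv
  refine ⟨Shrink.{0} (G ⧸ L), inferInstance, Fintype.ofFinite _, inferInstance,
    e.symm.toMonoidHom.comp (QuotientGroup.mk' L),
    e.symm.surjective.comp (QuotientGroup.mk'_surjective L), ?_⟩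
  ext x
  rw [MonoidHom.mem_ker]
  simp

lemma measureReal_ker {H : Type} [Group H] [Fintype H] {q : G →* H}
    (hq : Function.Surjective q) (hopen : IsOpen (q.ker : Set G)) :
    μ.real (q.ker : Set G) = (Fintype.card H : ℝ)⁻¹ := by
  classical
  have := measureReal_comap μ hq hopen ⊥
  rw [← MonoidHom.comap_bot q, this]
  simp

/-- The chain that a filtration induces on its quotient by `F N`. -/
def quotientChain {H : Type} [Group H] {F : ℕ → Subgroup G} (hnormal : ∀ n, (F n).Normal)
    (hanti : Antitone F) (hzero : F 0 = ⊤) {N : ℕ} {q : G →* H} (hq : Function.Surjective q)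
    (hker : q.ker = F N) : NormalChain H where
  sub n := (F (min n N)).map q
  normal n := (hnormal _).map q hq
  anti i j h := Subgroup.map_mono (hanti (min_le_min_right N h))
  sub_zero := by
    rw [Nat.zero_min, hzero, ← MonoidHom.range_eq_map, MonoidHom.range_eq_top.2 hq]
  len := N
  sub_len := by rw [min_self, ← hker, Subgroup.map_eq_bot_iff]

namespace IsFiltration

variable {μ} {F : ℕ → Subgroup G} {D : ℝ} (hF : IsFiltration μ F D)
include hF

lemma vol_pos (n : ℕ) : 0 < μ.real (F n : Set G) := by
  have := hF.normal n
  obtain ⟨H, _, _, _, q, hq, hker⟩ := exists_quotient (F n) (hF.isOpen n)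
  rw [← hker, measureReal_ker μ hq (hker ▸ hF.isOpen n)]
  exact inv_pos.2 (by exact_mod_cast Fintype.card_pos)

lemma vol_anti {m n : ℕ} (h : m ≤ n) : μ.real (F n : Set G) ≤ μ.real (F m : Set G) :=
  measureReal_mono (hF.anti h)

lemma vol_le_one (n : ℕ) : μ.real (F n : Set G) ≤ 1 := measureReal_le_one

lemma comap_map {H : Type} [Group H] {N : ℕ} {q : G →* H} (hker : q.ker = F N) (n : ℕ) :
    ((F (min n N)).map q).comap q = F (min n N) :=
  Subgroup.comap_map_eq_self (hker ▸ hF.anti (min_le_right n N))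

lemma mem_quotientChain {H : Type} [Group H] {N : ℕ} {q : G →* H} (hq : Function.Surjective q)
    (hker : q.ker = F N) {n : ℕ} {x : G} :
    q x ∈ (quotientChain hF.normal hF.anti hF.zero hq hker).sub n ↔ x ∈ F (min n N) := by
  rw [← hF.comap_map hker n, Subgroup.mem_comap]
  rfl

lemma card_quotientChain {H : Type} [Group H] [Fintype H] {N : ℕ} {q : G →* H}
    (hq : Function.Surjective q) (hker : q.ker = F N) (n : ℕ) :
    (quotientChain hF.normal hF.anti hF.zero hq hker).card n
      = Fintype.card H * μ.real (F (min n N) : Set G) := by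
  classical
  have h := measureReal_comap μ hq (hker ▸ hF.isOpen N)
    ((quotientChain hF.normal hF.anti hF.zero hq hker).sub n)
  have h1 : ((quotientChain hF.normal hF.anti hF.zero hq hker).sub n).comap q = F (min n N) :=
    hF.comap_map hker n
  rw [h1] at h
  rw [h, mul_div_cancel₀ _ (Nat.cast_ne_zero.2 Fintype.card_ne_zero)]
  rfl

lemma two_mul_vol_le {m n : ℕ} (h : m ≤ n) (hne : F m ≠ F n) :
    2 * μ.real (F n : Set G) ≤ μ.real (F m : Set G) := by
  have := hF.normal n
  obtain ⟨H, _, _, _, q, hq, hker⟩ := exists_quotient (F n) (hF.isOpen n)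
  have hcard : (0 : ℝ) < Fintype.card H := by exact_mod_cast Fintype.card_pos
  have hne' : (quotientChain hF.normal hF.anti hF.zero hq hker).sub m
      ≠ (quotientChain hF.normal hF.anti hF.zero hq hker).sub n := by
    intro heq
    have h2 := congrArg (Subgroup.comap q) heq
    have h3 : F (min m n) = F (min n n) :=
      ((hF.comap_map hker m).symm.trans h2).trans (hF.comap_map hker n)
    rw [min_eq_left h, min_self] at h3
    exact hne h3
  have h1 := NormalChain.two_mul_card_le _ h hne'
  rw [hF.card_quotientChain hq hker, hF.card_quotientChain hq hker, min_self, min_eq_left h] at h1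
  nlinarith

variable {σ : Symbol G} {B C b : ℝ}

lemma norm_symbolKernel_le (hB : 0 ≤ B) (hσ : ∀ ξ : Irrep G, opNorm (σ.toFun ξ.rep) ≤ B) (n : ℕ)
    (z : G) : ‖symbolKernel σ (F n) z‖ ≤ B / μ.real (F n : Set G) := by
  have := hF.normal n
  obtain ⟨H, _, _, _, q, hq, hker⟩ := exists_quotient (F n) (hF.isOpen n)
  have hopen : IsOpen (q.ker : Set G) := hker ▸ hF.isOpen n
  have hcard : (0 : ℝ) < Fintype.card H := by exact_mod_cast Fintype.card_pos
  have h := norm_quotientKernel_le μ hq hopen σ hB hσ (q z)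
  rw [quotientKernel_apply, norm_mul, norm_inv, Complex.norm_natCast, inv_mul_le_iff₀ hcard] at h
  rw [← hker, measureReal_ker μ hq hopen, div_inv_eq_mul, mul_comm B]
  exact h

lemma norm_symbolKernel_succ_sub_le (hC : 0 ≤ C) (hσ : IsDiffBound μ F σ C b) {l n : ℕ}
    (hl : l ≤ n) {z : G} (hz : z ∉ F l) :
    ‖symbolKernel σ (F (n + 1)) z - symbolKernel σ (F n) z‖
      ≤ C * (μ.real (F (n + 1) : Set G) / μ.real (F l : Set G)) ^ b
        / μ.real (F (n + 1) : Set G) := by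
  have := hF.normal
  obtain ⟨H, _, _, _, q, hq, hker⟩ := exists_quotient (F (n + 1)) (hF.isOpen (n + 1))
  obtain ⟨H', _, _, _, q', hq', hker'⟩ := exists_quotient (F n) (hF.isOpen n)
  obtain ⟨H₀, _, _, _, q₀, hq₀, hker₀⟩ := exists_quotient (F l) (hF.isOpen l)
  have hopen : IsOpen (q.ker : Set G) := hker ▸ hF.isOpen _
  have hδ : 0 ≤ C * (μ.real (F (n + 1) : Set G) / μ.real (F l : Set G)) ^ b := by positivity
  have h := norm_symbolKernel_sub_le μ (q := q) (q' := q') (q₀ := q₀) hq hq' hopen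
    (by rw [hker, hker']; exact hF.anti (Nat.le_succ n))
    (by rw [hker', hker₀]; exact hF.anti hl) σ hδ
    (by rw [hker, hker', hker₀]; exact hσ l n hl) (z := z) (by rwa [hker₀])
  have hvol := measureReal_ker μ hq hopen
  rw [hker] at hvol
  rw [hker, hker'] at h
  refine h.trans (le_of_eq ?_)
  rw [div_eq_mul_inv _ (μ.real (F (n + 1) : Set G))]
  congr 1
  rw [hvol, inv_inv]

/-- The contributions of the levels above `m` to the kernel form a geometric series over the
distinct members of the filtration. -/
lemma norm_symbolKernel_sub_le (hC : 0 ≤ C) (hb : 1 < b) (hσ : IsDiffBound μ F σ C b)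
    {l m N : ℕ} (hl : l ≤ m) (hm : m ≤ N) {z : G} (hz : z ∉ F l) :
    ‖symbolKernel σ (F N) z - symbolKernel σ (F m) z‖
      ≤ C / (2 ^ (b - 1) - 1) * μ.real (F m : Set G) ^ (b - 1) * μ.real (F l : Set G) ^ (-b) := by
  have h2 : (0 : ℝ) < 2 ^ (b - 1) - 1 := sub_pos.2 (one_lt_two_rpow (by linarith))
  have hcl := hF.vol_pos l
  have hstep : ‖symbolKernel σ (F N) z - symbolKernel σ (F m) z‖
      ≤ C / (2 ^ (b - 1) - 1) * μ.real (F l : Set G) ^ (-b) *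
        (μ.real (F m : Set G) ^ (b - 1) - μ.real (F N : Set G) ^ (b - 1)) := by
    induction N, hm using Nat.le_induction with
    | base => simp
    | succ n hn ih =>
      by_cases heq : F n = F (n + 1)
      · rw [← heq]; exact ih
      have hc := hF.vol_pos (n + 1)
      have h3 := hF.norm_symbolKernel_succ_sub_le hC hσ (hl.trans hn) hz
      have h4 : C * (μ.real (F (n + 1) : Set G) / μ.real (F l : Set G)) ^ b
          / μ.real (F (n + 1) : Set G)
          = C * μ.real (F l : Set G) ^ (-b) * μ.real (F (n + 1) : Set G) ^ (b - 1) := by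
        rw [Real.div_rpow hc.le hcl.le, Real.rpow_sub_one hc.ne', Real.rpow_neg hcl.le]
        ring
      have h5 := rpow_neg_le_of_two_mul_le hc (hF.two_mul_vol_le (Nat.le_succ n) heq)
        (sub_pos.2 hb)
      have h6 : C * μ.real (F l : Set G) ^ (-b) * μ.real (F (n + 1) : Set G) ^ (b - 1)
          ≤ C / (2 ^ (b - 1) - 1) * μ.real (F l : Set G) ^ (-b) *
            (μ.real (F n : Set G) ^ (b - 1) - μ.real (F (n + 1) : Set G) ^ (b - 1)) := by
        have h7 : C * μ.real (F l : Set G) ^ (-b) * μ.real (F (n + 1) : Set G) ^ (b - 1)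
            = C / (2 ^ (b - 1) - 1) * μ.real (F l : Set G) ^ (-b) *
              ((2 ^ (b - 1) - 1) * μ.real (F (n + 1) : Set G) ^ (b - 1)) := by
          field_simp
        rw [h7]
        refine mul_le_mul_of_nonneg_left (by linarith) (by positivity)
      have h8 := norm_sub_le_norm_sub_add_norm_sub (symbolKernel σ (F (n + 1)) z)
        (symbolKernel σ (F n) z) (symbolKernel σ (F m) z)
      rw [h4] at h3
      linarith
  refine hstep.trans ?_
  rw [mul_right_comm]
  have hcN := hF.vol_pos N
  refine mul_le_mul_of_nonneg_right (mul_le_mul_of_nonneg_left ?_ (by positivity)) (by positivity)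
  have : 0 ≤ μ.real (F N : Set G) ^ (b - 1) := by positivity
  linarith

/-- On every finite quotient, the kernel of the multiplier is a Calderón–Zygmund kernel, with
constants that do not depend on the quotient. -/
theorem isCZKernel_quotientKernel (hB : 0 ≤ B)
    (hσB : ∀ ξ : Irrep G, opNorm (σ.toFun ξ.rep) ≤ B) (hC : 0 ≤ C) (hb : 1 < b)
    (hσ : IsDiffBound μ F σ C b) {H : Type} [Group H] [Fintype H] {N : ℕ} {q : G →* H}
    (hq : Function.Surjective q) (hker : q.ker = F N) :
    IsCZKernel (quotientChain hF.normal hF.anti hF.zero hq hker) (quotientKernel hq σ) B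
      (B + 2 * (C / (2 ^ (b - 1) - 1))) D (b - 1) := by
  classical
  have hopen : IsOpen (q.ker : Set G) := hker ▸ hF.isOpen N
  have h2 : (0 : ℝ) < 2 ^ (b - 1) - 1 := sub_pos.2 (one_lt_two_rpow (by linarith))
  have hcard : (0 : ℝ) < Fintype.card H := by exact_mod_cast Fintype.card_pos
  set E : ℝ := C / (2 ^ (b - 1) - 1) with hE
  have hE0 : 0 ≤ E := by positivity
  clear_value E
  have hnorm : ∀ w : ℂ, ‖(Fintype.card H : ℂ)⁻¹ * w‖ = (Fintype.card H : ℝ)⁻¹ * ‖w‖ := by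
    intro w
    rw [norm_mul, norm_inv, Complex.norm_natCast]
  refine ⟨hB, by positivity, hF.one_le, sub_pos.2 hb, ?_, ?_, ?_, ?_⟩
  · intro n
    rw [hF.card_quotientChain hq hker, hF.card_quotientChain hq hker, mul_left_comm]
    refine mul_le_mul_of_nonneg_left ?_ hcard.le
    rcases le_or_gt N n with h | h
    · rw [min_eq_right h, min_eq_right (h.trans (Nat.le_succ n))]
      exact le_mul_of_one_le_left (hF.vol_pos N).le hF.one_le
    · rw [min_eq_left h.le, min_eq_left h]
      exact hF.doubling n
  · exact sum_norm_conv_quotientKernel_le μ hq hopen σ hB hσB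
  · intro l h hh
    obtain ⟨z, rfl⟩ := hq h
    rw [hF.mem_quotientChain hq hker] at hh
    rw [hF.card_quotientChain hq hker, quotientKernel_apply, hnorm, hker]
    set k := min l N with hk
    have hkN : k ≤ N := min_le_right _ _
    have hck := hF.vol_pos k
    have h3 := hF.norm_symbolKernel_le hB hσB k z
    have h4 := hF.norm_symbolKernel_sub_le hC hb hσ le_rfl hkN hh
    rw [← hE, mul_assoc, ← Real.rpow_add hck, show b - 1 + -b = -1 by ring, Real.rpow_neg_one] at h4
    have h5 : ‖symbolKernel σ (F N) z‖ ≤ (B + 2 * E) / μ.real (F k : Set G) := by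
      have h6 := norm_add_le (symbolKernel σ (F N) z - symbolKernel σ (F k) z)
        (symbolKernel σ (F k) z)
      rw [sub_add_cancel] at h6
      have h7 : 0 ≤ E * (μ.real (F k : Set G))⁻¹ := by positivity
      rw [div_eq_mul_inv] at h3 ⊢
      linarith
    calc (Fintype.card H : ℝ)⁻¹ * ‖symbolKernel σ (F N) z‖
        ≤ (Fintype.card H : ℝ)⁻¹ * ((B + 2 * E) / μ.real (F k : Set G)) := by gcongr
      _ = _ := by field_simp
  · intro l m h g hlm hh hg
    obtain ⟨z, rfl⟩ := hq h
    obtain ⟨y, rfl⟩ := hq g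
    rw [hF.mem_quotientChain hq hker] at hh hg
    rw [hF.card_quotientChain hq hker, hF.card_quotientChain hq hker, ← map_mul,
      quotientKernel_apply, quotientKernel_apply, ← mul_sub, hnorm, hker]
    have hkj : min l N ≤ min m N := min_le_min_right N hlm
    set k := min l N with hk
    set j := min m N with hj
    have hjN : j ≤ N := min_le_right _ _
    have hck := hF.vol_pos k
    have hcj := hF.vol_pos j
    have hzy : z * y ∉ F k := fun h => hh (by
      have := (F k).mul_mem h ((F k).inv_mem (hF.anti hkj hg))
      rwa [mul_inv_cancel_right] at this)
    have h3 := hF.norm_symbolKernel_sub_le hC hb hσ hkj hjN hh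
    have h4 := hF.norm_symbolKernel_sub_le hC hb hσ hkj hjN hzy
    rw [symbolKernel_mul_right σ (F j) z hg] at h4
    rw [← hE] at h3 h4
    have h5 : ‖symbolKernel σ (F N) (z * y) - symbolKernel σ (F N) z‖
        ≤ 2 * (E * μ.real (F j : Set G) ^ (b - 1) * μ.real (F k : Set G) ^ (-b)) := by
      have h6 := norm_sub_le (symbolKernel σ (F N) (z * y) - symbolKernel σ (F j) z)
        (symbolKernel σ (F N) z - symbolKernel σ (F j) z)
      rw [sub_sub_sub_cancel_right] at h6
      linarith
    have h7 : (Fintype.card H * μ.real (F j : Set G)) ^ (b - 1)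
        * (Fintype.card H * μ.real (F k : Set G)) ^ (-1 - (b - 1))
        = (Fintype.card H : ℝ)⁻¹ * (μ.real (F j : Set G) ^ (b - 1)
          * μ.real (F k : Set G) ^ (-b)) := by
      rw [show -1 - (b - 1) = -b by ring, Real.mul_rpow hcard.le hcj.le,
        Real.mul_rpow hcard.le hck.le, mul_mul_mul_comm, ← Real.rpow_add hcard,
        show b - 1 + -b = -1 by ring, Real.rpow_neg_one]
    rw [mul_assoc, h7]
    have h8 : 0 ≤ B * (μ.real (F j : Set G) ^ (b - 1) * μ.real (F k : Set G) ^ (-b)) := by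
      positivity
    calc (Fintype.card H : ℝ)⁻¹ * ‖symbolKernel σ (F N) (z * y) - symbolKernel σ (F N) z‖
        ≤ (Fintype.card H : ℝ)⁻¹ * ((B + 2 * E) * (μ.real (F j : Set G) ^ (b - 1)
          * μ.real (F k : Set G) ^ (-b))) := by
          gcongr
          linarith
      _ = _ := by ring

end IsFiltration

end Filtration

/-! ### Weighted measures and finite quotients -/

section Weighted

variable {G : Type*} [Group G] [TopologicalSpace G] [IsTopologicalGroup G] [CompactSpace G]
variable [MeasurableSpace G] [BorelSpace G]
variable {μ : Measure G} [IsProbabilityMeasure μ] [μ.IsMulLeftInvariant]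

lemma measurableSet_fiber {H : Type} [Group H] [Fintype H] {q : G →* H}
    (hopen : IsOpen (q.ker : Set G)) (h : H) : MeasurableSet (q ⁻¹' {h}) := by
  classical
  exact (continuous_Prop.1 (continuous_comp_quotient hopen fun g => g = h)).measurableSet

lemma measureReal_fiber {H : Type} [Group H] [Fintype H] {q : G →* H}
    (hq : Function.Surjective q) (hopen : IsOpen (q.ker : Set G)) (h : H) :
    μ.real (q ⁻¹' {h}) = (Fintype.card H : ℝ)⁻¹ := by
  obtain ⟨x, rfl⟩ := hq h
  have h1 : q ⁻¹' {q x} = (fun y => x⁻¹ * y) ⁻¹' (q.ker : Set G) := by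
    ext y
    simp only [Set.mem_preimage, Set.mem_singleton_iff, SetLike.mem_coe, MonoidHom.mem_ker,
      map_mul, map_inv, inv_mul_eq_one]
    exact eq_comm
  rw [h1, measureReal_def, measure_preimage_mul, ← measureReal_def, measureReal_ker μ hq hopen]

lemma integral_comp_eq_sum {H : Type} [Group H] [Fintype H] {q : G →* H}
    (hopen : IsOpen (q.ker : Set G)) (ν : Measure G) [IsFiniteMeasure ν] (φ : H → ℝ) :
    ∫ x, φ (q x) ∂ν = ∑ h, φ h * ν.real (q ⁻¹' {h}) := by
  classical
  have hmeas := measurableSet_fiber hopen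
  have h1 : ∀ x, φ (q x) = ∑ h, (q ⁻¹' {h}).indicator (fun _ => φ h) x := by
    intro x
    simp [Set.indicator_apply]
  simp only [h1]
  rw [integral_finsetSum _ fun h _ => (integrable_const (φ h)).indicator (hmeas h)]
  refine Finset.sum_congr rfl fun h _ => ?_
  rw [integral_indicator_const _ (hmeas h), smul_eq_mul, mul_comm]

lemma multiplier_comp_quotient {H : Type} [Group H] [Fintype H] {q : G →* H}
    (hq : Function.Surjective q) (hopen : IsOpen (q.ker : Set G)) (σ : Symbol G) (φ : H → ℂ)
    (x : G) : σ.multiplier μ (fun y => φ (q y)) x = conv (quotientKernel hq σ) φ (q x) := by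
  classical
  rw [multiplier_eq_integral μ hq hopen σ fun x y hy => by
    rw [map_mul, MonoidHom.mem_ker.1 hy, mul_one]]
  have hcard : (Fintype.card H : ℂ) ≠ 0 := Nat.cast_ne_zero.2 Fintype.card_ne_zero
  have h1 : ∀ y, φ (q y) * symbolKernel σ q.ker (y⁻¹ * x)
      = (fun h => φ h * (Fintype.card H * quotientKernel hq σ (h⁻¹ * q x))) (q y) := by
    intro y
    simp only
    rw [← map_inv, ← map_mul, quotientKernel_apply, mul_inv_cancel_left₀ hcard]
  rw [integral_congr_ae (Filter.Eventually.of_forall h1), integral_comp_quotient μ hq hopen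
    fun h => φ h * (Fintype.card H * quotientKernel hq σ (h⁻¹ * q x)), conv, Finset.mul_sum]
  refine Finset.sum_congr rfl fun h _ => ?_
  field_simp

variable {F : ℕ → Subgroup G} {D : ℝ} {d : ℕ} {α : ℝ}

lemma groupNorm_rpow (hanti : Antitone F) {n : ℕ} {x : G} (hx : x ∈ F n) (hx' : x ∉ F (n + 1)) :
    groupNorm μ F d x ^ α = μ.real (F n : Set G) ^ (α / d) := by
  have h1 : x ≠ 1 := fun h => hx' (h ▸ (F (n + 1)).one_mem)
  have h2 : {k | x ∈ F k} = Set.Iic n := by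
    ext k
    refine ⟨fun hk => ?_, fun hk => hanti hk hx⟩
    by_contra hlt
    exact hx' (hanti (Nat.succ_le_of_lt (not_le.1 hlt)) hk)
  rw [groupNorm, groupAbs, if_neg h1, h2, csSup_Iic, ← Real.rpow_mul measureReal_nonneg,
    one_div_mul_eq_div]

namespace IsFiltration

variable (hF : IsFiltration μ F D)
include hF

lemma measurableSet (n : ℕ) : MeasurableSet (F n : Set G) := (hF.isOpen n).measurableSet

lemma weightedMeasure_shell {n : ℕ} {s : Set G} (hs : MeasurableSet s)
    (hsub : s ⊆ (F n : Set G) \ F (n + 1)) :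
    weightedMeasure μ F d α s
      = ENNReal.ofReal (μ.real (F n : Set G) ^ (α / d) * μ.real s) := by
  rw [weightedMeasure, withDensity_apply _ hs, setLIntegral_congr_fun hs fun x hx =>
    congrArg ENNReal.ofReal (groupNorm_rpow hF.anti (hsub hx).1 (hsub hx).2), setLIntegral_const,
    ENNReal.ofReal_mul (by positivity), ofReal_measureReal]

/-- For `s = 1 + α / d > 0` the shells of `F N` have the masses `c_n ^ (s - 1) (c_n - c_{n+1})`,
where `c_n = |F n|`; these are dominated by the telescoping differences of `c_n ^ s`. -/
lemma weightedMeasure_diff_le (hα : -1 < α / d) (N k : ℕ) :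
    weightedMeasure μ F d α ((F N : Set G) \ F (N + k))
      ≤ ENNReal.ofReal ((1 - 2 ^ (-(1 + α / d)))⁻¹ * (μ.real (F N : Set G) ^ (1 + α / d)
        - μ.real (F (N + k) : Set G) ^ (1 + α / d))) := by
  have hs : 0 < 1 + α / d := by linarith
  have hE : 0 < 1 - (2 : ℝ) ^ (-(1 + α / d)) :=
    sub_pos.2 (Real.rpow_lt_one_of_one_lt_of_neg one_lt_two (by linarith))
  induction k with
  | zero => simp
  | succ k ih =>
    have hsub : (F N : Set G) \ F (N + (k + 1))
        ⊆ ((F N : Set G) \ F (N + k)) ∪ ((F (N + k) : Set G) \ F (N + k + 1)) := by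
      intro x hx
      by_cases h : x ∈ F (N + k)
      · exact Or.inr ⟨h, hx.2⟩
      · exact Or.inl ⟨hx.1, h⟩
    have hc := hF.vol_pos (N + k)
    have hc' := hF.vol_pos (N + k + 1)
    have hanti := hF.vol_anti (Nat.le_succ (N + k))
    have h1 : weightedMeasure μ F d α ((F (N + k) : Set G) \ F (N + k + 1))
        ≤ ENNReal.ofReal ((1 - 2 ^ (-(1 + α / d)))⁻¹ * (μ.real (F (N + k) : Set G) ^ (1 + α / d)
          - μ.real (F (N + k + 1) : Set G) ^ (1 + α / d))) := by
      by_cases heq : F (N + k) = F (N + k + 1)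
      · rw [← heq]; simp
      rw [hF.weightedMeasure_shell ((hF.measurableSet _).diff (hF.measurableSet _)) subset_rfl]
      refine ENNReal.ofReal_le_ofReal ?_
      have h2 : μ.real ((F (N + k) : Set G) \ F (N + k + 1)) ≤ μ.real (F (N + k) : Set G) :=
        measureReal_mono Set.sdiff_subset
      have h3 := rpow_neg_le_of_two_mul_le hc' (hF.two_mul_vol_le (Nat.le_succ _) heq) hs
      have h4 : μ.real (F (N + k + 1) : Set G) ^ (1 + α / d)
          ≤ 2 ^ (-(1 + α / d)) * μ.real (F (N + k) : Set G) ^ (1 + α / d) := by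
        rw [Real.rpow_neg zero_le_two, le_inv_mul_iff₀ (by positivity)]
        exact h3
      calc μ.real (F (N + k) : Set G) ^ (α / d) * μ.real ((F (N + k) : Set G) \ F (N + k + 1))
          ≤ μ.real (F (N + k) : Set G) ^ (α / d) * μ.real (F (N + k) : Set G) := by gcongr
        _ = μ.real (F (N + k) : Set G) ^ (1 + α / d) := by
            rw [add_comm 1, Real.rpow_add_one hc.ne']
        _ ≤ _ := by
            rw [le_inv_mul_iff₀ hE]
            linarith
    refine (measure_mono hsub).trans ((measure_union_le _ _).trans ((add_le_add ih h1).trans ?_))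
    have hmono : μ.real (F (N + k) : Set G) ^ (1 + α / d) ≤ μ.real (F N : Set G) ^ (1 + α / d) :=
      Real.rpow_le_rpow hc.le (hF.vol_anti (Nat.le_add_right N k)) hs.le
    have hmono' : μ.real (F (N + k + 1) : Set G) ^ (1 + α / d)
        ≤ μ.real (F (N + k) : Set G) ^ (1 + α / d) := Real.rpow_le_rpow hc'.le hanti hs.le
    rw [← ENNReal.ofReal_add (mul_nonneg (inv_pos.2 hE).le (sub_nonneg.2 hmono))
      (mul_nonneg (inv_pos.2 hE).le (sub_nonneg.2 hmono'))]
    refine ENNReal.ofReal_le_ofReal (le_of_eq ?_)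
    rw [← add_assoc N k 1]
    ring

lemma iInter_eq (hsep : ∀ x : G, x ≠ 1 → ∃ n, x ∉ F n) : ⋂ n, (F n : Set G) = {1} := by
  ext x
  simp only [Set.mem_iInter, SetLike.mem_coe, Set.mem_singleton_iff]
  refine ⟨fun h => ?_, fun h n => h ▸ (F n).one_mem⟩
  by_contra hx
  obtain ⟨n, hn⟩ := hsep x hx
  exact hn (h n)

lemma weightedMeasure_le (hα : -1 < α / d) (hsep : ∀ x : G, x ≠ 1 → ∃ n, x ∉ F n)
    (hatom : μ {1} = 0) (N : ℕ) :
    weightedMeasure μ F d α (F N : Set G)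
      ≤ ENNReal.ofReal ((1 - 2 ^ (-(1 + α / d)))⁻¹ * μ.real (F N : Set G) ^ (1 + α / d)) := by
  have hE : 0 < 1 - (2 : ℝ) ^ (-(1 + α / d)) :=
    sub_pos.2 (Real.rpow_lt_one_of_one_lt_of_neg one_lt_two (by linarith))
  have hzero : weightedMeasure μ F d α {1} = 0 := withDensity_absolutelyContinuous _ _ hatom
  have hsub : (F N : Set G) ⊆ {1} ∪ ⋃ k, (F N : Set G) \ F (N + k) := by
    intro x hx
    by_cases h1 : x = 1
    · exact Or.inl h1
    · obtain ⟨n, hn⟩ := hsep x h1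
      exact Or.inr (Set.mem_iUnion.2 ⟨n, hx, fun h => hn (hF.anti (Nat.le_add_left n N) h)⟩)
  have hmono : Monotone fun k => (F N : Set G) \ F (N + k) := fun i j hij =>
    Set.sdiff_subset_sdiff_right (hF.anti (Nat.add_le_add_left hij N))
  refine (measure_mono hsub).trans ((measure_union_le _ _).trans ?_)
  rw [hzero, zero_add]
  refine le_of_tendsto (tendsto_measure_iUnion_atTop hmono)
    (Filter.Eventually.of_forall fun k => ?_)
  refine (hF.weightedMeasure_diff_le hα N k).trans (ENNReal.ofReal_le_ofReal ?_)
  refine mul_le_mul_of_nonneg_left ?_ (inv_pos.2 hE).le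
  have : 0 ≤ μ.real (F (N + k) : Set G) ^ (1 + α / d) := by positivity
  linarith

lemma isFiniteMeasure_weightedMeasure (hα : -1 < α / d)
    (hsep : ∀ x : G, x ≠ 1 → ∃ n, x ∉ F n) (hatom : μ {1} = 0) :
    IsFiniteMeasure (weightedMeasure μ F d α) := by
  have h := hF.weightedMeasure_le hα hsep hatom 0
  rw [hF.zero, Subgroup.coe_top] at h
  exact ⟨h.trans_lt ENNReal.ofReal_lt_top⟩

lemma le_weightedMeasure {N : ℕ} (hne : F N ≠ F (N + 1)) :
    ENNReal.ofReal (2⁻¹ * μ.real (F N : Set G) ^ (1 + α / d))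
      ≤ weightedMeasure μ F d α (F N : Set G) := by
  refine le_trans ?_ (measure_mono (Set.sdiff_subset (s := (F N : Set G)) (t := F (N + 1))))
  rw [hF.weightedMeasure_shell ((hF.measurableSet _).diff (hF.measurableSet _)) subset_rfl]
  refine ENNReal.ofReal_le_ofReal ?_
  have hc := hF.vol_pos N
  have h1 := hF.two_mul_vol_le (Nat.le_succ N) hne
  have h2 : μ.real ((F N : Set G) \ F (N + 1))
      = μ.real (F N : Set G) - μ.real (F (N + 1) : Set G) :=
    measureReal_sdiff (hF.anti (Nat.le_succ N)) (hF.measurableSet _)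
  rw [h2, add_comm, Real.rpow_add_one hc.ne', mul_left_comm]
  refine mul_le_mul_of_nonneg_left ?_ (by positivity)
  change 2 * μ.real (F (N + 1) : Set G) ≤ _ at h1
  linarith

/-- Since a point has measure zero, the filtration has infinitely many jumps. -/
lemma exists_ne_succ (hsep : ∀ x : G, x ≠ 1 → ∃ n, x ∉ F n) (hatom : μ {1} = 0) (l : ℕ) :
    ∃ N, l ≤ N ∧ F N ≠ F (N + 1) := by
  by_contra! hcon
  have hconst : ∀ n, l ≤ n → F n = F l := by
    intro n hn
    induction n, hn using Nat.le_induction with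
    | base => rfl
    | succ n hn ih => rw [← hcon n hn, ih]
  have h1 : (F l : Set G) ⊆ {1} := by
    rw [← hF.iInter_eq hsep]
    refine Set.subset_iInter fun n => ?_
    rcases le_total l n with h | h
    · rw [hconst n h]
    · exact hF.anti h
  have h2 : μ.real (F l : Set G) = 0 := by
    rw [measureReal_def, measure_mono_null h1 hatom, ENNReal.toReal_zero]
  exact (hF.vol_pos l).ne' h2

/-- The weighted measure of the fibers of a finite quotient is comparable to the power weight on
the quotient. At the identity this needs a jump of the filtration at `N`. -/
lemma weightedMeasure_fiber (hα : -1 < α / d) (hsep : ∀ x : G, x ≠ 1 → ∃ n, x ∉ F n)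
    (hatom : μ {1} = 0) {H : Type} [Group H] [Fintype H] {N : ℕ} {q : G →* H}
    (hq : Function.Surjective q) (hker : q.ker = F N) (hne : F N ≠ F (N + 1)) (h : H) :
    2⁻¹ * ((Fintype.card H : ℝ)⁻¹ ^ (1 + α / d) *
        (quotientChain hF.normal hF.anti hF.zero hq hker).vol h ^ (α / d))
      ≤ (weightedMeasure μ F d α).real (q ⁻¹' {h}) ∧
    (weightedMeasure μ F d α).real (q ⁻¹' {h})
      ≤ (1 - 2 ^ (-(1 + α / d)))⁻¹ * ((Fintype.card H : ℝ)⁻¹ ^ (1 + α / d) *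
        (quotientChain hF.normal hF.anti hF.zero hq hker).vol h ^ (α / d)) := by
  classical
  have hfin := hF.isFiniteMeasure_weightedMeasure hα hsep hatom
  have hopen : IsOpen (q.ker : Set G) := hker ▸ hF.isOpen N
  have hcard : (0 : ℝ) < Fintype.card H := by exact_mod_cast Fintype.card_pos
  have hvol : μ.real (F N : Set G) = (Fintype.card H : ℝ)⁻¹ := by
    rw [← hker, measureReal_ker μ hq hopen]
  have hE : 0 < 1 - (2 : ℝ) ^ (-(1 + α / d)) :=
    sub_pos.2 (Real.rpow_lt_one_of_one_lt_of_neg one_lt_two (by linarith))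
  have hE1 : 1 ≤ (1 - (2 : ℝ) ^ (-(1 + α / d)))⁻¹ := by
    rw [one_le_inv₀ hE]
    have : (0 : ℝ) < 2 ^ (-(1 + α / d)) := by positivity
    linarith
  set A := quotientChain hF.normal hF.anti hF.zero hq hker with hA
  by_cases h1 : h = 1
  -- the fiber of the identity is `F N`, every other fiber lies in a single shell
  · subst h1
    have h2 : q ⁻¹' {1} = (F N : Set G) := by rw [← hker]; rfl
    rw [A.vol_one, Real.one_rpow, mul_one, h2, ← hvol]
    refine ⟨?_, ?_⟩
    · exact (ENNReal.ofReal_le_iff_le_toReal (measure_ne_top _ _)).1 (hF.le_weightedMeasure hne)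
    · exact ENNReal.toReal_le_of_le_ofReal (mul_nonneg (inv_pos.2 hE).le (by positivity))
        (hF.weightedMeasure_le hα hsep hatom N)
  · have hmem := A.mem_sub_lev h
    have hnot := A.notMem_sub_lev_succ h1
    have hlt : A.lev h < N := by
      refine A.lev_lt fun h2 => h1 ?_
      have h3 : A.sub N = ⊥ := A.sub_len
      rw [h3] at h2
      exact h2
    set n := A.lev h with hn
    have hmeas := measurableSet_fiber hopen h
    have hsub : q ⁻¹' {h} ⊆ (F n : Set G) \ F (n + 1) := by
      intro x hx
      have hx' : q x = h := hx
      rw [← hx', hF.mem_quotientChain hq hker] at hmem hnot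
      rw [min_eq_left hlt.le] at hmem
      rw [min_eq_left hlt] at hnot
      exact ⟨hmem, hnot⟩
    have h4 : A.vol h = Fintype.card H * μ.real (F n : Set G) := by
      rw [NormalChain.vol, ← hn, hF.card_quotientChain hq hker, min_eq_left hlt.le]
    have hc := hF.vol_pos n
    have h5 : (weightedMeasure μ F d α).real (q ⁻¹' {h})
        = (Fintype.card H : ℝ)⁻¹ ^ (1 + α / d) * A.vol h ^ (α / d) := by
      rw [measureReal_def, hF.weightedMeasure_shell hmeas hsub, measureReal_fiber hq hopen,
        ENNReal.toReal_ofReal (by positivity), h4, Real.mul_rpow hcard.le hc.le, add_comm,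
        Real.rpow_add_one (inv_pos.2 hcard).ne', Real.inv_rpow hcard.le]
      have : (Fintype.card H : ℝ) ^ (α / d) ≠ 0 := by positivity
      field_simp
    rw [h5]
    have h6 : 0 ≤ (Fintype.card H : ℝ)⁻¹ ^ (1 + α / d) * A.vol h ^ (α / d) := by
      have := A.vol_pos h
      positivity
    exact ⟨by linarith, le_mul_of_one_le_left h6 hE1⟩

variable {σ : Symbol G} {B C b : ℝ}

/-- The weighted estimate for the multiplier on smooth functions, transferred from the finite
quotients. -/
theorem exists_integral_multiplier_le (hsep : ∀ x : G, x ≠ 1 → ∃ n, x ∉ F n) (hatom : μ {1} = 0)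
    (hB : 0 ≤ B) (hσB : ∀ ξ : Irrep G, opNorm (σ.toFun ξ.rep) ≤ B) (hC : 0 ≤ C) (hb : 1 < b)
    (hσ : IsDiffBound μ F σ C b) {r : ℝ} (hr : 1 < r) (hα : -1 < α / d) (hα' : α / d < r - 1) :
    ∃ M, 0 ≤ M ∧ ∀ f : G → ℂ, IsSmooth F f →
      ∫ x, ‖σ.multiplier μ f x‖ ^ r ∂(weightedMeasure μ F d α)
        ≤ M * ∫ x, ‖f x‖ ^ r ∂(weightedMeasure μ F d α) := by
  have hfin := hF.isFiniteMeasure_weightedMeasure hα hsep hatom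
  obtain ⟨M, hM, hbound⟩ := exists_weighted_bound B (B + 2 * (C / (2 ^ (b - 1) - 1))) D (b - 1)
    hr hα hα'
  have hE : 0 < 1 - (2 : ℝ) ^ (-(1 + α / d)) :=
    sub_pos.2 (Real.rpow_lt_one_of_one_lt_of_neg one_lt_two (by linarith))
  set E : ℝ := (1 - (2 : ℝ) ^ (-(1 + α / d)))⁻¹ with hEdef
  have hE0 : 0 ≤ E := (inv_pos.2 hE).le
  refine ⟨2 * E * M, by positivity, fun f ⟨l, hl⟩ => ?_⟩
  -- a jump of the filtration is needed for the comparison of measures on the fiber of the identity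
  obtain ⟨N, hlN, hne⟩ := hF.exists_ne_succ hsep hatom l
  have hnormal := hF.normal
  obtain ⟨H, _, _, _, q, hq, hker⟩ := exists_quotient (F N) (hF.isOpen N)
  have hopen : IsOpen (q.ker : Set G) := hker ▸ hF.isOpen N
  set φ : H → ℂ := fun h => f (Function.surjInv hq h) with hφ
  have hfφ : f = fun x => φ (q x) := by
    ext x
    exact (eq_of_quotient_eq (q := q) (fun x y hy => hl x y (hF.anti hlN (hker ▸ hy)))
      (Function.surjInv_eq hq (q x))).symm
  rw [hfφ]
  simp only [multiplier_comp_quotient hq hopen]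
  rw [integral_comp_eq_sum hopen _ fun h => ‖conv (quotientKernel hq σ) φ h‖ ^ r,
    integral_comp_eq_sum hopen _ fun h => ‖φ h‖ ^ r]
  have hfib := hF.weightedMeasure_fiber hα hsep hatom hq hker hne
  simp only [← hEdef] at hfib
  have hmain := hbound (hF.isCZKernel_quotientKernel hB hσB hC hb hσ hq hker) φ
  set A := quotientChain hF.normal hF.anti hF.zero hq hker with hA
  have hcard : (0 : ℝ) < Fintype.card H := by exact_mod_cast Fintype.card_pos
  set c : ℝ := (Fintype.card H : ℝ)⁻¹ ^ (1 + α / d) with hc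
  have hc0 : 0 ≤ c := by positivity
  clear_value E c
  calc ∑ h, ‖conv (quotientKernel hq σ) φ h‖ ^ r * (weightedMeasure μ F d α).real (q ⁻¹' {h})
      ≤ ∑ h, ‖conv (quotientKernel hq σ) φ h‖ ^ r * (E * (c * A.vol h ^ (α / d))) :=
        Finset.sum_le_sum fun h _ => mul_le_mul_of_nonneg_left (hfib h).2 (by positivity)
    _ = E * c * ∑ h, ‖conv (quotientKernel hq σ) φ h‖ ^ r * A.vol h ^ (α / d) := by
        rw [Finset.mul_sum]
        exact Finset.sum_congr rfl fun h _ => by ring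
    _ ≤ E * c * (M * ∑ h, ‖φ h‖ ^ r * A.vol h ^ (α / d)) :=
        mul_le_mul_of_nonneg_left hmain (by positivity)
    _ = 2 * E * M * ∑ h, ‖φ h‖ ^ r * (2⁻¹ * (c * A.vol h ^ (α / d))) := by
        rw [Finset.mul_sum, Finset.mul_sum, Finset.mul_sum]
        exact Finset.sum_congr rfl fun h _ => by ring
    _ ≤ _ := mul_le_mul_of_nonneg_left (Finset.sum_le_sum fun h _ =>
        mul_le_mul_of_nonneg_left (hfib h).1 (by positivity)) (by positivity)

end IsFiltration

end Weighted

/-! ### Density of smooth functions and extension by continuity -/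

section Density

variable {G : Type*} [Group G] [TopologicalSpace G] [IsTopologicalGroup G] [CompactSpace G]

/-- The smooth functions, as a `*`-algebra of continuous functions. -/
def smoothAlgebra (F : ℕ → Subgroup G) (hanti : Antitone F) : StarSubalgebra ℂ C(G, ℂ) where
  carrier := {f | IsSmooth F f}
  mul_mem' := by
    rintro f g ⟨l, hl⟩ ⟨m, hm⟩
    refine ⟨max l m, fun x y hy => ?_⟩
    rw [ContinuousMap.mul_apply, ContinuousMap.mul_apply, hl x y (hanti (le_max_left _ _) hy),
      hm x y (hanti (le_max_right _ _) hy)]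
  add_mem' := by
    rintro f g ⟨l, hl⟩ ⟨m, hm⟩
    refine ⟨max l m, fun x y hy => ?_⟩
    rw [ContinuousMap.add_apply, ContinuousMap.add_apply, hl x y (hanti (le_max_left _ _) hy),
      hm x y (hanti (le_max_right _ _) hy)]
  algebraMap_mem' := fun c => ⟨0, fun _ _ _ => rfl⟩
  star_mem' := by
    rintro f ⟨l, hl⟩
    exact ⟨l, fun x y hy => by
      rw [ContinuousMap.star_apply, ContinuousMap.star_apply, hl x y hy]⟩

lemma IsSmooth.continuous {F : ℕ → Subgroup G} (hopen : ∀ n, IsOpen (F n : Set G)) {f : G → ℂ}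
    (hf : IsSmooth F f) : Continuous f := by
  obtain ⟨l, hl⟩ := hf
  exact continuous_of_right_invariant (hopen l) hl

/-- Smooth functions are uniformly dense in the continuous functions, by the Stone–Weierstrass
theorem. -/
lemma smoothAlgebra_topologicalClosure {F : ℕ → Subgroup G} (hanti : Antitone F)
    (hopen : ∀ n, IsOpen (F n : Set G)) (hsep : ∀ x : G, x ≠ 1 → ∃ n, x ∉ F n) :
    (smoothAlgebra F hanti).topologicalClosure = ⊤ := by
  classical
  refine ContinuousMap.starSubalgebra_topologicalClosure_eq_top_of_separatesPoints _ ?_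
  intro x y hxy
  obtain ⟨n, hn⟩ := hsep (x⁻¹ * y) fun h => hxy (inv_mul_eq_one.1 h)
  have hinv : ∀ z, ∀ w ∈ F n, (if x⁻¹ * (z * w) ∈ F n then (1 : ℂ) else 0)
      = if x⁻¹ * z ∈ F n then 1 else 0 := by
    intro z w hw
    rw [← mul_assoc, Subgroup.mul_mem_cancel_right _ hw]
  refine ⟨_, ⟨⟨fun z => if x⁻¹ * z ∈ F n then (1 : ℂ) else 0,
    continuous_of_right_invariant (hopen n) hinv⟩, ⟨n, hinv⟩, rfl⟩, ?_⟩
  simp [hn, (F n).one_mem]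

variable [MeasurableSpace G] [BorelSpace G] [TopologicalSpace.PseudoMetrizableSpace G]

lemma denseRange_smooth_toLp {F : ℕ → Subgroup G} (hanti : Antitone F)
    (hopen : ∀ n, IsOpen (F n : Set G)) (hsep : ∀ x : G, x ≠ 1 → ∃ n, x ∉ F n) (ν : Measure G)
    [IsFiniteMeasure ν] {p : ℝ≥0∞} [Fact (1 ≤ p)] (hp : p ≠ ⊤) :
    DenseRange fun f : smoothAlgebra F hanti =>
      ContinuousMap.toLp (E := ℂ) p ν ℂ (f : C(G, ℂ)) := by
  have h1 : DenseRange ((↑) : smoothAlgebra F hanti → C(G, ℂ)) := by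
    intro g
    rw [Subtype.range_coe]
    have h2 : g ∈ (smoothAlgebra F hanti).topologicalClosure := by
      rw [smoothAlgebra_topologicalClosure hanti hopen hsep]
      exact StarSubalgebra.mem_top
    exact h2
  exact (ContinuousMap.toLp_denseRange ℂ ν ℂ hp).comp h1
    (ContinuousMap.toLp (E := ℂ) p ν ℂ).continuous

omit [IsTopologicalGroup G] [Group G] [TopologicalSpace.PseudoMetrizableSpace G] in
lemma norm_toLp {ν : Measure G} [IsFiniteMeasure ν] {r : ℝ} (hr : 1 ≤ r)
    [Fact (1 ≤ ENNReal.ofReal r)] (f : C(G, ℂ)) :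
    ‖ContinuousMap.toLp (E := ℂ) (ENNReal.ofReal r) ν ℂ f‖ = (∫ x, ‖f x‖ ^ r ∂ν) ^ r⁻¹ := by
  have hr0 : 0 ≤ r := zero_le_one.trans hr
  have hmem : MemLp f (ENNReal.ofReal r) ν := ContinuousMap.memLp ν ℂ f
  have hpos : ENNReal.ofReal r ≠ 0 := by
    rw [Ne, ENNReal.ofReal_eq_zero]
    linarith
  rw [Lp.norm_def, eLpNorm_congr_ae (ContinuousMap.coeFn_toLp ν f),
    hmem.eLpNorm_eq_integral_rpow_norm hpos ENNReal.ofReal_ne_top,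
    ENNReal.toReal_ofReal hr0, ENNReal.toReal_ofReal (by positivity)]

variable {μ : Measure G} [IsProbabilityMeasure μ] [μ.IsMulLeftInvariant]
variable {F : ℕ → Subgroup G} {D : ℝ} (hF : IsFiltration μ F D) (σ : Symbol G)
include hF

namespace IsFiltration

/-- Smooth functions factor through arbitrarily fine finite quotients, where the multiplier is a
convolution. -/
lemma exists_multiplier_eq_conv {l : ℕ} {f g : G → ℂ} (hf : ∀ x, ∀ y ∈ F l, f (x * y) = f x)
    (hg : ∀ x, ∀ y ∈ F l, g (x * y) = g x) :
    ∃ (H : Type) (_ : Group H) (_ : Fintype H) (q : G →* H) (K φ γ : H → ℂ), q.ker = F l ∧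
      f = (fun x => φ (q x)) ∧ g = (fun x => γ (q x)) ∧
      ∀ (ψ : H → ℂ) x, σ.multiplier μ (fun y => ψ (q y)) x = conv K ψ (q x) := by
  have hnormal := hF.normal
  obtain ⟨H, _, _, _, q, hq, hker⟩ := exists_quotient (F l) (hF.isOpen l)
  refine ⟨H, inferInstance, inferInstance, q, quotientKernel hq σ,
    fun h => f (Function.surjInv hq h), fun h => g (Function.surjInv hq h), hker, ?_, ?_,
    multiplier_comp_quotient hq (hker ▸ hF.isOpen l) σ⟩
  · ext x
    exact (eq_of_quotient_eq (q := q) (fun x y hy => hf x y (hker ▸ hy))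
      (Function.surjInv_eq hq (q x))).symm
  · ext x
    exact (eq_of_quotient_eq (q := q) (fun x y hy => hg x y (hker ▸ hy))
      (Function.surjInv_eq hq (q x))).symm

lemma isSmooth_multiplier {f : G → ℂ} (hf : IsSmooth F f) : IsSmooth F (σ.multiplier μ f) := by
  obtain ⟨l, hl⟩ := hf
  obtain ⟨H, _, _, q, K, φ, _, hker, rfl, -, hT⟩ := hF.exists_multiplier_eq_conv σ hl hl
  refine ⟨l, fun x y hy => ?_⟩
  have hy' : q y = 1 := MonoidHom.mem_ker.1 (hker.symm ▸ hy)
  rw [hT, hT, map_mul, hy', mul_one]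

lemma multiplier_add {f g : G → ℂ} (hf : IsSmooth F f) (hg : IsSmooth F g) (x : G) :
    σ.multiplier μ (f + g) x = σ.multiplier μ f x + σ.multiplier μ g x := by
  obtain ⟨l, hl⟩ := hf
  obtain ⟨m, hm⟩ := hg
  obtain ⟨H, _, _, q, K, φ, γ, -, rfl, rfl, hT⟩ := hF.exists_multiplier_eq_conv σ
    (l := max l m) (fun x y hy => hl x y (hF.anti (le_max_left _ _) hy))
    (fun x y hy => hm x y (hF.anti (le_max_right _ _) hy))
  have h1 : (fun x => φ (q x)) + (fun x => γ (q x)) = fun x => (φ + γ) (q x) := rfl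
  rw [h1, hT, hT, hT]
  simp only [conv, Pi.add_apply, add_mul, Finset.sum_add_distrib]

lemma multiplier_smul (c : ℂ) {f : G → ℂ} (hf : IsSmooth F f) (x : G) :
    σ.multiplier μ (c • f) x = c * σ.multiplier μ f x := by
  obtain ⟨l, hl⟩ := hf
  obtain ⟨H, _, _, q, K, φ, _, -, rfl, -, hT⟩ := hF.exists_multiplier_eq_conv σ hl hl
  have h1 : (c • fun x => φ (q x)) = fun x => (c • φ) (q x) := rfl
  rw [h1, hT, hT]
  simp only [conv, Pi.smul_apply, smul_eq_mul, mul_assoc, Finset.mul_sum]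

/-- The multiplier as a linear map from smooth functions to continuous functions. -/
def multiplierMap : smoothAlgebra F hF.anti →ₗ[ℂ] C(G, ℂ) where
  toFun f := ⟨σ.multiplier μ f.1, (hF.isSmooth_multiplier σ f.2).continuous hF.isOpen⟩
  map_add' f g := by
    ext x
    exact hF.multiplier_add σ f.2 g.2 x
  map_smul' c f := by
    ext x
    exact hF.multiplier_smul σ c f.2 x

/-- The weighted bound, for any filtered compact group in which points have measure zero: the
estimate on smooth functions extends by density. -/
theorem extendsToBounded_multiplier (hsep : ∀ x : G, x ≠ 1 → ∃ n, x ∉ F n) (hatom : μ {1} = 0)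
    {B C b : ℝ} (hB : 0 ≤ B) (hσB : ∀ ξ : Irrep G, opNorm (σ.toFun ξ.rep) ≤ B) (hC : 0 ≤ C)
    (hb : 1 < b) (hσ : IsDiffBound μ F σ C b) {d : ℕ} {r α : ℝ} (hr : 1 < r) (hα : -1 < α / d)
    (hα' : α / d < r - 1) :
    ExtendsToBounded F (σ.multiplier μ) (weightedMeasure μ F d α) r hr.le := by
  have hfin := hF.isFiniteMeasure_weightedMeasure hα hsep hatom
  have hfact : Fact (1 ≤ ENNReal.ofReal r) := ⟨ENNReal.one_le_ofReal.2 hr.le⟩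
  obtain ⟨M, hM, hbound⟩ :=
    hF.exists_integral_multiplier_le hsep hatom hB hσB hC hb hσ hr hα hα'
  set ν := weightedMeasure μ F d α with hν
  let J : C(G, ℂ) →ₗ[ℂ] Lp ℂ (ENNReal.ofReal r) ν :=
    (ContinuousMap.toLp (E := ℂ) (ENNReal.ofReal r) ν ℂ).toLinearMap
  let e : smoothAlgebra F hF.anti →ₗ[ℂ] Lp ℂ (ENNReal.ofReal r) ν :=
    J ∘ₗ (smoothAlgebra F hF.anti).toSubalgebra.toSubmodule.subtype
  let T : smoothAlgebra F hF.anti →ₗ[ℂ] Lp ℂ (ENNReal.ofReal r) ν := J ∘ₗ hF.multiplierMap σ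
  have hdense : DenseRange e :=
    denseRange_smooth_toLp hF.anti hF.isOpen hsep ν ENNReal.ofReal_ne_top
  have hnorm : ∃ c, ∀ f, ‖T f‖ ≤ c * ‖e f‖ := by
    refine ⟨M ^ r⁻¹, fun f => ?_⟩
    have h1 : ‖T f‖ = (∫ x, ‖σ.multiplier μ f.1 x‖ ^ r ∂ν) ^ r⁻¹ := norm_toLp hr.le _
    have h2 : ‖e f‖ = (∫ x, ‖f.1 x‖ ^ r ∂ν) ^ r⁻¹ := norm_toLp hr.le _
    have h0 : ∀ g : G → ℂ, 0 ≤ ∫ x, ‖g x‖ ^ r ∂ν := fun g =>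
      integral_nonneg fun x => by positivity
    rw [h1, h2, ← Real.mul_rpow hM (h0 _)]
    exact Real.rpow_le_rpow (h0 _) (hbound f.1 f.2) (inv_nonneg.2 (by linarith))
  refine ⟨T.extendOfNorm e, fun f hf => ?_⟩
  have hfc : Continuous f := hf.continuous hF.isOpen
  have hTc : Continuous (σ.multiplier μ f) := (hF.isSmooth_multiplier σ hf).continuous hF.isOpen
  refine ⟨ContinuousMap.memLp ν ℂ ⟨f, hfc⟩, ContinuousMap.memLp ν ℂ ⟨_, hTc⟩, ?_⟩
  exact LinearMap.extendOfNorm_eq hdense hnorm ⟨⟨f, hfc⟩, hf⟩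

end IsFiltration

end Density

/-! ### The congruence filtration of a p-adic matrix group -/

section Congruence

variable {p : ℕ} [Fact p.Prime] {m : ℕ} {G : Type*} [Group G]
variable {ρ : G →* Matrix.GeneralLinearGroup (Fin m) ℤ_[p]}

lemma toZModPow_eq_iff {n : ℕ} {u v : ℤ_[p]} :
    PadicInt.toZModPow n u = PadicInt.toZModPow n v ↔ (p : ℤ_[p]) ^ n ∣ u - v := by
  rw [← sub_eq_zero, ← map_sub, ← RingHom.mem_ker, PadicInt.ker_toZModPow,
    Ideal.mem_span_singleton]

lemma mem_congruenceFiltration_iff_toZModPow {n : ℕ} {x : G} :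
    x ∈ congruenceFiltration ρ n ↔ ∀ i j, PadicInt.toZModPow n ((ρ x).1 i j)
      = PadicInt.toZModPow n ((1 : Matrix (Fin m) (Fin m) ℤ_[p]) i j) := by
  rw [congruenceFiltration, Subgroup.mem_comap, MonoidHom.mem_ker, Units.ext_iff,
    ← Matrix.ext_iff]
  refine forall_congr' fun i => forall_congr' fun j => ?_
  have h1 : (1 : Matrix (Fin m) (Fin m) (ZMod (p ^ n))) i j
      = PadicInt.toZModPow n ((1 : Matrix (Fin m) (Fin m) ℤ_[p]) i j) := by
    rw [Matrix.one_apply, Matrix.one_apply]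
    split_ifs <;> simp
  rw [← h1]
  rfl

lemma mem_congruenceFiltration {n : ℕ} {x : G} :
    x ∈ congruenceFiltration ρ n ↔
      ∀ i j, (p : ℤ_[p]) ^ n ∣ (ρ x).1 i j - (1 : Matrix (Fin m) (Fin m) ℤ_[p]) i j := by
  simp only [mem_congruenceFiltration_iff_toZModPow, toZModPow_eq_iff]

lemma congruenceFiltration_antitone : Antitone (congruenceFiltration ρ) := by
  intro n k h x hx
  rw [mem_congruenceFiltration] at hx ⊢
  exact fun i j => (pow_dvd_pow _ h).trans (hx i j)

lemma congruenceFiltration_zero : congruenceFiltration ρ 0 = ⊤ := by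
  ext x
  simp [mem_congruenceFiltration]

lemma exists_notMem_congruenceFiltration (hinj : Function.Injective ρ) {x : G} (hx : x ≠ 1) :
    ∃ n, x ∉ congruenceFiltration ρ n := by
  by_contra! hcon
  refine hx (hinj (Units.ext (Matrix.ext fun i j => ?_)))
  rw [map_one]
  exact PadicInt.ext_of_toZModPow.1 fun n => mem_congruenceFiltration_iff_toZModPow.1 (hcon n) i j

/-- Elements whose matrices agree modulo `p ^ n` lie in the same coset of `G_n`. -/
lemma inv_mul_mem_congruenceFiltration {n : ℕ} {x y : G}
    (h : ∀ i j, (p : ℤ_[p]) ^ n ∣ (ρ y).1 i j - (ρ x).1 i j) :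
    x⁻¹ * y ∈ congruenceFiltration ρ n := by
  rw [mem_congruenceFiltration]
  intro i j
  have h1 : (ρ (x⁻¹ * y)).1 - 1 = (ρ x⁻¹).1 * ((ρ y).1 - (ρ x).1) := by
    rw [mul_sub, ← Units.val_mul, ← Units.val_mul, ← map_mul, ← map_mul, inv_mul_cancel, map_one,
      Units.val_one]
  have h2 := congrFun (congrFun h1 i) j
  rw [Matrix.sub_apply, Matrix.mul_apply] at h2
  rw [h2]
  exact Finset.dvd_sum fun k _ => (h k j).mul_left _

variable [TopologicalSpace G]

lemma continuous_entry_of_continuous (hρ : Continuous ρ) (i j : Fin m) :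
    Continuous fun x => (ρ x).1 i j :=
  (Units.continuous_val.comp hρ).matrix_elem i j

lemma measureReal_le_card_mul {X T : Type*} [MeasurableSpace X] {ν : Measure X} [IsFiniteMeasure ν]
    [Fintype T] {s : Set X} {S : T → Set X} {c : ℝ} (hcover : s ⊆ ⋃ t, S t)
    (hS : ∀ t, ν.real (S t) ≤ c) : ν.real s ≤ Fintype.card T * c := by
  calc ν.real s ≤ ∑ t, ν.real (S t) :=
        (measureReal_mono hcover).trans (measureReal_iUnion_fintype_le S)
    _ ≤ ∑ _t : T, c := Finset.sum_le_sum fun t _ => hS t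
    _ = _ := by rw [Finset.sum_const, Finset.card_univ, nsmul_eq_mul]

lemma isOpen_congruenceFiltration (hρ : Continuous ρ) (n : ℕ) :
    IsOpen (congruenceFiltration ρ n : Set G) := by
  have h1 : (congruenceFiltration ρ n : Set G) = ⋂ i, ⋂ j, (fun x => (ρ x).1 i j) ⁻¹'
      Metric.closedBall ((1 : Matrix (Fin m) (Fin m) ℤ_[p]) i j) ((p : ℝ) ^ (-(n : ℤ))) := by
    ext x
    simp only [SetLike.mem_coe, mem_congruenceFiltration, Set.mem_iInter, Set.mem_preimage,
      Metric.mem_closedBall, dist_eq_norm, PadicInt.norm_le_pow_iff_mem_span_pow,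
      Ideal.mem_span_singleton]
  rw [h1]
  have hp : (p : ℝ) ^ (-(n : ℤ)) ≠ 0 :=
    zpow_ne_zero _ (Nat.cast_ne_zero.2 (Fact.out : p.Prime).ne_zero)
  exact isOpen_iInter_of_finite fun i => isOpen_iInter_of_finite fun j =>
    (IsUltrametricDist.isOpen_closedBall _ hp).preimage (continuous_entry_of_continuous hρ i j)

/-- The embedding of `G` into the matrices over `ℤ_p`, which are regarded as a metric space. -/
lemma isEmbedding_entries [CompactSpace G] (hρ : Continuous ρ) (hinj : Function.Injective ρ) :
    Topology.IsEmbedding fun (x : G) (i j : Fin m) => (ρ x).1 i j := by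
  refine (Continuous.isClosedEmbedding ?_ ?_).isEmbedding
  · exact continuous_pi fun i => continuous_pi fun j => continuous_entry_of_continuous hρ i j
  · exact fun x y h => hinj (Units.ext h)

variable [IsTopologicalGroup G] [CompactSpace G] [MeasurableSpace G] [BorelSpace G]
variable (μ : Measure G) [IsProbabilityMeasure μ] [μ.IsMulLeftInvariant]

/-- `G_n` is covered by the cosets of `G_{n+1}` that belong to the possible values modulo `p` of
the matrices `p ^ (-n) (x - 1)`. -/
lemma measureReal_congruenceFiltration_le (n : ℕ) :
    μ.real (congruenceFiltration ρ n : Set G)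
      ≤ Fintype.card (Fin m → Fin m → ZMod (p ^ 1))
        * μ.real (congruenceFiltration ρ (n + 1) : Set G) := by
  classical
  have hdvd : ∀ x ∈ congruenceFiltration ρ n, ∃ u : Fin m → Fin m → ℤ_[p], ∀ i j,
      (ρ x).1 i j = (1 : Matrix (Fin m) (Fin m) ℤ_[p]) i j + (p : ℤ_[p]) ^ n * u i j := by
    intro x hx
    choose u hu using mem_congruenceFiltration.1 hx
    exact ⟨u, fun i j => by rw [← hu i j]; ring⟩
  choose! u hu using hdvd
  let κ : G → Fin m → Fin m → ZMod (p ^ 1) := fun x i j => PadicInt.toZModPow 1 (u x i j)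
  have hκ : ∀ x ∈ congruenceFiltration ρ n, ∀ y ∈ congruenceFiltration ρ n, κ y = κ x →
      x⁻¹ * y ∈ congruenceFiltration ρ (n + 1) := by
    intro x hx y hy h
    refine inv_mul_mem_congruenceFiltration fun i j => ?_
    obtain ⟨v, hv⟩ := toZModPow_eq_iff.1 (congrFun (congrFun h i) j)
    exact ⟨v, by linear_combination hu y hy i j - hu x hx i j + (p : ℤ_[p]) ^ n * hv⟩
  clear_value κ
  refine measureReal_le_card_mul (S := fun c => {x | x ∈ congruenceFiltration ρ n ∧ κ x = c})
    (fun x hx => Set.mem_iUnion.2 ⟨κ x, hx, rfl⟩) fun c => ?_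
  rcases {x | x ∈ congruenceFiltration ρ n ∧ κ x = c}.eq_empty_or_nonempty with he | ⟨x, hx, hxc⟩
  · rw [he, measureReal_empty]
    exact measureReal_nonneg
  · have hsub : {x | x ∈ congruenceFiltration ρ n ∧ κ x = c}
        ⊆ (fun y => x⁻¹ * y) ⁻¹' (congruenceFiltration ρ (n + 1) : Set G) := by
      rintro y ⟨hy, hyc⟩
      exact hκ x hx y hy (hyc.trans hxc.symm)
    refine (measureReal_mono hsub).trans (le_of_eq ?_)
    rw [measureReal_def, measure_preimage_mul, ← measureReal_def]

lemma isFiltration_congruenceFiltration (hρ : Continuous ρ) :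
    IsFiltration μ (congruenceFiltration ρ) (Fintype.card (Fin m → Fin m → ZMod (p ^ 1))) where
  normal n := by unfold congruenceFiltration; infer_instance
  isOpen := isOpen_congruenceFiltration hρ
  anti := congruenceFiltration_antitone
  zero := congruenceFiltration_zero
  one_le := by exact_mod_cast Fintype.card_pos
  doubling := measureReal_congruenceFiltration_le μ

end Congruence

lemma weightedMeasure_zero {G : Type*} [Group G] [MeasurableSpace G] (μ : Measure G)
    (F : ℕ → Subgroup G) (d : ℕ) : weightedMeasure μ F d 0 = μ := by
  simp [weightedMeasure]

/-- A manifold modelled on `ℚ_p ^ d` with `d > 0` has no isolated points. -/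
lemma punctured_nhds_neBot_of_chartedSpace {p : ℕ} [Fact p.Prime] {d : ℕ} (hd : 0 < d) {X : Type*}
    [TopologicalSpace X] [ChartedSpace (Fin d → ℚ_[p]) X] (x : X) :
    (nhdsWithin x {x}ᶜ).NeBot := by
  have hne : Nonempty (Fin d) := Fin.pos_iff_nonempty.1 hd
  by_contra hbot
  rw [Filter.not_neBot, ← isOpen_singleton_iff_punctured_nhds] at hbot
  have h1 := (chartAt (Fin d → ℚ_[p]) x).isOpen_image_of_subset_source hbot
    (Set.singleton_subset_iff.2 (mem_chart_source _ x))
  rw [Set.image_singleton, isOpen_singleton_iff_punctured_nhds] at h1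
  exact (Module.punctured_nhds_neBot ℚ_[p] (Fin d → ℚ_[p]) _).ne h1

/-! ### The difference conditions -/

section Condition

variable {G : Type*} [Group G] [TopologicalSpace G] [IsTopologicalGroup G] [CompactSpace G]
variable [MeasurableSpace G] [BorelSpace G]
variable {μ : Measure G} [IsProbabilityMeasure μ] [μ.IsMulLeftInvariant]
variable {F : ℕ → Subgroup G} {D : ℝ}

lemma Symbol.diff_eq_zero (σ : Symbol G) {ι κ : Type} [Fintype ι] [DecidableEq ι] [Fintype κ]
    [DecidableEq κ] {η : UnitaryRep G ι} (hη : η.TrivialOn ⊤) (ξ : UnitaryRep G κ) :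
    σ.diff η ξ = 0 := by
  have h1 : η = UnitaryRep.one G ι := UnitaryRep.ext_toHom fun x => hη x trivial
  rw [Symbol.diff, h1, sub_self]

lemma UnitaryRep.TrivialOn.level_mem {ι : Type} [Fintype ι] [DecidableEq ι] {η : UnitaryRep G ι}
    {l : ℕ} (h : η.TrivialOn (F l)) : η.TrivialOn (F (η.level F)) :=
  Nat.sInf_mem (s := {n | ∀ x ∈ F n, η.toHom x = 1}) ⟨l, h⟩

lemma UnitaryRep.TrivialOn.level_le {ι : Type} [Fintype ι] [DecidableEq ι] {η : UnitaryRep G ι}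
    {l : ℕ} (h : η.TrivialOn (F l)) : η.level F ≤ l :=
  Nat.sInf_le (s := {n | ∀ x ∈ F n, η.toHom x = 1}) h

lemma UnitaryRep.norm_rpow {ι : Type} [Fintype ι] [DecidableEq ι] {η : UnitaryRep G ι}
    (h : η.level F ≠ 0) (d : ℕ) (s : ℝ) :
    η.norm μ F d ^ s = μ.real (F (η.level F) : Set G) ^ (-(s / d)) := by
  rw [UnitaryRep.norm, UnitaryRep.abs, if_neg h, ← Real.rpow_mul (by positivity),
    Real.inv_rpow measureReal_nonneg, ← Real.rpow_neg measureReal_nonneg, one_div_mul_eq_div]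

/-- Both difference conditions have the shape `‖Δ_η^β σ(ξ)‖ ≤ C ‖ξ‖ ^ (-γ)` with `β ≤ γ`; as
`‖η‖ ≥ 1` for nontrivial `η`, they bound `Δ_η σ(ξ)` by `C (‖η‖ / ‖ξ‖) ^ γ`. -/
theorem IsFiltration.isDiffBound (hF : IsFiltration μ F D) {σ : Symbol G} {d : ℕ} (hd : 0 < d)
    {C β γ : ℝ} (hC : 0 ≤ C) (hβγ : β ≤ γ) (hγ : 0 ≤ γ)
    (h : ∀ η ξ : Irrep G, η.rep.norm μ F d < ξ.rep.norm μ F d →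
      opNorm (σ.wdiff μ F d β η.rep ξ.rep) ≤ C * ξ.rep.norm μ F d ^ (-γ)) :
    IsDiffBound μ F σ C (γ / d) := by
  intro l n hl η ξ hη hξ hξ'
  have hd' : (0 : ℝ) < d := Nat.cast_pos.2 hd
  have hcn := hF.vol_pos (n + 1)
  have hcl := hF.vol_pos l
  have hlevξ : ξ.rep.level F = n + 1 := by
    refine le_antisymm hξ.level_le (not_lt.1 fun hlt => hξ' ?_)
    exact hξ.level_mem.mono (hF.anti (Nat.lt_succ_iff.1 hlt))
  by_cases h0 : η.rep.level F = 0
  · have h1 := hη.level_mem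
    rw [h0, hF.zero] at h1
    rw [σ.diff_eq_zero h1, opNorm_zero]
    positivity
  set k := η.rep.level F with hk
  have hkl : k ≤ l := hη.level_le
  have hck := hF.vol_pos k
  have hne : F n ≠ F (n + 1) := fun heq => hξ' (heq ▸ hξ)
  have hlt : μ.real (F (n + 1) : Set G) < μ.real (F k : Set G) := by
    have h1 := hF.two_mul_vol_le (Nat.le_succ n) hne
    have h2 := hF.vol_anti (hkl.trans hl)
    change 2 * μ.real (F (n + 1) : Set G) ≤ _ at h1
    linarith
  have hnorm : η.rep.norm μ F d < ξ.rep.norm μ F d := by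
    have h1 := UnitaryRep.norm_rpow (μ := μ) h0 d 1
    have h2 := UnitaryRep.norm_rpow (μ := μ) (F := F) (η := ξ.rep)
      (by rw [hlevξ]; exact Nat.succ_ne_zero n) d 1
    rw [Real.rpow_one] at h1 h2
    rw [h1, h2, hlevξ]
    exact Real.rpow_lt_rpow_of_neg hcn hlt (neg_lt_zero.2 (by positivity))
  have hmain := h η ξ hnorm
  rw [Symbol.wdiff, opNorm_smul, Complex.norm_real, Real.norm_eq_abs, UnitaryRep.norm_rpow h0,
    UnitaryRep.norm_rpow (by rw [hlevξ]; exact Nat.succ_ne_zero n), hlevξ, ← hk,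
    Real.rpow_neg hck.le, one_div, inv_inv, abs_of_nonneg (by positivity), neg_div, neg_neg,
    ← le_div_iff₀' (by positivity)] at hmain
  refine hmain.trans ?_
  rw [Real.div_rpow hcn.le hcl.le, mul_div_assoc]
  refine mul_le_mul_of_nonneg_left ?_ hC
  refine div_le_div_of_nonneg_left (by positivity) (by positivity) ?_
  calc μ.real (F l : Set G) ^ (γ / d) ≤ μ.real (F k : Set G) ^ (γ / d) :=
        Real.rpow_le_rpow hcl.le (hF.vol_anti hkl) (by positivity)
    _ ≤ μ.real (F k : Set G) ^ (β / d) :=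
        Real.rpow_le_rpow_of_exponent_ge hck (hF.vol_le_one k) (by gcongr)

end Condition

end PadicMultiplier

end

/-- The weighted bound under a difference condition with exponents `β ≤ γ`, `d < γ`. -/
theorem PadicMultiplier.extendsToBounded_of_wdiff_le {p : ℕ} [Fact p.Prime] {d : ℕ} (hd : 0 < d)
    {m : ℕ} {G : Type*} [Group G] [TopologicalSpace G] [CompactSpace G]
    [ChartedSpace (Fin d → ℚ_[p]) G] [LieGroup 𝓘(ℚ_[p], Fin d → ℚ_[p]) ω G]
    (ρ : G →* Matrix.GeneralLinearGroup (Fin m) ℤ_[p])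
    (hρ_cont : Continuous ρ) (hρ_inj : Function.Injective ρ)
    [MeasurableSpace G] [BorelSpace G]
    (μ : Measure G) [μ.IsHaarMeasure] [IsProbabilityMeasure μ]
    (σ : PadicMultiplier.Symbol G) (hσ : σ.IsBounded) {β γ C : ℝ} (hβγ : β ≤ γ) (hγ : d < γ)
    (hC : 0 < C)
    (h : ∀ η ξ : PadicMultiplier.Irrep G,
      η.rep.norm μ (PadicMultiplier.congruenceFiltration ρ) d
          < ξ.rep.norm μ (PadicMultiplier.congruenceFiltration ρ) d →
      PadicMultiplier.opNorm (σ.wdiff μ (PadicMultiplier.congruenceFiltration ρ) d β η.rep ξ.rep)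
        ≤ C * ξ.rep.norm μ (PadicMultiplier.congruenceFiltration ρ) d ^ (-γ))
    {r : ℝ} (hr : 1 < r) {α : ℝ} (hα : -(d : ℝ) < α) (hα' : α < (r - 1) * (d : ℝ)) :
    PadicMultiplier.ExtendsToBounded (PadicMultiplier.congruenceFiltration ρ) (σ.multiplier μ)
      (PadicMultiplier.weightedMeasure μ (PadicMultiplier.congruenceFiltration ρ) d α) r hr.le := by
  have hgroup : IsTopologicalGroup G :=
    topologicalGroup_of_lieGroup 𝓘(ℚ_[p], Fin d → ℚ_[p]) ω
  have hmetr : TopologicalSpace.MetrizableSpace G :=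
    (PadicMultiplier.isEmbedding_entries hρ_cont hρ_inj).metrizableSpace
  have hneBot : (nhdsWithin (1 : G) {1}ᶜ).NeBot :=
    PadicMultiplier.punctured_nhds_neBot_of_chartedSpace (p := p) hd 1
  have hatom : μ {1} = 0 := measure_singleton 1
  have hd' : (0 : ℝ) < d := Nat.cast_pos.2 hd
  have hF := PadicMultiplier.isFiltration_congruenceFiltration μ hρ_cont
  obtain ⟨B, hB⟩ := hσ
  refine hF.extendsToBounded_multiplier σ
    (fun x hx => PadicMultiplier.exists_notMem_congruenceFiltration hρ_inj hx) hatom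
    (le_max_right B 0) (fun ξ => (hB ξ).trans (le_max_left B 0)) hC.le ((one_lt_div hd').2 hγ)
    (hF.isDiffBound hd hC.le hβγ (hd'.trans hγ).le h) hr ?_ ?_
  · rwa [lt_div_iff₀ hd', neg_one_mul]
  · rwa [div_lt_iff₀ hd']

theorem mainTheorem5 {p : ℕ} [Fact p.Prime] {d : ℕ} (hd : 0 < d) {m : ℕ}
    {G : Type*} [Group G] [TopologicalSpace G] [CompactSpace G]
    [ChartedSpace (Fin d → ℚ_[p]) G] [LieGroup 𝓘(ℚ_[p], Fin d → ℚ_[p]) ω G]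
    (ρ : G →* Matrix.GeneralLinearGroup (Fin m) ℤ_[p])
    (hρ_cont : Continuous ρ) (hρ_inj : Function.Injective ρ)
    [MeasurableSpace G] [BorelSpace G]
    (μ : Measure G) [μ.IsHaarMeasure] [IsProbabilityMeasure μ]
    (σ : PadicMultiplier.Symbol G) (hσ : σ.IsBounded) :
    (∀ α₀ : ℝ, (d : ℝ) / 2 < α₀ →
      (∃ C : ℝ, 0 < C ∧ ∀ η ξ : PadicMultiplier.Irrep G,
        η.rep.norm μ (PadicMultiplier.congruenceFiltration ρ) d
            < ξ.rep.norm μ (PadicMultiplier.congruenceFiltration ρ) d →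
        PadicMultiplier.opNorm (σ.wdiff μ (PadicMultiplier.congruenceFiltration ρ) d
            (α₀ + (d : ℝ) / 2) η.rep ξ.rep)
          ≤ C * ξ.rep.norm μ (PadicMultiplier.congruenceFiltration ρ) d
              ^ (-(α₀ + (d : ℝ) / 2))) →
      ∀ (r : ℝ) (hr : 1 < r),
        PadicMultiplier.ExtendsToBounded (PadicMultiplier.congruenceFiltration ρ)
          (σ.multiplier μ) μ r hr.le) ∧
    (∀ t : ℝ, 1 < t → t < 2 → ∀ α₀ : ℝ, (d : ℝ) * (1 / t - 1 / 2) < α₀ →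
      (∃ C : ℝ, 0 < C ∧ ∀ η ξ : PadicMultiplier.Irrep G,
        η.rep.norm μ (PadicMultiplier.congruenceFiltration ρ) d
            < ξ.rep.norm μ (PadicMultiplier.congruenceFiltration ρ) d →
        PadicMultiplier.opNorm (σ.wdiff μ (PadicMultiplier.congruenceFiltration ρ) d
            (α₀ + (d : ℝ) / 2) η.rep ξ.rep)
          ≤ C * ξ.rep.norm μ (PadicMultiplier.congruenceFiltration ρ) d
              ^ (-(α₀ + (d : ℝ) * (3 / 2 - 1 / t)))) →
      ∀ (r : ℝ) (hr : 1 < r) (α : ℝ), -(d : ℝ) < α → α < (r - 1) * (d : ℝ) →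
        PadicMultiplier.ExtendsToBounded (PadicMultiplier.congruenceFiltration ρ)
          (σ.multiplier μ)
          (PadicMultiplier.weightedMeasure μ (PadicMultiplier.congruenceFiltration ρ) d α)
          r hr.le) := by
  have hd' : (0 : ℝ) < d := Nat.cast_pos.2 hd
  refine ⟨fun α₀ hα₀ ⟨C, hC, h⟩ r hr => ?_, fun t ht ht' α₀ hα₀ ⟨C, hC, h⟩ r hr α hα hα' => ?_⟩
  · have hmain := PadicMultiplier.extendsToBounded_of_wdiff_le hd ρ hρ_cont hρ_inj μ σ hσ le_rfl
      (by linarith) hC h hr (α := 0) (by linarith) (mul_pos (by linarith) hd')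
    rwa [PadicMultiplier.weightedMeasure_zero] at hmain
  · have ht0 : 1 / t < 1 := (div_lt_one (by linarith)).2 ht
    refine PadicMultiplier.extendsToBounded_of_wdiff_le hd ρ hρ_cont hρ_inj μ σ hσ ?_ ?_ hC h hr
      hα hα'
    · nlinarith
    · nlinarith
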